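/- Let $m_1,m_2\in\mathbb N$, $m=m_1+m_2$, $j=\mathrm{diag}(I_{m_1},-I_{m_2})$, $r>0$. Let $\mathcal U^{p\times q}[0,r]$ be the class of $p\times q$ matrix functions $G$ differentiable on $[0,r]$ with $G'(x)=G'(0)+\int_0^xG''(t)\,dt$, where $G''\in L_2^{p\times q}(0,r)$ (that is, the entries of $G$ belong to $W^{2,2}$), and put $\mathcal U^{p}=\mathcal U^{p\times1}$. An element of $L_2^{p}(0,r)$ is said to belong to $\mathcal U^{p}[0,r]$ if it has a representative there. Let $\beta\in\mathcal U^{m_2\times m}[0,r]$ satisfy $\beta(x) j\beta(x)^*\equiv0$ and $\beta'(x)j\beta(x)^*\equiv \mathrm iI_{m_2}$ on $[0,r]$, and consider on $L_2^{m_2}(0,r)$ the operators $$Af=\int_0^x(t-x)f(t)\,dt,\qquad Kf=\mathrm i\beta(x)j\int_0^x\beta(t)^*f(t)\,dt .$$ Construction of $V$. Put $R=\beta'j\beta'^*$ and $R'=\beta''j\beta'^*+\beta'j\beta''^*$. Let $u$ ($m_2\times m_2$) and $\Omega$ ($m\times m$) be the solutions on $[0,r]$ of $$u'=\tfrac{\mathrm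 i}{2}R\,u,\quad u(0)=I_{m_2};\qquad \Omega'=\mathrm i\beta^*\beta''j\,\Omega,\quad \Omega(0)=I_m,$$ where the second equation is understood almost everywhere with $\Omega$ absolutely continuous, and put $$u_4=u^*\Big(\tfrac34R^2+\tfrac{\mathrm i}{2}\big(\beta''j\beta'^*-\beta'j\beta''^*\big)\Big)u,\qquad \mathcal F(s,\eta)=h_1(s)h_2(\eta),\qquad h_1=\mathrm i\,u^*\beta''j\,\Omega,$$ $$h_2=(\Omega^{-1}\beta^*)''u=\Omega^{-1}\big(\beta''^*+\mathrm i\beta'^*R+\mathrm i\beta^*R'-\mathrm i\beta^*\beta''j(\beta'^*+\mathrm i\beta^*R)\big)u .$$ With $\breve{\mathcal F}(t,\eta)=\int_\eta^t\mathcal F(s,\eta)\,ds$ let, for $0\le\zeta\le x\le r$, $$\mathcal V_1(x,\zeta)=\tfrac12\Big(\int_0^{\frac{x+\zeta}2}u_4\,dt+\int_0^{\frac{x-\zeta}2}u_4\,dt-\int_{\frac{x+\zeta}2}^x\breve{\mathcal F}(t,x-t+\zeta)\,dt-\int_{\frac{x-\zeta}2}^{x-\zeta}\breve{\mathcal F}(t,x-t-\zeta)\,dt-\int_{x-\zeta}^x\breve{\mathcal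 F}(t,\zeta+t-x)\,dt\Big),$$ and, for $k\ge2$, $$\mathcal V_k(x,\zeta)=\tfrac12\Big(\int_{x-\zeta}^x\varphi_k(t,\zeta+t-x)\,dt+\int_{\frac{x+\zeta}2}^x\varphi_k(t,\zeta+x-t)\,dt+\int_{\frac{x-\zeta}2}^{x-\zeta}\varphi_k(t,x-t-\zeta)\,dt\Big),$$ $$\varphi_k(t,\eta)=\int_\eta^tu_4(s)\mathcal V_{k-1}(s,\eta)\,ds-\int_\eta^t\int_\eta^s\mathcal F(s,\xi)\mathcal V_{k-1}(\xi,\eta)\,d\xi\,ds .$$ Finally put $$\mathcal V=\sum_{k\ge1}\mathcal V_k,\qquad (Vf)(x)=u(x)\Big(f(x)+\int_0^x\mathcal V(x,t)f(t)\,dt\Big).$$ Then $u$ and $\Omega$ exist, $\Omega(x)$ is invertible for every $x\in[0,r]$, $u\in\mathcal U^{m_2\times m_2}[0,r]$, $u^*=u^{-1}$; the series for $\mathcal V(x,\zeta)$ converges for all $0\le\zeta\le x\le r$ and $\sup_{0\le\zeta\le x\le r}\|\mathcal V(x,\zeta)\|<\infty$; $A$, $K$ and $V$ are bounded operators in $L_2^{m_2}(0,r)$,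 $V$ has a bounded inverse, and $K=VAV^{-1}$. Moreover, $V$ and $V^{-1}$ map $\mathcal U^{m_2}[0,r]$ into $\mathcal U^{m_2}[0,r]$. -/

import Mathlib

open MeasureTheory Set
open scoped Matrix

namespace CanonSim

noncomputable section

/-- The scalar class behind `𝒰[0,r]` (the Sobolev class `W^{2,2}` on `[0,r]`): `g` is differentiable
on `[0,r]` (one-sidedly at the end points) with derivative `g'`, and `g'` is the indefinite integral
of the square integrable function `g''`. -/
structure IsU (r : ℝ) (g g' g'' : ℝ → ℂ) : Prop where
  hasDeriv : ∀ x ∈ Icc (0 : ℝ) r, HasDerivWithinAt g (g' x) (Icc 0 r) x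
  memLp : MemLp g'' 2 (volume.restrict (Ioo (0 : ℝ) r))
  integral_eq : ∀ x ∈ Icc (0 : ℝ) r, g' x = g' 0 + ∫ t in (0 : ℝ)..x, g'' t

/-- The class `𝒰^{p×q}[0,r]` of matrix functions, with first derivative `G'` and second
derivative `G''` (entrywise). -/
def IsUMat {p q : Type*} (r : ℝ) (G G' G'' : ℝ → Matrix p q ℂ) : Prop :=
  ∀ i k, IsU r (fun x => G x i k) (fun x => G' x i k) (fun x => G'' x i k)

/-- The class `𝒰^{n}[0,r]` of vector functions. -/
def MemUVec {n : ℕ} (r : ℝ) (f : ℝ → EuclideanSpace ℂ (Fin n)) : Prop :=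
  ∀ i, ∃ g' g'' : ℝ → ℂ, IsU r (fun x => f x i) g' g''

/-- The Hilbert space `L_2^n(0,r)`. -/
abbrev L2 (n : ℕ) (r : ℝ) : Type :=
  Lp (EuclideanSpace ℂ (Fin n)) 2 (volume.restrict (Ioo (0 : ℝ) r))

/-- An element of `L_2^n(0,r)` belongs to `𝒰^n[0,r]` (it has a representative in this class). -/
def MemU {n : ℕ} {r : ℝ} (F : L2 n r) : Prop :=
  ∃ f : ℝ → EuclideanSpace ℂ (Fin n), MemUVec r f ∧ F =ᵐ[volume.restrict (Ioo (0 : ℝ) r)] f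

/-- The matrix `j = diag(I_{m₁}, -I_{m₂})`. -/
def J (m₁ m₂ : ℕ) : Matrix (Fin m₁ ⊕ Fin m₂) (Fin m₁ ⊕ Fin m₂) ℂ :=
  Matrix.fromBlocks 1 0 0 (-1)

/-- Entrywise integral of a matrix function. -/
def matInt {p q : Type*} (a b : ℝ) (G : ℝ → Matrix p q ℂ) : Matrix p q ℂ :=
  Matrix.of fun i k => ∫ t in a..b, G t i k

/-- `Y` is the (Carathéodory) solution on `[0,r]` of `Y' = B Y`, `Y(0) = I`. -/
structure IsFundSol {n : Type*} [Fintype n] [DecidableEq n] (r : ℝ)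
    (B Y : ℝ → Matrix n n ℂ) : Prop where
  continuousOn : ContinuousOn Y (Icc 0 r)
  integral_eq : ∀ x ∈ Icc (0 : ℝ) r, Y x = 1 + matInt 0 x (fun t => B t * Y t)

section Coefficients

variable {m₁ m₂ : ℕ} (β β' β'' : ℝ → Matrix (Fin m₂) (Fin m₁ ⊕ Fin m₂) ℂ)

/-- `R = β' j β'^*`. -/
def R (x : ℝ) : Matrix (Fin m₂) (Fin m₂) ℂ := β' x * J m₁ m₂ * (β' x)ᴴ

/-- `R' = β'' j β'^* + β' j β''^*`. -/
def R' (x : ℝ) : Matrix (Fin m₂) (Fin m₂) ℂ :=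
  β'' x * J m₁ m₂ * (β' x)ᴴ + β' x * J m₁ m₂ * (β'' x)ᴴ

/-- The coefficient of the equation `u' = (i/2) β' j β'^* u` for the unitary factor `u`. -/
def coefU (x : ℝ) : Matrix (Fin m₂) (Fin m₂) ℂ := (Complex.I / 2) • R β' x

/-- The coefficient of the equation `Ω' = i β^* β'' j Ω`; its fundamental solution `Ω` yields the
inverse of the operator `I - i β''(x) j ∫_0^x β(t)^* · dt`. -/
def coefΩ (x : ℝ) : Matrix (Fin m₁ ⊕ Fin m₂) (Fin m₁ ⊕ Fin m₂) ℂ :=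
  Complex.I • ((β x)ᴴ * β'' x * J m₁ m₂)

/-- The self-adjoint potential
`u₄ = u^* ((3/4) R² + (i/2) (β'' j β'^* - β' j β''^*)) u`. -/
def u₄ (u : ℝ → Matrix (Fin m₂) (Fin m₂) ℂ) (x : ℝ) : Matrix (Fin m₂) (Fin m₂) ℂ :=
  (u x)ᴴ * ((3 / 4 : ℂ) • (R β' x * R β' x)
    + (Complex.I / 2) • (β'' x * J m₁ m₂ * (β' x)ᴴ - β' x * J m₁ m₂ * (β'' x)ᴴ)) * u x

/-- The left factor `h₁ = i u^* β'' j Ω` of the semi-separable kernel `ℱ(s,η) = h₁(s) h₂(η)`. -/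
def h₁ (u : ℝ → Matrix (Fin m₂) (Fin m₂) ℂ)
    (Ω : ℝ → Matrix (Fin m₁ ⊕ Fin m₂) (Fin m₁ ⊕ Fin m₂) ℂ) (x : ℝ) :
    Matrix (Fin m₂) (Fin m₁ ⊕ Fin m₂) ℂ :=
  Complex.I • ((u x)ᴴ * β'' x * J m₁ m₂ * Ω x)

/-- The right factor of `ℱ`, that is, `h₂ = (Ω⁻¹ β^*)'' u`, which is written out as
`h₂ = Ω⁻¹ (β''^* + i β'^* R + i β^* R' - i β^* β'' j (β'^* + i β^* R)) u`. -/
def h₂ (u : ℝ → Matrix (Fin m₂) (Fin m₂) ℂ)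
    (Ω : ℝ → Matrix (Fin m₁ ⊕ Fin m₂) (Fin m₁ ⊕ Fin m₂) ℂ) (x : ℝ) :
    Matrix (Fin m₁ ⊕ Fin m₂) (Fin m₂) ℂ :=
  (Ω x)⁻¹ * ((β'' x)ᴴ + Complex.I • ((β' x)ᴴ * R β' x) + Complex.I • ((β x)ᴴ * R' β' β'' x)
    - Complex.I • ((β x)ᴴ * β'' x * J m₁ m₂ * ((β' x)ᴴ + Complex.I • ((β x)ᴴ * R β' x)))) * u x

end Coefficients

section Kernel

variable {m : Type*} [Fintype m] {n : ℕ}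
  (v : ℝ → Matrix (Fin n) (Fin n) ℂ) (a : ℝ → Matrix (Fin n) m ℂ) (b : ℝ → Matrix m (Fin n) ℂ)

/-- `ℱ̆(t,η) = ∫_η^t a(s) b(η) ds`. -/
def Fbreve (t η : ℝ) : Matrix (Fin n) (Fin n) ℂ := matInt η t (fun s => a s * b η)

/-- The first term of the kernel series. -/
def kernelFirst (x ζ : ℝ) : Matrix (Fin n) (Fin n) ℂ :=
  (1 / 2 : ℂ) • (matInt 0 ((x + ζ) / 2) v + matInt 0 ((x - ζ) / 2) v
    - matInt ((x + ζ) / 2) x (fun t => Fbreve a b t (x - t + ζ))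
    - matInt ((x - ζ) / 2) (x - ζ) (fun t => Fbreve a b t (x - t - ζ))
    - matInt (x - ζ) x (fun t => Fbreve a b t (ζ + t - x)))

/-- `∫_η^t v(s) W(s,η) ds`. -/
def innerPot (W : ℝ → ℝ → Matrix (Fin n) (Fin n) ℂ) (t η : ℝ) : Matrix (Fin n) (Fin n) ℂ :=
  matInt η t (fun s => v s * W s η)

/-- `∫_η^t ∫_η^s a(s) b(ξ) W(ξ,η) dξ ds`. -/
def innerSep (W : ℝ → ℝ → Matrix (Fin n) (Fin n) ℂ) (t η : ℝ) : Matrix (Fin n) (Fin n) ℂ :=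
  matInt η t (fun s => matInt η s (fun ξ => a s * b ξ * W ξ η))

/-- The recursion step giving the next term of the kernel series from the term `W`. -/
def kernelStep (W : ℝ → ℝ → Matrix (Fin n) (Fin n) ℂ) (x ζ : ℝ) : Matrix (Fin n) (Fin n) ℂ :=
  (1 / 2 : ℂ) • (matInt (x - ζ) x (fun t => innerPot v W t (ζ + t - x))
    + matInt ((x + ζ) / 2) x (fun t => innerPot v W t (ζ + x - t))
    + matInt ((x - ζ) / 2) (x - ζ) (fun t => innerPot v W t (x - t - ζ))
    - matInt (x - ζ) x (fun t => innerSep a b W t (ζ + t - x))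
    - matInt ((x + ζ) / 2) x (fun t => innerSep a b W t (ζ + x - t))
    - matInt ((x - ζ) / 2) (x - ζ) (fun t => innerSep a b W t (x - t - ζ)))

/-- The terms of the kernel series; `kernelTerm k` is the term `𝒱_{k+1}`. -/
def kernelTerm : ℕ → ℝ → ℝ → Matrix (Fin n) (Fin n) ℂ
  | 0 => kernelFirst v a b
  | k + 1 => kernelStep v a b (kernelTerm k)

end Kernel

section Similarity

variable {m₁ m₂ : ℕ} (β β' β'' : ℝ → Matrix (Fin m₂) (Fin m₁ ⊕ Fin m₂) ℂ)
  (u : ℝ → Matrix (Fin m₂) (Fin m₂) ℂ)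
  (Ω : ℝ → Matrix (Fin m₁ ⊕ Fin m₂) (Fin m₁ ⊕ Fin m₂) ℂ)

/-- The terms `𝒱_{k+1}(x,ζ)` of the kernel series constructed from `β`. -/
def simTerm (k : ℕ) (x ζ : ℝ) : Matrix (Fin m₂) (Fin m₂) ℂ :=
  kernelTerm (u₄ β' β'' u) (h₁ β'' u Ω) (h₂ β β' β'' u Ω) k x ζ

/-- The kernel `𝒱(x,ζ) = ∑_{k ≥ 1} 𝒱_k(x,ζ)`. -/
def simKernel (x ζ : ℝ) : Matrix (Fin m₂) (Fin m₂) ℂ :=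
  ∑' k, simTerm β β' β'' u Ω k x ζ

end Similarity

section Operators

variable {m₁ m₂ : ℕ} {r : ℝ}

/-- `A f = ∫_0^x (t - x) f(t) dt`. -/
def IsOpA (A : L2 m₂ r →L[ℂ] L2 m₂ r) : Prop :=
  ∀ f : L2 m₂ r, A f =ᵐ[volume.restrict (Ioo (0 : ℝ) r)]
    fun x => ∫ t in (0 : ℝ)..x, ((t - x : ℝ) : ℂ) • f t

/-- `K f = i β(x) j ∫_0^x β(t)^* f(t) dt`. -/
def IsOpK (β : ℝ → Matrix (Fin m₂) (Fin m₁ ⊕ Fin m₂) ℂ) (K : L2 m₂ r →L[ℂ] L2 m₂ r) : Prop :=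
  ∀ f : L2 m₂ r, K f =ᵐ[volume.restrict (Ioo (0 : ℝ) r)]
    fun x => Matrix.toEuclideanLin (Complex.I • (β x * J m₁ m₂))
      (∫ t in (0 : ℝ)..x, Matrix.toEuclideanLin (β t)ᴴ (f t))

/-- `V f = u(x) (f(x) + ∫_0^x 𝒱(x,t) f(t) dt)`. -/
def IsOpV (u : ℝ → Matrix (Fin m₂) (Fin m₂) ℂ) (𝒱 : ℝ → ℝ → Matrix (Fin m₂) (Fin m₂) ℂ)
    (V : L2 m₂ r →L[ℂ] L2 m₂ r) : Prop :=
  ∀ f : L2 m₂ r, V f =ᵐ[volume.restrict (Ioo (0 : ℝ) r)]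
    fun x => Matrix.toEuclideanLin (u x)
      (f x + ∫ t in (0 : ℝ)..x, Matrix.toEuclideanLin (𝒱 x t) (f t))

end Operators

end

end CanonSim

namespace CanonSim

noncomputable section

/-! ### Triangle integrals -/

/-! Since βjβ* = 0 and β'jβ* = iI, two differentiations of y = Kf give y'' = iβ''j∫β*f − f with
vanishing data at 0, while A inverts −d²/dx² with the same data. Thus K is a lower order
perturbation of A, and I + 𝒱 is a transformation operator in the sense of Gelfand and Levitan: it
carries −d²/dx² into the operator attached to K, after a change of gauge.

The gauge is the unitary u. Substituting y = uz removes the first order term iRy' from the equation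
for y and leaves the potential u₄; the fundamental solution Ω allows ∫β*f to be eliminated, at the
price of the semi-separable term with kernel h₁h₂. The outcome is `opK_eq_unitary_mul`: if z has
zero data and z'' = u₄z − h₁∫h₂z − p, then K(up) = uz. Hence KV = VA follows once z = (I + 𝒱)Aφ is
shown to solve this equation with p = (I + 𝒱)φ.

Formally, this asks that 𝒱 solve a wave equation in (x,ζ) with a source depending linearly on 𝒱. The
coefficients are only square integrable, so the kernel is never differentiated. The series sums to a
bounded solution of the integral equation 𝒱 = `dAlembert` φ, where φ depends affinely on 𝒱
(`kernelTerm_bound` gives factorial decay of the terms, `exists_kernelSum` the equation). After even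
extension in ζ, `dAlembert` is an average over two characteristics, and a Fubini argument yields the
Duhamel identity `integral_dAlembert_second_primitive`: testing against g with g'' = f gives ∬φg
plus the second primitive of the test against f. This is the weak form of the wave equation. By
`matInt_fullPhi_mul`, the integral of φg is that of vz − a∫bz for z = g + 𝒱g, and the equation for z
results (`IsSeriesKernel.exists_intertwining`, `opK_comp_opV`).

V is invertible because it is multiplication by a unitary function times I plus a Volterra operator,
and some power of the latter has norm below one (`isUnit_one_add_of_volterra`).

For the class 𝒰, a function is split into a second primitive and a linear function. The even
extension of the latter has a kink at 0, which adds only the bounded term 𝒱(·,0) to the second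
derivative (`integral_dAlembert_id`); hence V preserves 𝒰. For the inverse, f in 𝒰 is corrected by V
applied to an affine function until its data vanish. The rest lies in the range of A, hence in that
of K, since K = A(I + T) with I + T invertible; and V⁻¹K = AV⁻¹ maps into the range of A, which lies
in 𝒰. -/

lemma integral_ite_lt_left {η x : ℝ} (hη : 0 ≤ η) (hx : η ≤ x) (f : ℝ → ℂ) :
    ∫ s in (0 : ℝ)..x, (if η < s then f s else 0) = ∫ s in η..x, f s := by
  rw [intervalIntegral.integral_of_le (hη.trans hx), intervalIntegral.integral_of_le hx,
    ← integral_indicator measurableSet_Ioc, ← integral_indicator measurableSet_Ioc]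
  congr 1
  ext s
  simp only [indicator, mem_Ioc]
  split_ifs <;> grind

lemma integral_ite_lt_right {s x : ℝ} (hs : 0 ≤ s) (hx : s ≤ x) (f : ℝ → ℂ) :
    ∫ η in (0 : ℝ)..x, (if η < s then f η else 0) = ∫ η in (0 : ℝ)..s, f η := by
  rw [intervalIntegral.integral_of_le (hs.trans hx), intervalIntegral.integral_of_le hs,
    integral_Ioc_eq_integral_Ioo, integral_Ioc_eq_integral_Ioo,
    ← integral_indicator measurableSet_Ioo, ← integral_indicator measurableSet_Ioo]
  refine integral_congr_ae ?_
  have h : ∀ᵐ η : ℝ, η ≠ x := by simp [ae_iff, measure_singleton]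
  filter_upwards [h] with η hη
  simp only [indicator, mem_Ioo]
  split_ifs <;> grind

/-- Fubini on the square for the integrand cut off to η < s. This one exchange underlies the product
rule for absolutely continuous functions, the repeated integration formula and the Duhamel identity.
-/
lemma integral_triangle_swap {x : ℝ} (hx : 0 ≤ x) {F : ℝ → ℝ → ℂ}
    (h : IntegrableOn (Function.uncurry F) (Ioc 0 x ×ˢ Ioc 0 x)) :
    ∫ η in (0 : ℝ)..x, ∫ s in η..x, F s η = ∫ s in (0 : ℝ)..x, ∫ η in (0 : ℝ)..s, F s η := by
  have hswap := intervalIntegral_intervalIntegral_swap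
    (F := fun s η => if η < s then F s η else 0) (a := 0) (b := x) (c := 0) (d := x) (by
      rw [uIoc_of_le hx]
      have hm : MeasurableSet {p : ℝ × ℝ | p.2 < p.1} :=
        measurableSet_lt measurable_snd measurable_fst
      refine (h.indicator hm).congr ?_
      filter_upwards with p
      simp [indicator, Function.uncurry])
  have h1 : ∫ η in (0 : ℝ)..x, ∫ s in η..x, F s η
      = ∫ η in (0 : ℝ)..x, ∫ s in (0 : ℝ)..x, (if η < s then F s η else 0) := by
    refine intervalIntegral.integral_congr fun η hη => ?_
    rw [uIcc_of_le hx] at hη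
    exact (integral_ite_lt_left hη.1 hη.2 _).symm
  have h2 : ∫ s in (0 : ℝ)..x, ∫ η in (0 : ℝ)..s, F s η
      = ∫ s in (0 : ℝ)..x, ∫ η in (0 : ℝ)..x, (if η < s then F s η else 0) := by
    refine intervalIntegral.integral_congr fun s hs => ?_
    rw [uIcc_of_le hx] at hs
    exact (integral_ite_lt_right hs.1 hs.2 _).symm
  rw [h1, h2, hswap]

/-! ### Absolutely continuous scalar functions -/

/-- `f` is absolutely continuous on `[0,r]` with almost everywhere derivative `f'`. -/
structure IsAC (r : ℝ) (f f' : ℝ → ℂ) : Prop where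
  intervalIntegrable : IntervalIntegrable f' volume 0 r
  integral_eq : ∀ x ∈ Icc (0 : ℝ) r, f x = f 0 + ∫ t in (0 : ℝ)..x, f' t

variable {r : ℝ} {f f' g g' : ℝ → ℂ}

lemma intervalIntegrable_mono {E : Type*} [NormedAddCommGroup E] {h : ℝ → E}
    (hh : IntervalIntegrable h volume 0 r) {x y : ℝ}
    (hx : x ∈ Icc (0 : ℝ) r) (hy : y ∈ Icc (0 : ℝ) r) : IntervalIntegrable h volume x y := by
  refine hh.mono_set ?_
  rw [uIcc_of_le (hx.1.trans hx.2)]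
  exact uIcc_subset_Icc hx hy

lemma zero_mem_Icc {x : ℝ} (hx : x ∈ Icc (0 : ℝ) r) : (0 : ℝ) ∈ Icc (0 : ℝ) r :=
  ⟨le_rfl, hx.1.trans hx.2⟩

lemma IsAC.integral_from_to (hf : IsAC r f f') {x y : ℝ} (hx : x ∈ Icc (0 : ℝ) r)
    (hy : y ∈ Icc (0 : ℝ) r) : ∫ t in x..y, f' t = f y - f x := by
  have h0 := zero_mem_Icc hx
  rw [hf.integral_eq x hx, hf.integral_eq y hy,
    ← intervalIntegral.integral_interval_sub_left
      (intervalIntegrable_mono hf.1 h0 hy) (intervalIntegrable_mono hf.1 h0 hx)]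
  ring

lemma continuousOn_primitive_Icc (hr : 0 ≤ r) {E : Type*} [NormedAddCommGroup E] [NormedSpace ℝ E]
    {h : ℝ → E} (hh : IntervalIntegrable h volume 0 r) :
    ContinuousOn (fun x => ∫ t in (0 : ℝ)..x, h t) (Icc 0 r) := by
  have := intervalIntegral.continuousOn_primitive_interval (f := h) (a := 0) (b := r) (μ := volume)
    (by rw [uIcc_of_le hr, integrableOn_Icc_iff_integrableOn_Ioc]
        rwa [intervalIntegrable_iff, uIoc_of_le hr] at hh)
  rwa [uIcc_of_le hr] at this

lemma IsAC.continuousOn (hf : IsAC r f f') : ContinuousOn f (Icc 0 r) := by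
  intro x hx
  exact ((continuousOn_const.add (continuousOn_primitive_Icc (hx.1.trans hx.2) hf.1)).congr
    fun y hy => hf.integral_eq y hy) x hx

lemma isAC_const (c : ℂ) : IsAC r (fun _ => c) (fun _ => 0) :=
  ⟨intervalIntegrable_const, fun x _ => by simp⟩

lemma isAC_primitive {h : ℝ → ℂ} (hh : IntervalIntegrable h volume 0 r) :
    IsAC r (fun x => ∫ t in (0 : ℝ)..x, h t) h :=
  ⟨hh, fun x _ => by simp⟩

lemma IsAC.add (hf : IsAC r f f') (hg : IsAC r g g') :
    IsAC r (fun x => f x + g x) (fun x => f' x + g' x) := by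
  refine ⟨hf.1.add hg.1, fun x hx => ?_⟩
  have h0 := zero_mem_Icc hx
  rw [intervalIntegral.integral_add (intervalIntegrable_mono hf.1 h0 hx)
    (intervalIntegrable_mono hg.1 h0 hx), hf.2 x hx, hg.2 x hx]
  ring

lemma IsAC.const_mul (c : ℂ) (hf : IsAC r f f') :
    IsAC r (fun x => c * f x) (fun x => c * f' x) := by
  refine ⟨hf.1.const_mul c, fun x hx => ?_⟩
  rw [intervalIntegral.integral_const_mul, hf.2 x hx]
  ring

lemma IsAC.neg (hf : IsAC r f f') : IsAC r (fun x => -f x) (fun x => -f' x) := by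
  simpa using hf.const_mul (-1)

lemma IsAC.sub (hf : IsAC r f f') (hg : IsAC r g g') :
    IsAC r (fun x => f x - g x) (fun x => f' x - g' x) := by
  simpa [sub_eq_add_neg] using hf.add hg.neg

lemma IsAC.sum {ι : Type*} (s : Finset ι) {F F' : ι → ℝ → ℂ} (h : ∀ i ∈ s, IsAC r (F i) (F' i)) :
    IsAC r (fun x => ∑ i ∈ s, F i x) (fun x => ∑ i ∈ s, F' i x) := by
  classical
  induction s using Finset.induction_on with
  | empty => simpa using isAC_const 0
  | insert a s ha ih =>
    simp only [Finset.sum_insert ha]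
    exact (h a (by simp)).add (ih fun i hi => h i (by simp [hi]))

lemma IsAC.conj (hf : IsAC r f f') : IsAC r (fun x => star (f x)) (fun x => star (f' x)) := by
  refine ⟨?_, fun x hx => ?_⟩
  · refine ⟨?_, ?_⟩
    · exact (ContinuousLinearMap.integrable_comp (Complex.conjCLE : ℂ →L[ℝ] ℂ) hf.1.1)
    · exact (ContinuousLinearMap.integrable_comp (Complex.conjCLE : ℂ →L[ℝ] ℂ) hf.1.2)
  · rw [hf.2 x hx, star_add]
    congr 1
    exact (intervalIntegral.intervalIntegral_conj).symm

lemma IsAC.congr (hf : IsAC r f f') (hr : 0 ≤ r) (h : EqOn g f (Icc 0 r))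
    (h' : ∀ᵐ x ∂(volume.restrict (Ioo 0 r)), g' x = f' x) : IsAC r g g' := by
  have h'' : f' =ᵐ[volume.restrict (Ioc 0 r)] g' := by
    rw [← restrict_Ioo_eq_restrict_Ioc]
    filter_upwards [h'] with x hx using hx.symm
  refine ⟨?_, fun x hx => ?_⟩
  · refine hf.1.congr_ae ?_
    rwa [uIoc_of_le hr]
  · rw [h hx, h ⟨le_rfl, hr⟩, hf.2 x hx]
    congr 1
    refine intervalIntegral.integral_congr_ae_restrict ?_
    rw [uIoc_of_le hx.1]
    exact ae_mono (Measure.restrict_mono (Ioc_subset_Ioc_right hx.2) le_rfl) h''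

lemma IsAC.intervalIntegrable_mul (hf : IntervalIntegrable f volume 0 r) (hr : 0 ≤ r)
    (hg : ContinuousOn g (Icc 0 r)) : IntervalIntegrable (fun x => f x * g x) volume 0 r :=
  hf.mul_continuousOn (by rwa [uIcc_of_le hr])

lemma integrableOn_mul_prod {x : ℝ} {p q : ℝ → ℂ} (hp : IntegrableOn p (Ioc 0 x))
    (hq : IntegrableOn q (Ioc 0 x)) :
    IntegrableOn (Function.uncurry fun s η => p s * q η) (Ioc 0 x ×ˢ Ioc 0 x) := by
  rw [IntegrableOn, Measure.volume_eq_prod, ← Measure.prod_restrict]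
  exact Integrable.mul_prod hp hq

/-- Integration by parts obtained from Fubini: the integral of f'(s)g'(η) over the triangle η < s is
evaluated in both orders, and the two answers differ by the boundary terms. -/
lemma IsAC.mul (hr : 0 ≤ r) (hf : IsAC r f f') (hg : IsAC r g g') :
    IsAC r (fun x => f x * g x) (fun x => f' x * g x + f x * g' x) := by
  have hi1 := IsAC.intervalIntegrable_mul hf.1 hr hg.continuousOn
  have hi2 := IsAC.intervalIntegrable_mul hg.1 hr hf.continuousOn
  simp only [mul_comm (g' _)] at hi2
  refine ⟨hi1.add hi2, fun x hx => ?_⟩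
  have h0 := zero_mem_Icc hx
  have hf' := intervalIntegrable_mono hf.1 h0 hx
  have hg' := intervalIntegrable_mono hg.1 h0 hx
  have key := integral_triangle_swap hx.1 (F := fun s η => f' s * g' η)
    (integrableOn_mul_prod ((intervalIntegrable_iff_integrableOn_Ioc_of_le hx.1).1 hf')
      ((intervalIntegrable_iff_integrableOn_Ioc_of_le hx.1).1 hg'))
  have e1 : ∫ η in (0 : ℝ)..x, ∫ s in η..x, f' s * g' η
      = ∫ η in (0 : ℝ)..x, (f x * g' η - f η * g' η) := by
    refine intervalIntegral.integral_congr fun η hη => ?_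
    rw [uIcc_of_le hx.1] at hη
    simp only [intervalIntegral.integral_mul_const]
    rw [hf.integral_from_to ⟨hη.1, hη.2.trans hx.2⟩ hx]
    ring
  have e2 : ∫ s in (0 : ℝ)..x, ∫ η in (0 : ℝ)..s, f' s * g' η
      = ∫ s in (0 : ℝ)..x, (f' s * g s - g 0 * f' s) := by
    refine intervalIntegral.integral_congr fun s hs => ?_
    rw [uIcc_of_le hx.1] at hs
    simp only [intervalIntegral.integral_const_mul]
    rw [hg.integral_from_to h0 ⟨hs.1, hs.2.trans hx.2⟩]
    ring
  have hi1' := intervalIntegrable_mono hi1 h0 hx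
  have hi2' := intervalIntegrable_mono hi2 h0 hx
  rw [e1, e2, intervalIntegral.integral_sub (hg'.const_mul _) hi2',
    intervalIntegral.integral_sub hi1' (hf'.const_mul _), intervalIntegral.integral_const_mul,
    intervalIntegral.integral_const_mul, hf.integral_from_to h0 hx,
    hg.integral_from_to h0 hx] at key
  rw [intervalIntegral.integral_add hi1' hi2']
  linear_combination key

lemma IsAC.eqOn_of_deriv_ae_eq (hr : 0 ≤ r) (hf : IsAC r f f') (hg : IsAC r g g') (h0 : f 0 = g 0)
    (h : ∀ᵐ x ∂(volume.restrict (Ioo 0 r)), f' x = g' x) : EqOn f g (Icc 0 r) := by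
  have h2 := hg.congr (g := g) (g' := f') hr (fun _ _ => rfl) h
  intro x hx
  rw [hf.2 x hx, h2.2 x hx, h0]

/-- The primitive of f' − g' vanishes on the whole interval, so Lebesgue's differentiation theorem
makes its density zero almost everywhere. This is how the pointwise constraints on β are
differentiated. -/
lemma IsAC.ae_eq_deriv_of_eqOn (hr : 0 ≤ r) (hf : IsAC r f f') (hg : IsAC r g g')
    (h : EqOn f g (Icc 0 r)) : ∀ᵐ x ∂(volume.restrict (Ioo 0 r)), f' x = g' x := by
  have hd := hf.sub hg
  have h3 := hd.1.ae_hasDerivAt_integral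
  rw [uIcc_of_le hr] at h3
  rw [ae_restrict_iff' measurableSet_Ioo]
  filter_upwards [h3] with x hx hx'
  have h4 := hx (Ioo_subset_Icc_self hx') 0 ⟨le_rfl, hr⟩
  have h5 : HasDerivAt (fun y => ∫ t in (0 : ℝ)..y, (f' t - g' t)) 0 x := by
    refine (hasDerivAt_const x (0 : ℂ)).congr_of_eventuallyEq ?_
    filter_upwards [Icc_mem_nhds hx'.1 hx'.2] with y hy
    have := hd.2 y hy
    simp only [h hy, h ⟨le_rfl, hr⟩, sub_self, zero_add] at this
    exact this.symm
  exact sub_eq_zero.1 (h4.unique h5)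

/-! ### The class `𝒰` -/

lemma memLp_intervalIntegrable (hr : 0 ≤ r) (h : MemLp f 2 (volume.restrict (Ioo 0 r))) :
    IntervalIntegrable f volume 0 r := by
  rw [intervalIntegrable_iff_integrableOn_Ioo_of_le hr]
  exact h.integrable one_le_two

variable {g'' : ℝ → ℂ}

lemma IsU.isAC_deriv (hr : 0 ≤ r) (h : IsU r g g' g'') : IsAC r g' g'' :=
  ⟨memLp_intervalIntegrable hr h.memLp, h.integral_eq⟩

lemma IsU.isAC (hr : 0 ≤ r) (h : IsU r g g' g'') : IsAC r g g' := by
  have hc := (h.isAC_deriv hr).continuousOn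
  refine ⟨ContinuousOn.intervalIntegrable (by rwa [uIcc_of_le hr]), fun x hx => ?_⟩
  have hsub : Icc 0 x ⊆ Icc 0 r := Icc_subset_Icc_right hx.2
  rw [intervalIntegral.integral_eq_sub_of_hasDeriv_right_of_le hx.1
    (fun y hy => (h.hasDeriv y (hsub hy)).continuousWithinAt.mono hsub)
    (f' := g') (fun y hy => ?_) (ContinuousOn.intervalIntegrable (by
      rw [uIcc_of_le hx.1]; exact hc.mono hsub))]
  · ring
  · have hy' : y ∈ Ioo 0 r := ⟨hy.1, hy.2.trans_le hx.2⟩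
    exact ((h.hasDeriv y (Ioo_subset_Icc_self hy')).hasDerivAt
      (Icc_mem_nhds hy'.1 hy'.2)).hasDerivWithinAt

/-- The first derivative is continuous because it is absolutely continuous, so the fundamental
theorem gives differentiability at every point, one-sidedly at the ends. -/
lemma isU_of_isAC (hg : IsAC r g g') (hg' : IsAC r g' g'')
    (h2 : MemLp g'' 2 (volume.restrict (Ioo 0 r))) : IsU r g g' g'' := by
  refine ⟨fun x hx => ?_, h2, hg'.2⟩
  have hr : 0 ≤ r := hx.1.trans hx.2
  have hc := hg'.continuousOn
  have h0 := zero_mem_Icc hx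
  have hd : HasDerivWithinAt (fun y => ∫ t in (0 : ℝ)..y, g' t) (g' x) (Icc 0 r) x := by
    have : Fact (x ∈ Icc (0 : ℝ) r) := ⟨hx⟩
    refine intervalIntegral.integral_hasDerivWithinAt_right
      (intervalIntegrable_mono hg.1 h0 hx) ?_ (hc x hx)
    exact hc.stronglyMeasurableAtFilter_nhdsWithin measurableSet_Icc x
  exact (hd.const_add (g 0)).congr (fun y hy => hg.2 y hy) (hg.2 x hx)

/-! ### Duhamel representation of the kernel series step -/

/-- The d'Alembert sum over the three characteristic segments. -/
def dAlembert (φ : ℝ → ℝ → ℂ) (x ζ : ℝ) : ℂ :=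
  (1 / 2) * ((∫ t in (x - ζ)..x, φ t (ζ + t - x)) + (∫ t in ((x + ζ) / 2)..x, φ t (ζ + x - t))
    + ∫ t in ((x - ζ) / 2)..(x - ζ), φ t (x - t - ζ))

/-- The even extension of a function on `[0,r]`, truncated to `[-r,r]`. -/
def evenExt {E : Type*} [Zero E] (r : ℝ) (f : ℝ → E) (ζ : ℝ) : E := if |ζ| ≤ r then f |ζ| else 0

/-- The even extension in the second variable of a kernel on the triangle `0 ≤ η ≤ t ≤ r`. -/
def evenKer (r : ℝ) (φ : ℝ → ℝ → ℂ) (t η : ℝ) : ℂ := if |η| ≤ t ∧ t ≤ r then φ t |η| else 0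

lemma evenExt_neg {E : Type*} [Zero E] (r : ℝ) (f : ℝ → E) (ζ : ℝ) :
    evenExt r f (-ζ) = evenExt r f ζ := by
  simp [evenExt]

lemma evenKer_neg (r : ℝ) (φ : ℝ → ℝ → ℂ) (t η : ℝ) : evenKer r φ t (-η) = evenKer r φ t η := by
  simp [evenKer]

lemma evenExt_of_mem {E : Type*} [Zero E] {r ζ : ℝ} (f : ℝ → E) (h : ζ ∈ Icc (0 : ℝ) r) :
    evenExt r f ζ = f ζ := by
  simp [evenExt, abs_of_nonneg h.1, h.2]

lemma integral_eq_integral_Ioi_add_neg {k : ℝ → ℂ} (hk : Integrable k) :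
    ∫ ζ, k ζ = ∫ ζ in Ioi (0 : ℝ), (k ζ + k (-ζ)) := by
  rw [integral_add hk.integrableOn hk.comp_neg.integrableOn, integral_comp_neg_Ioi, neg_zero,
    add_comm, ← setIntegral_union (by simp) measurableSet_Ioi hk.integrableOn hk.integrableOn,
    Iic_union_Ioi, setIntegral_univ]

lemma integral_eq_intervalIntegral_add_neg {k : ℝ → ℂ} (hk : Integrable k) {x : ℝ} (hx : 0 ≤ x)
    (h0 : ∀ ζ, x < |ζ| → k ζ = 0) :
    ∫ ζ, k ζ = ∫ ζ in (0 : ℝ)..x, (k ζ + k (-ζ)) := by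
  rw [integral_eq_integral_Ioi_add_neg hk, intervalIntegral.integral_of_le hx]
  refine (setIntegral_eq_of_subset_of_forall_sdiff_eq_zero measurableSet_Ioi
    Ioc_subset_Ioi_self fun ζ hζ => ?_).symm.symm
  have h1 : x < ζ := by
    by_contra h
    exact hζ.2 ⟨hζ.1, not_lt.1 h⟩
  have h2 : x < |ζ| := h1.trans_le (le_abs_self _)
  rw [h0 ζ h2, h0 (-ζ) (by rwa [abs_neg]), add_zero]

lemma integrable_evenExt {E : Type*} [NormedAddCommGroup E] {r : ℝ} (hr : 0 ≤ r) {f : ℝ → E}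
    (hf : IntervalIntegrable f volume 0 r) : Integrable (evenExt r f) := by
  rw [intervalIntegrable_iff_integrableOn_Ioc_of_le hr] at hf
  have h1 : Integrable (indicator (Ioc 0 r) f) := hf.integrable_indicator measurableSet_Ioc
  refine (h1.add h1.comp_neg).congr ?_
  have h0 : ∀ᵐ η : ℝ, η ≠ 0 := by simp [ae_iff, measure_singleton]
  filter_upwards [h0] with η hη
  simp only [evenExt, indicator, mem_Ioc, Pi.add_apply]
  rcases lt_or_gt_of_ne hη with h | h
  · rw [abs_of_neg h, if_neg (by grind)]
    simp [h]
  · rw [abs_of_pos h, if_neg (c := 0 < -η ∧ -η ≤ r) (by grind)]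
    simp [h]

lemma measurable_evenExt {E : Type*} [Zero E] [MeasurableSpace E] {r : ℝ} {f : ℝ → E}
    (hf : Measurable f) : Measurable (evenExt r f) :=
  Measurable.ite (measurableSet_le continuous_abs.measurable measurable_const)
    (hf.comp continuous_abs.measurable) measurable_const

section Kernel

variable {r : ℝ} {φ : ℝ → ℝ → ℂ} {c : ℝ → ℝ}

lemma measurable_evenKer (hφm : Measurable (Function.uncurry φ)) :
    Measurable (Function.uncurry (evenKer r φ)) := by
  have h1 : Measurable fun p : ℝ × ℝ => |p.2| := continuous_abs.measurable.comp measurable_snd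
  refine Measurable.ite ?_ (hφm.comp (measurable_fst.prodMk h1)) measurable_const
  exact (measurableSet_le h1 measurable_fst).inter (measurableSet_le measurable_fst measurable_const)

/-- The majorant depends on the second variable alone. Along a characteristic this variable is a
reflected translate of t, so a merely integrable c still dominates an integrable function. -/
lemma norm_evenKer_le (hφ : ∀ t η, 0 ≤ η → η ≤ t → t ≤ r → ‖φ t η‖ ≤ c η) (t η : ℝ) :
    ‖evenKer r φ t η‖ ≤ evenExt r c η := by
  unfold evenKer evenExt
  split_ifs with h1 h2 h2
  · exact hφ t _ (abs_nonneg _) h1.1 h1.2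
  · exact absurd (h1.1.trans h1.2) h2
  · rw [norm_zero]
    exact (norm_nonneg _).trans (hφ _ _ (abs_nonneg η) le_rfl h2)
  · simp

variable (hr : 0 ≤ r) (hφm : Measurable (Function.uncurry φ)) (hc : IntervalIntegrable c volume 0 r)
  (hφ : ∀ t η, 0 ≤ η → η ≤ t → t ≤ r → ‖φ t η‖ ≤ c η)

include hr hφm hc hφ

omit hr hc in
lemma intervalIntegrable_evenKer_comp {a : ℝ → ℝ} (ha : Measurable a)
    (hac : Integrable fun t => evenExt r c (a t)) (x y : ℝ) :
    IntervalIntegrable (fun t => evenKer r φ t (a t)) volume x y := by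
  have : Integrable (fun t => evenKer r φ t (a t)) := by
    refine hac.mono' ?_ ?_
    · exact ((measurable_evenKer hφm).comp (measurable_id.prodMk ha)).aestronglyMeasurable
    · filter_upwards with t using norm_evenKer_le hφ t _
  exact this.intervalIntegrable

/-- With φ extended evenly in η, the three segments become two full characteristics t ↦ x − t ± ζ.
The cut-off |η| ≤ t starts them at t = (x ± ζ)/2, and the one through x − ζ is reflected at t = x −
ζ, where its argument changes sign. -/
lemma dAlembert_eq {x ζ : ℝ} (hζ : 0 ≤ ζ) (hζx : ζ ≤ x) (hx : x ≤ r) :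
    dAlembert φ x ζ = (1 / 2) * ((∫ t in (0 : ℝ)..x, evenKer r φ t (x - t + ζ))
      + ∫ t in (0 : ℝ)..x, evenKer r φ t (x - t + -ζ)) := by
  have hce := integrable_evenExt hr hc
  have i1 : ∀ a b, IntervalIntegrable (fun t => evenKer r φ t (x - t + ζ)) volume a b := by
    refine intervalIntegrable_evenKer_comp hφm hφ (by fun_prop) ?_
    have := hce.comp_sub_left (x + ζ)
    refine this.congr (by filter_upwards with t; congr 1; ring)
  have i2 : ∀ a b, IntervalIntegrable (fun t => evenKer r φ t (x - t + -ζ)) volume a b := by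
    refine intervalIntegrable_evenKer_comp hφm hφ (by fun_prop) ?_
    have := hce.comp_sub_left (x - ζ)
    refine this.congr (by filter_upwards with t; congr 1; ring)
  have hne : ∀ a : ℝ, ∀ᵐ t : ℝ, t ≠ a := fun a => by simp [ae_iff, measure_singleton]
  have e1 : ∫ t in (0 : ℝ)..x, evenKer r φ t (x - t + ζ)
      = ∫ t in ((x + ζ) / 2)..x, φ t (ζ + x - t) := by
    rw [← intervalIntegral.integral_add_adjacent_intervals (i1 0 ((x + ζ) / 2)) (i1 _ _)]
    have : ∫ t in (0 : ℝ)..((x + ζ) / 2), evenKer r φ t (x - t + ζ) = 0 := by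
      refine intervalIntegral.integral_zero_ae ?_
      filter_upwards [hne ((x + ζ) / 2)] with t ht ht'
      rw [uIoc_of_le (by linarith)] at ht'
      have : t < (x + ζ) / 2 := lt_of_le_of_ne ht'.2 ht
      rw [evenKer, if_neg]
      rintro ⟨h, -⟩
      have := le_abs_self (x - t + ζ)
      linarith
    rw [this, zero_add]
    refine intervalIntegral.integral_congr fun t ht => ?_
    rw [uIcc_of_le (by linarith)] at ht
    have h0 : 0 ≤ x - t + ζ := by linarith [ht.2]
    simp only [evenKer, abs_of_nonneg h0]
    rw [if_pos ⟨by linarith [ht.1], by linarith [ht.2]⟩]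
    congr 1; ring
  have e2 : ∫ t in (0 : ℝ)..x, evenKer r φ t (x - t + -ζ)
      = (∫ t in ((x - ζ) / 2)..(x - ζ), φ t (x - t - ζ)) + ∫ t in (x - ζ)..x, φ t (ζ + t - x) := by
    rw [← intervalIntegral.integral_add_adjacent_intervals (i2 0 (x - ζ)) (i2 _ _),
      ← intervalIntegral.integral_add_adjacent_intervals (i2 0 ((x - ζ) / 2)) (i2 _ _)]
    have : ∫ t in (0 : ℝ)..((x - ζ) / 2), evenKer r φ t (x - t + -ζ) = 0 := by
      refine intervalIntegral.integral_zero_ae ?_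
      filter_upwards [hne ((x - ζ) / 2)] with t ht ht'
      rw [uIoc_of_le (by linarith)] at ht'
      have : t < (x - ζ) / 2 := lt_of_le_of_ne ht'.2 ht
      rw [evenKer, if_neg]
      rintro ⟨h, -⟩
      have := le_abs_self (x - t + -ζ)
      linarith
    rw [this, zero_add]
    congr 1
    · refine intervalIntegral.integral_congr fun t ht => ?_
      rw [uIcc_of_le (by linarith)] at ht
      have h0 : 0 ≤ x - t + -ζ := by linarith [ht.2]
      simp only [evenKer, abs_of_nonneg h0]
      rw [if_pos ⟨by linarith [ht.1], by linarith [ht.2]⟩]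
      congr 1
    · refine intervalIntegral.integral_congr fun t ht => ?_
      rw [uIcc_of_le (by linarith)] at ht
      have h0 : x - t + -ζ ≤ 0 := by linarith [ht.1]
      simp only [evenKer, abs_of_nonpos h0]
      rw [if_pos ⟨by linarith [ht.1], by linarith [ht.2]⟩]
      congr 1; ring
  rw [e1, e2, dAlembert]
  ring

/-- Folding the half line by evenness merges the two characteristics into a single integral over all
ζ. Fubini and the shift η = x − t + ζ then move the dependence on x from the kernel to the test
function. -/
lemma integral_dAlembert_mul {f : ℝ → ℂ} (hf : IntervalIntegrable f volume 0 r) {x : ℝ}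
    (hx0 : 0 ≤ x) (hx : x ≤ r) :
    ∫ ζ in (0 : ℝ)..x, dAlembert φ x ζ * f ζ
      = (1 / 2) * ∫ t in (0 : ℝ)..x, ∫ η, evenKer r φ t η * evenExt r f (η - (x - t)) := by
  have hce := integrable_evenExt hr hc
  have hfe := integrable_evenExt hr hf
  have hI : Integrable (Function.uncurry fun t ζ => evenKer r φ t (x - t + ζ) * evenExt r f ζ)
      ((volume.restrict (uIoc 0 x)).prod volume) := by
    -- Joint integrability comes from a convolution: the product |f(ζ)| c(x − t + ζ) is the
    -- integrand of |f| convolved with a reflected translate of c.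
    have h1 := (hfe.norm.convolution_integrand (ContinuousLinearMap.mul ℝ ℝ)
      (hce.comp_sub_left x))
    have h2 := h1.mono_measure (μ := (volume.restrict (uIoc 0 x)).prod volume)
      (Measure.prod_mono Measure.restrict_le_self le_rfl)
    refine h2.mono' ?_ ?_
    · refine AEStronglyMeasurable.mul ?_ ?_
      · refine ((measurable_evenKer hφm).comp (f := fun p : ℝ × ℝ => (p.1, x - p.1 + p.2))
          ?_).aestronglyMeasurable
        fun_prop
      · exact hfe.aestronglyMeasurable.comp_snd
    · filter_upwards with p
      simp only [Function.uncurry, norm_mul, ContinuousLinearMap.mul_apply']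
      rw [mul_comm]
      gcongr
      refine (norm_evenKer_le hφ _ _).trans (le_of_eq ?_)
      congr 1; ring
  have hprod := hI.integral_prod_right
  have e1 : ∫ ζ in (0 : ℝ)..x, dAlembert φ x ζ * f ζ
      = (1 / 2) * ∫ ζ, (∫ t in (0 : ℝ)..x, evenKer r φ t (x - t + ζ) * evenExt r f ζ) := by
    rw [integral_eq_intervalIntegral_add_neg (x := x) _ hx0, ← intervalIntegral.integral_const_mul]
    · refine intervalIntegral.integral_congr fun ζ hζ => ?_
      rw [uIcc_of_le hx0] at hζ
      simp only [intervalIntegral.integral_mul_const, evenExt_neg]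
      rw [dAlembert_eq hr hφm hc hφ hζ.1 hζ.2 hx, evenExt_of_mem f ⟨hζ.1, hζ.2.trans hx⟩]
      ring
    · intro ζ hζ
      rw [intervalIntegral.integral_mul_const]
      have : ∫ t in (0 : ℝ)..x, evenKer r φ t (x - t + ζ) = 0 := by
        refine intervalIntegral.integral_zero_ae ?_
        filter_upwards with t ht
        rw [uIoc_of_le hx0] at ht
        rw [evenKer, if_neg]
        rintro ⟨h, -⟩
        rw [abs_le] at h
        rcases lt_abs.1 hζ with h' | h'
        · linarith [h.2, ht.2]
        · linarith [h.1, ht.2]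
      rw [this, zero_mul]
    · refine hprod.congr ?_
      filter_upwards with ζ
      simp only [Function.uncurry]
      rw [intervalIntegral.integral_of_le hx0, uIoc_of_le hx0]
  rw [e1, ← intervalIntegral_integral_swap hI]
  congr 1
  refine intervalIntegral.integral_congr fun t _ => ?_
  rw [← integral_sub_right_eq_self (fun ζ => evenKer r φ t (x - t + ζ) * evenExt r f ζ) (x - t)]
  simp

lemma integrable_evenKer_mul_of_continuous {k : ℝ → ℂ} (hk : Continuous k) (t : ℝ) :
    Integrable fun η => evenKer r φ t η * k η := by
  have hce := integrable_evenExt hr hc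
  obtain ⟨B, hB⟩ := (isCompact_Icc (a := -r) (b := r)).exists_bound_of_continuousOn hk.continuousOn
  refine (hce.mul_const B).mono' ?_ ?_
  · exact (((measurable_evenKer hφm).comp (measurable_const.prodMk measurable_id)).mul
      hk.measurable).aestronglyMeasurable
  · filter_upwards with η
    rw [norm_mul]
    by_cases h : |η| ≤ r
    · exact mul_le_mul (norm_evenKer_le hφ t η) (hB η (abs_le.1 h)) (norm_nonneg _)
        ((norm_nonneg _).trans (norm_evenKer_le hφ t η))
    · have : evenKer r φ t η = 0 := by
        rw [evenKer, if_neg]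
        exact fun h' => h (h'.1.trans h'.2)
      simp [this, evenExt, h]

lemma intervalIntegrable_integral_evenKer_mul {k : ℝ → ℝ → ℂ}
    (hk : Continuous (Function.uncurry k)) {x : ℝ} (hx : 0 ≤ x) :
    IntervalIntegrable (fun t => ∫ η, evenKer r φ t η * k t η) volume 0 x := by
  have hce := integrable_evenExt hr hc
  obtain ⟨B, hB⟩ := ((isCompact_Icc (a := (0 : ℝ)) (b := x)).prod
    (isCompact_Icc (a := -r) (b := r))).exists_bound_of_continuousOn hk.continuousOn
  have hm : StronglyMeasurable (fun t => ∫ η, evenKer r φ t η * k t η) := by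
    refine StronglyMeasurable.integral_prod_right
      (f := fun t η => evenKer r φ t η * k t η) ?_
    exact ((measurable_evenKer hφm).mul hk.measurable).stronglyMeasurable
  rw [intervalIntegrable_iff_integrableOn_Icc_of_le hx]
  refine Measure.integrableOn_of_bounded (M := ∫ η, evenExt r c η * B) (by simp)
    hm.aestronglyMeasurable ?_
  filter_upwards [ae_restrict_mem measurableSet_Icc] with t ht
  refine norm_integral_le_of_norm_le (hce.mul_const B) ?_
  filter_upwards with η
  rw [norm_mul]
  by_cases h : |η| ≤ r
  · exact mul_le_mul (norm_evenKer_le hφ t η) (hB (t, η) ⟨ht, abs_le.1 h⟩) (norm_nonneg _)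
      ((norm_nonneg _).trans (norm_evenKer_le hφ t η))
  · have : evenKer r φ t η = 0 := by
      rw [evenKer, if_neg]
      exact fun h' => h (h'.1.trans h'.2)
    simp [this, evenExt, h]

omit hr hφm hc hφ in
-- Reflection shows that the integral equals its own negative. It removes the first order term of
-- the Taylor expansions in the two Duhamel identities, so no boundary data of the kernel are needed
-- there.
lemma integral_evenKer_mul_odd {k : ℝ → ℂ} (hk : ∀ η, k (-η) = -k η) (t : ℝ) :
    ∫ η, evenKer r φ t η * k η = 0 := by
  have h := integral_neg_eq_self (fun η => evenKer r φ t η * k η) volume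
  simp only [evenKer_neg, hk, mul_neg, integral_neg] at h
  have h2 : (2 : ℂ) * ∫ η, evenKer r φ t η * k η = 0 := by linear_combination -h
  simpa using h2

lemma integral_evenKer_mul_even {g : ℝ → ℂ} {k : ℝ → ℂ} (hk : Continuous k) {t : ℝ} (ht : 0 ≤ t)
    (htr : t ≤ r) (hkg : ∀ η, |η| ≤ r → k η = g |η|) :
    ∫ η, evenKer r φ t η * k η = 2 * ∫ η in (0 : ℝ)..t, φ t η * g η := by
  rw [integral_eq_intervalIntegral_add_neg
    (integrable_evenKer_mul_of_continuous hr hφm hc hφ hk t) ht,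
    ← intervalIntegral.integral_const_mul]
  · refine intervalIntegral.integral_congr fun η hη => ?_
    rw [uIcc_of_le ht] at hη
    have ha : |η| = η := abs_of_nonneg hη.1
    simp only [evenKer_neg]
    rw [hkg η (by rw [ha]; exact hη.2.trans htr), hkg (-η) (by
      rw [abs_neg, ha]; exact hη.2.trans htr), abs_neg, evenKer, ha, if_pos ⟨hη.2, htr⟩]
    ring
  · intro η hη
    rw [evenKer, if_neg (fun h => absurd h.1 (not_le.2 hη)), zero_mul]

end Kernel

/-! ### The Duhamel identity -/

/-- Taylor's formula with integral remainder for a second primitive. -/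
lemma taylor_second_primitive {h : ℝ → ℂ} (hh : Integrable h) (η s : ℝ) :
    ∫ τ in (0 : ℝ)..(η - s), ((η - s - τ : ℝ) : ℂ) * h τ
      = (∫ τ in (0 : ℝ)..η, ((η - τ : ℝ) : ℂ) * h τ) - s * (∫ τ in (0 : ℝ)..η, h τ)
        + ∫ σ in (0 : ℝ)..s, ((s - σ : ℝ) : ℂ) * h (η - σ) := by
  have hi : ∀ a b, IntervalIntegrable h volume a b := fun a b => hh.intervalIntegrable
  have hi' : ∀ a b, IntervalIntegrable (fun τ : ℝ => (τ : ℂ) * h τ) volume a b := fun a b =>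
    (hi a b).continuousOn_mul (by fun_prop)
  have e : ∀ a b d : ℝ, ∫ τ in a..b, ((d - τ : ℝ) : ℂ) * h τ
      = d * (∫ τ in a..b, h τ) - ∫ τ in a..b, (τ : ℂ) * h τ := by
    intro a b d
    rw [← intervalIntegral.integral_const_mul, ← intervalIntegral.integral_sub
      ((hi a b).const_mul _) (hi' a b)]
    refine intervalIntegral.integral_congr fun τ _ => ?_
    push_cast
    ring
  have e2 : ∫ σ in (0 : ℝ)..s, ((s - σ : ℝ) : ℂ) * h (η - σ)
      = - ∫ τ in (η - s)..η, ((η - s - τ : ℝ) : ℂ) * h τ := by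
    have := intervalIntegral.integral_comp_sub_left (a := 0) (b := s)
      (fun τ => ((s - (η - τ) : ℝ) : ℂ) * h τ) η
    simp only [sub_sub_cancel, sub_zero] at this
    rw [this, ← intervalIntegral.integral_neg]
    refine intervalIntegral.integral_congr fun τ _ => ?_
    push_cast
    ring
  rw [e2, e, e, e, ← intervalIntegral.integral_interval_sub_left (hi 0 η) (hi 0 (η - s)),
    ← intervalIntegral.integral_interval_sub_left (hi' 0 η) (hi' 0 (η - s))]
  push_cast
  ring

/-- If `Ψ(t,x-t)` is obtained from `Ψ(t,0)` by integrating `Ψ₁` twice along the second variable,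
then the same holds for the integrals along the lines `t + s = x`. -/
lemma integral_shift_of_taylor {x : ℝ} (hx : 0 ≤ x) {Ψ Ψ₁ : ℝ → ℝ → ℂ}
    (hm : Measurable (Function.uncurry Ψ₁)) {κ : ℝ → ℝ} (hκ : Integrable κ)
    (hb : ∀ᵐ σ, ∀ t, ‖Ψ₁ t σ‖ ≤ κ σ)
    (h0 : IntervalIntegrable (fun t => Ψ t 0) volume 0 x)
    (h1 : IntervalIntegrable (fun t => Ψ t (x - t)) volume 0 x)
    (hT : ∀ t ∈ Icc 0 x, Ψ t (x - t) = Ψ t 0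
      + ∫ σ in (0 : ℝ)..(x - t), ((x - t - σ : ℝ) : ℂ) * Ψ₁ t σ) :
    ∫ t in (0 : ℝ)..x, Ψ t (x - t) = (∫ t in (0 : ℝ)..x, Ψ t 0)
      + ∫ y in (0 : ℝ)..x, ((x - y : ℝ) : ℂ) * ∫ t in (0 : ℝ)..y, Ψ₁ t (y - t) := by
  -- On the square, x − y is at most x and Ψ₁ is at most κ(y − t), so the integrand is dominated by
  -- x times the convolution integrand of κ with the indicator of (0,x].
  have hI : IntegrableOn (Function.uncurry fun y t => ((x - y : ℝ) : ℂ) * Ψ₁ t (y - t))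
      (Ioc 0 x ×ˢ Ioc 0 x) := by
    have hone : Integrable (indicator (Ioc 0 x) (fun _ => (1 : ℝ))) :=
      (integrable_indicator_iff measurableSet_Ioc).2 (by simp)
    have h2 := (hone.convolution_integrand (ContinuousLinearMap.mul ℝ ℝ) hκ).const_mul x
    refine Integrable.mono' (g := fun p : ℝ × ℝ => x * ((ContinuousLinearMap.mul ℝ ℝ)
      (indicator (Ioc 0 x) (fun _ => (1 : ℝ)) p.2) (κ (p.1 - p.2)))) ?_ ?_ ?_
    · exact h2.integrableOn
    · have : Measurable fun p : ℝ × ℝ => Ψ₁ p.2 (p.1 - p.2) :=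
        hm.comp (f := fun p : ℝ × ℝ => (p.2, p.1 - p.2)) (by fun_prop)
      refine (Measurable.mul ?_ this).aestronglyMeasurable
      fun_prop
    · have hb' : ∀ᵐ p : ℝ × ℝ, ∀ t, ‖Ψ₁ t (p.1 - p.2)‖ ≤ κ (p.1 - p.2) :=
        (quasiMeasurePreserving_sub_of_right_invariant volume volume).ae hb
      filter_upwards [ae_restrict_mem (measurableSet_Ioc.prod measurableSet_Ioc),
        ae_restrict_of_ae hb'] with p hp hb'
      simp only [Function.uncurry, ContinuousLinearMap.mul_apply', norm_mul, Complex.norm_real,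
        indicator_of_mem hp.2, one_mul]
      refine mul_le_mul ?_ (hb' _) (norm_nonneg _) hx
      rw [Real.norm_eq_abs, abs_le]
      constructor <;> linarith [hp.1.1, hp.1.2]
  have hsw := integral_triangle_swap hx hI
  -- Substituting σ = y − t turns the inner integral into the Taylor remainder at s = x − t.
  have e1 : ∫ t in (0 : ℝ)..x, ∫ y in t..x, ((x - y : ℝ) : ℂ) * Ψ₁ t (y - t)
      = ∫ t in (0 : ℝ)..x, (Ψ t (x - t) - Ψ t 0) := by
    refine intervalIntegral.integral_congr fun t ht => ?_
    rw [uIcc_of_le hx] at ht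
    rw [hT t ht, add_sub_cancel_left]
    have := intervalIntegral.integral_comp_sub_right (a := t) (b := x)
      (fun σ => ((x - t - σ : ℝ) : ℂ) * Ψ₁ t σ) t
    rw [sub_self] at this
    rw [← this]
    refine intervalIntegral.integral_congr fun y _ => ?_
    push_cast
    ring
  rw [e1, intervalIntegral.integral_sub h1 h0] at hsw
  simp only [intervalIntegral.integral_const_mul] at hsw
  linear_combination hsw

section Kernel

variable {r : ℝ} {φ : ℝ → ℝ → ℂ} {c : ℝ → ℝ}

variable (hr : 0 ≤ r) (hφm : Measurable (Function.uncurry φ)) (hc : IntervalIntegrable c volume 0 r)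
  (hφ : ∀ t η, 0 ≤ η → η ≤ t → t ≤ r → ‖φ t η‖ ≤ c η)

include hr hφm hc hφ

omit hr hφm hc hφ in
/-- A second primitive of an even function is even. -/
lemma second_primitive_even {f : ℝ → ℂ} {ζ : ℝ} (hζ : |ζ| ≤ r) :
    ∫ τ in (0 : ℝ)..ζ, ((ζ - τ : ℝ) : ℂ) * evenExt r f τ
      = ∫ τ in (0 : ℝ)..|ζ|, ((|ζ| - τ : ℝ) : ℂ) * f τ := by
  have key : ∀ z, 0 ≤ z → z ≤ r → ∫ τ in (0 : ℝ)..z, ((z - τ : ℝ) : ℂ) * evenExt r f τ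
      = ∫ τ in (0 : ℝ)..z, ((z - τ : ℝ) : ℂ) * f τ := by
    intro z hz hzr
    refine intervalIntegral.integral_congr fun τ hτ => ?_
    rw [uIcc_of_le hz] at hτ
    rw [evenExt_of_mem f ⟨hτ.1, hτ.2.trans hzr⟩]
  rcases le_total 0 ζ with h | h
  · rw [abs_of_nonneg h] at hζ ⊢
    exact key ζ h hζ
  · rw [abs_of_nonpos h] at hζ ⊢
    rw [← key (-ζ) (by linarith) hζ]
    have := intervalIntegral.integral_comp_neg (a := 0) (b := ζ)
      (fun τ => ((-ζ - τ : ℝ) : ℂ) * evenExt r f τ)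
    rw [neg_zero] at this
    rw [intervalIntegral.integral_symm (-ζ), ← this, ← intervalIntegral.integral_neg]
    refine intervalIntegral.integral_congr fun τ _ => ?_
    simp only [evenExt_neg]
    push_cast
    ring

/-- The Duhamel identity for a second primitive. -/
lemma integral_dAlembert_second_primitive {f : ℝ → ℂ} (hfm : Measurable f)
    (hf : IntervalIntegrable f volume 0 r) (g0 : ℂ) {x : ℝ} (hx0 : 0 ≤ x) (hx : x ≤ r) :
    ∫ ζ in (0 : ℝ)..x, dAlembert φ x ζ * (g0 + ∫ τ in (0 : ℝ)..ζ, ((ζ - τ : ℝ) : ℂ) * f τ)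
      = (∫ t in (0 : ℝ)..x, ∫ η in (0 : ℝ)..t,
          φ t η * (g0 + ∫ τ in (0 : ℝ)..η, ((η - τ : ℝ) : ℂ) * f τ))
        + ∫ y in (0 : ℝ)..x, ((x - y : ℝ) : ℂ) * ∫ ζ in (0 : ℝ)..y, dAlembert φ y ζ * f ζ := by
  have hce := integrable_evenExt hr hc
  have hfe := integrable_evenExt hr hf
  have hfem : Measurable (evenExt r f) := measurable_evenExt hfm
  set g : ℝ → ℂ := fun ζ => g0 + ∫ τ in (0 : ℝ)..ζ, ((ζ - τ : ℝ) : ℂ) * f τ with hg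
  -- G agrees with the even extension of g on [−r,r], but it is continuous on the whole line, so
  -- that it may be shifted freely; its second derivative is the even extension of f.
  set G : ℝ → ℂ := fun ζ => g0 + ∫ τ in (0 : ℝ)..ζ, ((ζ - τ : ℝ) : ℂ) * evenExt r f τ with hG
  set P : ℝ → ℂ := fun ζ => ∫ τ in (0 : ℝ)..ζ, evenExt r f τ with hP
  have hii : ∀ a b, IntervalIntegrable (evenExt r f) volume a b := fun a b =>
    hfe.intervalIntegrable
  have hii' : ∀ a b, IntervalIntegrable (fun τ : ℝ => (τ : ℂ) * evenExt r f τ) volume a b :=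
    fun a b => (hii a b).continuousOn_mul (by fun_prop)
  have hPc : Continuous P := intervalIntegral.continuous_primitive hii 0
  have hGc : Continuous G := by
    have : G = fun ζ : ℝ => g0 + ((ζ : ℂ) * P ζ - ∫ τ in (0 : ℝ)..ζ, (τ : ℂ) * evenExt r f τ) := by
      ext ζ
      simp only [hG, hP]
      rw [← intervalIntegral.integral_const_mul, ← intervalIntegral.integral_sub
        ((hii _ _).const_mul _) (hii' _ _)]
      congr 1
      refine intervalIntegral.integral_congr fun τ _ => ?_
      push_cast
      ring
    rw [this]
    have h2 := intervalIntegral.continuous_primitive hii' 0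
    fun_prop
  have hGg : ∀ ζ, |ζ| ≤ r → G ζ = g |ζ| := fun ζ hζ => by
    simp only [hG, hg]
    rw [second_primitive_even hζ]
  have hPodd : ∀ η, P (-η) = -P η := by
    intro η
    have := intervalIntegral.integral_comp_neg (a := 0) (b := η) (evenExt r f)
    simp only [evenExt_neg, neg_zero] at this
    simp only [hP]
    rw [this, intervalIntegral.integral_symm]
  have hgi : IntervalIntegrable g volume 0 r := by
    refine ContinuousOn.intervalIntegrable ?_
    refine hGc.continuousOn.congr fun ζ hζ => ?_
    rw [uIcc_of_le hr] at hζ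
    have ha := abs_of_nonneg hζ.1
    rw [hGg ζ (by rw [ha]; exact hζ.2), ha]
  -- Ψ(t,s) pairs φ(t,·) with the translate of G by s. The value at s = x − t is the left side of
  -- the identity, the value at s = 0 the first term on the right, and Ψ₁ plays the part of the
  -- second derivative in s.
  set Ψ : ℝ → ℝ → ℂ := fun t s => ∫ η, evenKer r φ t η * G (η - s) with hΨ
  set Ψ₁ : ℝ → ℝ → ℂ := fun t s => ∫ η, evenKer r φ t η * evenExt r f (η - s) with hΨ₁
  have hconv := hfe.norm.convolution_integrand (ContinuousLinearMap.mul ℝ ℝ) hce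
  have hconv' := hce.convolution_integrand (ContinuousLinearMap.mul ℝ ℝ) hfe.norm
  have hsymm : ∀ η σ, evenExt r f (η - σ) = evenExt r f (σ - η) := fun η σ => by
    rw [← evenExt_neg, neg_sub]
  have hT : ∀ t s, 0 ≤ s → Ψ t s = Ψ t 0 + ∫ σ in (0 : ℝ)..s, ((s - σ : ℝ) : ℂ) * Ψ₁ t σ := by
    intro t s hs
    have hI : Integrable (Function.uncurry fun σ η =>
        evenKer r φ t η * (((s - σ : ℝ) : ℂ) * evenExt r f (η - σ)))
        ((volume.restrict (uIoc 0 s)).prod volume) := by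
      have h2 := (hconv'.mono_measure (μ := (volume.restrict (uIoc 0 s)).prod volume)
        (Measure.prod_mono Measure.restrict_le_self le_rfl)).const_mul s
      refine h2.mono' ?_ ?_
      · have h3 : Measurable fun p : ℝ × ℝ => evenKer r φ t p.2 :=
          (measurable_evenKer hφm).comp (measurable_const.prodMk measurable_snd)
        have h4 : Measurable fun p : ℝ × ℝ => evenExt r f (p.2 - p.1) :=
          hfem.comp (by fun_prop)
        refine (h3.mul (Measurable.mul ?_ h4)).aestronglyMeasurable
        fun_prop
      · have hmem : ∀ᵐ p : ℝ × ℝ ∂((volume.restrict (uIoc 0 s)).prod volume), p.1 ∈ uIoc 0 s :=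
          Measure.quasiMeasurePreserving_fst.ae (ae_restrict_mem measurableSet_uIoc)
        filter_upwards [hmem] with p hp
        rw [uIoc_of_le hs] at hp
        simp only [Function.uncurry, ContinuousLinearMap.mul_apply', norm_mul, Complex.norm_real,
          hsymm p.2]
        have h5 : ‖s - p.1‖ ≤ s := by
          rw [Real.norm_eq_abs, abs_le]
          constructor <;> linarith [hp.1, hp.2]
        have h6 := norm_evenKer_le hφ t p.2
        calc _ ≤ evenExt r c p.2 * (s * ‖evenExt r f (p.1 - p.2)‖) := by
              refine mul_le_mul h6 ?_ (by positivity) ((norm_nonneg _).trans h6)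
              gcongr
          _ = _ := by ring
    have hsw := intervalIntegral_integral_swap hI
    simp only [intervalIntegral.integral_const_mul] at hsw
    have e0 : ∀ σ : ℝ, ∫ η, evenKer r φ t η * (((s - σ : ℝ) : ℂ) * evenExt r f (η - σ))
        = ((s - σ : ℝ) : ℂ) * Ψ₁ t σ := by
      intro σ
      rw [hΨ₁, ← integral_const_mul]
      congr 1
      ext η
      ring
    simp only [e0] at hsw
    -- The remainder formula leaves the linear term sP(η). P is odd, so this term integrates to zero
    -- against the even kernel.
    have hrem : ∀ η, ∫ σ in (0 : ℝ)..s, ((s - σ : ℝ) : ℂ) * evenExt r f (η - σ)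
        = G (η - s) - G η + s * P η := by
      intro η
      have := taylor_second_primitive hfe η s
      simp only [hG, hP]
      rw [this]
      ring
    have i0 := integrable_evenKer_mul_of_continuous hr hφm hc hφ hGc t
    have i1 := integrable_evenKer_mul_of_continuous hr hφm hc hφ
      (k := fun η => G (η - s)) (by fun_prop) t
    have i2 := integrable_evenKer_mul_of_continuous hr hφm hc hφ
      (k := fun η => (s : ℂ) * P η) (by fun_prop) t
    have hodd := integral_evenKer_mul_odd (r := r) (φ := φ)
      (k := fun η => (s : ℂ) * P η) (fun η => by rw [hPodd]; ring) t
    simp only [hrem] at hsw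
    rw [hsw]
    have : ∀ η, evenKer r φ t η * (G (η - s) - G η + s * P η)
        = evenKer r φ t η * G (η - s) - evenKer r φ t η * G η
          + evenKer r φ t η * (s * P η) := fun η => by ring
    simp only [this]
    have i3 : Integrable fun η => evenKer r φ t η * G (η - s) - evenKer r φ t η * G η := i1.sub i0
    rw [integral_add i3 i2, integral_sub i1 i0, hodd]
    simp only [hΨ, sub_zero]
    ring
  have hΨ₁m : Measurable (Function.uncurry Ψ₁) := by
    have h3 : Measurable fun p : (ℝ × ℝ) × ℝ => evenKer r φ p.1.1 p.2 :=
      (measurable_evenKer hφm).comp (f := fun p : (ℝ × ℝ) × ℝ => (p.1.1, p.2)) (by fun_prop)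
    have h4 : Measurable fun p : (ℝ × ℝ) × ℝ => evenExt r f (p.2 - p.1.2) :=
      hfem.comp (by fun_prop)
    have := (h3.mul h4).stronglyMeasurable.integral_prod_right' (ν := volume)
    exact this.measurable
  have hκ : Integrable fun σ => ∫ η, evenExt r c η * ‖evenExt r f (σ - η)‖ :=
    hconv'.integral_prod_left
  have hb : ∀ᵐ σ, ∀ t, ‖Ψ₁ t σ‖ ≤ ∫ η, evenExt r c η * ‖evenExt r f (σ - η)‖ := by
    filter_upwards [hconv'.prod_right_ae] with σ hi t
    refine norm_integral_le_of_norm_le hi ?_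
    filter_upwards with η
    rw [norm_mul, hsymm η σ]
    gcongr
    exact norm_evenKer_le hφ t η
  have hG0 : ∀ t ∈ Icc 0 x, Ψ t 0 = 2 * ∫ η in (0 : ℝ)..t, φ t η * g η := by
    intro t ht
    simp only [hΨ, sub_zero]
    exact integral_evenKer_mul_even hr hφm hc hφ hGc ht.1 (ht.2.trans hx) hGg
  have hmain := integral_shift_of_taylor hx0 hΨ₁m hκ hb
    (intervalIntegrable_integral_evenKer_mul hr hφm hc hφ
      (k := fun _ η => G (η - 0)) (by fun_prop) hx0)
    (intervalIntegrable_integral_evenKer_mul hr hφm hc hφ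
      (k := fun t η => G (η - (x - t))) (by fun_prop) hx0)
    (fun t ht => hT t (x - t) (by linarith [ht.2]))
  have e1 : ∫ ζ in (0 : ℝ)..x, dAlembert φ x ζ * g ζ
      = (1 / 2) * ∫ t in (0 : ℝ)..x, Ψ t (x - t) := by
    rw [integral_dAlembert_mul hr hφm hc hφ hgi hx0 hx]
    congr 1
    refine intervalIntegral.integral_congr fun t ht => ?_
    rw [uIcc_of_le hx0] at ht
    refine integral_congr_ae ?_
    filter_upwards with η
    by_cases h : |η| ≤ t ∧ t ≤ r
    -- Where the kernel is nonzero, |η| ≤ t, hence |η − (x − t)| ≤ x ≤ r, and G may replace the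
    -- truncated extension of g.
    · have h1 : |η - (x - t)| ≤ r := by
        have := abs_le.1 h.1
        rw [abs_le]
        constructor <;> linarith [ht.1, ht.2]
      simp only [evenExt, if_pos h1, hGg _ h1]
    · simp [evenKer, if_neg h]
  have e2 : ∀ y ∈ Icc 0 x, ∫ ζ in (0 : ℝ)..y, dAlembert φ y ζ * f ζ
      = (1 / 2) * ∫ t in (0 : ℝ)..y, Ψ₁ t (y - t) := fun y hy =>
    integral_dAlembert_mul hr hφm hc hφ hf hy.1 (hy.2.trans hx)
  have e3 : ∫ t in (0 : ℝ)..x, Ψ t 0 = 2 * ∫ t in (0 : ℝ)..x, ∫ η in (0 : ℝ)..t, φ t η * g η := by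
    rw [← intervalIntegral.integral_const_mul]
    refine intervalIntegral.integral_congr fun t ht => ?_
    rw [uIcc_of_le hx0] at ht
    exact hG0 t ht
  have e4 : ∫ y in (0 : ℝ)..x, ((x - y : ℝ) : ℂ) * ∫ ζ in (0 : ℝ)..y, dAlembert φ y ζ * f ζ
      = (1 / 2) * ∫ y in (0 : ℝ)..x, ((x - y : ℝ) : ℂ) * ∫ t in (0 : ℝ)..y, Ψ₁ t (y - t) := by
    rw [← intervalIntegral.integral_const_mul]
    refine intervalIntegral.integral_congr fun y hy => ?_
    rw [uIcc_of_le hx0] at hy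
    simp only [e2 y hy]
    ring
  rw [e1, hmain, e3, e4]
  ring

/-- The Duhamel identity for the identity function. -/
lemma integral_dAlembert_id {x : ℝ} (hx0 : 0 ≤ x) (hx : x ≤ r) :
    ∫ ζ in (0 : ℝ)..x, dAlembert φ x ζ * (ζ : ℂ)
      = (∫ t in (0 : ℝ)..x, ∫ η in (0 : ℝ)..t, φ t η * (η : ℂ))
        + ∫ y in (0 : ℝ)..x, ((x - y : ℝ) : ℂ) * dAlembert φ y 0 := by
  have hce := integrable_evenExt hr hc
  set g : ℝ → ℂ := fun ζ => (ζ : ℂ) with hg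
  -- The even extension of the identity is |ζ|, whose second derivative is twice the point mass at
  -- 0. Hence Ψ₁(t,s) is 2φ(t,s), evenly extended, and no integral remains in it.
  set G : ℝ → ℂ := fun ζ => ((|ζ| : ℝ) : ℂ) with hG
  have hGc : Continuous G := by fun_prop
  have hgi : IntervalIntegrable g volume 0 r := Continuous.intervalIntegrable (by fun_prop) _ _
  set Ψ : ℝ → ℝ → ℂ := fun t s => ∫ η, evenKer r φ t η * G (η - s) with hΨ
  set Ψ₁ : ℝ → ℝ → ℂ := fun t s => 2 * evenKer r φ t s with hΨ₁
  have hT : ∀ t s, 0 ≤ s → Ψ t s = Ψ t 0 + ∫ σ in (0 : ℝ)..s, ((s - σ : ℝ) : ℂ) * Ψ₁ t σ := by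
    intro t s hs
    have i0 := integrable_evenKer_mul_of_continuous hr hφm hc hφ hGc t
    have i1 := integrable_evenKer_mul_of_continuous hr hφm hc hφ
      (k := fun η => G (η - s)) (by fun_prop) t
    have hm : Measurable (evenKer r φ t) :=
      (measurable_evenKer hφm).comp (measurable_const.prodMk measurable_id)
    have hk : Integrable (evenKer r φ t) :=
      hce.mono' hm.aestronglyMeasurable (by filter_upwards with η using norm_evenKer_le hφ t η)
    have hsign : Measurable fun η : ℝ => ((SignType.sign η : ℝ) : ℂ) := by
      have : (fun η : ℝ => ((SignType.sign η : ℝ) : ℂ))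
          = fun η : ℝ => if 0 < η then (1 : ℂ) else if η < 0 then -1 else 0 := by
        ext η
        rw [sign_apply]
        split_ifs <;> simp
      rw [this]
      exact Measurable.ite measurableSet_Ioi measurable_const
        (Measurable.ite measurableSet_Iio measurable_const measurable_const)
    have i2 : Integrable fun η => evenKer r φ t η * (s * ((SignType.sign η : ℝ) : ℂ)) := by
      refine (hk.norm.mul_const ‖(s : ℂ)‖).mono'
        (hm.mul (hsign.const_mul _)).aestronglyMeasurable ?_
      filter_upwards with η
      rw [norm_mul, norm_mul]
      have : ‖((SignType.sign η : ℝ) : ℂ)‖ ≤ 1 := by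
        rw [sign_apply]
        split_ifs <;> simp
      gcongr
      exact mul_le_of_le_one_right (norm_nonneg _) this
    have hodd := integral_evenKer_mul_odd (r := r) (φ := φ)
      (k := fun η => s * ((SignType.sign η : ℝ) : ℂ)) (fun η => by simp [Left.sign_neg]) t
    -- Taylor's formula for |η|: for s ≥ 0, |η − s| − |η| + s·sign η equals 2(s − η) for 0 < η ≤ s
    -- and vanishes for the other η ≠ 0.
    have e1 : ∫ σ in (0 : ℝ)..s, ((s - σ : ℝ) : ℂ) * Ψ₁ t σ
        = ∫ η, (evenKer r φ t η * G (η - s) - evenKer r φ t η * G η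
          + evenKer r φ t η * (s * ((SignType.sign η : ℝ) : ℂ))) := by
      rw [intervalIntegral.integral_of_le hs, ← integral_indicator measurableSet_Ioc]
      refine integral_congr_ae ?_
      have h0 : ∀ᵐ η : ℝ, η ≠ 0 := by simp [ae_iff, measure_singleton]
      filter_upwards [h0] with η hη
      simp only [indicator, mem_Ioc, hΨ₁, hG]
      rcases lt_or_gt_of_ne hη with h | h
      · rw [if_neg (by grind), sign_neg h, abs_of_neg h, abs_of_nonpos (by linarith)]
        push_cast
        simp
        ring
      · rw [sign_pos h, abs_of_pos h]
        split_ifs with h1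
        · rw [abs_of_nonpos (by linarith [h1.2])]
          push_cast
          simp
          ring
        · rw [abs_of_nonneg (by grind)]
          push_cast
          simp
          ring
    have i3 : Integrable fun η => evenKer r φ t η * G (η - s) - evenKer r φ t η * G η := i1.sub i0
    rw [e1, integral_add i3 i2, integral_sub i1 i0, hodd]
    simp only [hΨ, sub_zero]
    ring
  have hmain := integral_shift_of_taylor (Ψ := Ψ) (Ψ₁ := Ψ₁) hx0
    ((measurable_evenKer hφm).const_mul 2) (hce.const_mul 2)
    (by
      filter_upwards with σ t
      simp only [hΨ₁, norm_mul, Complex.norm_ofNat]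
      gcongr
      exact norm_evenKer_le hφ t σ)
    (intervalIntegrable_integral_evenKer_mul hr hφm hc hφ
      (k := fun _ η => G (η - 0)) (by fun_prop) hx0)
    (intervalIntegrable_integral_evenKer_mul hr hφm hc hφ
      (k := fun t η => G (η - (x - t))) (by fun_prop) hx0)
    (fun t ht => hT t (x - t) (by linarith [ht.2]))
  have e1 : ∫ ζ in (0 : ℝ)..x, dAlembert φ x ζ * g ζ
      = (1 / 2) * ∫ t in (0 : ℝ)..x, Ψ t (x - t) := by
    rw [integral_dAlembert_mul hr hφm hc hφ hgi hx0 hx]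
    congr 1
    refine intervalIntegral.integral_congr fun t ht => ?_
    rw [uIcc_of_le hx0] at ht
    refine integral_congr_ae ?_
    filter_upwards with η
    by_cases h : |η| ≤ t ∧ t ≤ r
    · have h1 : |η - (x - t)| ≤ r := by
        have := abs_le.1 h.1
        rw [abs_le]
        constructor <;> linarith [ht.1, ht.2]
      simp only [evenExt, if_pos h1, hG, hg]
    · simp [evenKer, if_neg h]
  have e3 : ∫ t in (0 : ℝ)..x, Ψ t 0 = 2 * ∫ t in (0 : ℝ)..x, ∫ η in (0 : ℝ)..t, φ t η * g η := by
    rw [← intervalIntegral.integral_const_mul]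
    refine intervalIntegral.integral_congr fun t ht => ?_
    rw [uIcc_of_le hx0] at ht
    simp only [hΨ, sub_zero]
    exact integral_evenKer_mul_even hr hφm hc hφ hGc ht.1 (ht.2.trans hx) (fun _ _ => rfl)
  have e4 : ∫ y in (0 : ℝ)..x, ((x - y : ℝ) : ℂ) * dAlembert φ y 0
      = (1 / 2) * ∫ y in (0 : ℝ)..x, ((x - y : ℝ) : ℂ) * ∫ t in (0 : ℝ)..y, Ψ₁ t (y - t) := by
    rw [← intervalIntegral.integral_const_mul]
    refine intervalIntegral.integral_congr fun y hy => ?_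
    rw [uIcc_of_le hx0] at hy
    simp only [hΨ₁, intervalIntegral.integral_const_mul]
    -- At ζ = 0 the two characteristics coincide, which accounts for the factor 2 of Ψ₁.
    rw [dAlembert_eq hr hφm hc hφ le_rfl hy.1 (hy.2.trans hx)]
    simp only [neg_zero, add_zero]
    ring
  rw [e1, hmain, e3, e4]
  ring

end Kernel

/-! ### Measurability of parametric interval integrals and entry sums -/

lemma measurable_intervalIntegral {α : Type*} [MeasurableSpace α] {F : α → ℝ → ℂ}
    (hF : Measurable (Function.uncurry F)) {a b : α → ℝ} (ha : Measurable a) (hb : Measurable b) :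
    Measurable fun p => ∫ t in (a p)..(b p), F p t := by
  have key : ∀ {a b : α → ℝ}, Measurable a → Measurable b →
      Measurable fun p => ∫ t in Ioc (a p) (b p), F p t := by
    intro a b ha hb
    have h1 : MeasurableSet {q : α × ℝ | q.2 ∈ Ioc (a q.1) (b q.1)} :=
      (measurableSet_lt (ha.comp measurable_fst) measurable_snd).inter
        (measurableSet_le measurable_snd (hb.comp measurable_fst))
    have h2 := ((hF.indicator h1).stronglyMeasurable.integral_prod_right' (ν := volume)).measurable
    convert h2 using 2 with p
    rw [← integral_indicator measurableSet_Ioc]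
    congr 1
  exact (key ha hb).sub (key hb ha)

/-- The sum of the norms of the entries. -/
def entrySum {p q : Type*} [Fintype p] [Fintype q] (M : Matrix p q ℂ) : ℝ := ∑ i, ∑ k, ‖M i k‖

section EntrySum

variable {p q s : Type*} [Fintype p] [Fintype q]

lemma entrySum_nonneg (M : Matrix p q ℂ) : 0 ≤ entrySum M :=
  Finset.sum_nonneg fun _ _ => Finset.sum_nonneg fun _ _ => norm_nonneg _

lemma row_le_entrySum (M : Matrix p q ℂ) (i : p) : ∑ k, ‖M i k‖ ≤ entrySum M :=
  Finset.single_le_sum (f := fun i => ∑ k, ‖M i k‖)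
    (fun _ _ => Finset.sum_nonneg fun _ _ => norm_nonneg _) (Finset.mem_univ i)

lemma norm_entry_le_entrySum (M : Matrix p q ℂ) (i : p) (k : q) : ‖M i k‖ ≤ entrySum M :=
  (Finset.single_le_sum (f := fun k => ‖M i k‖) (fun _ _ => norm_nonneg _)
    (Finset.mem_univ k)).trans (row_le_entrySum M i)

lemma norm_mul_entry_le (M : Matrix p q ℂ) (N : Matrix q s ℂ) (i : p) (k : s) {B : ℝ}
    (hB : ∀ j, ‖N j k‖ ≤ B) : ‖(M * N) i k‖ ≤ entrySum M * B := by
  -- If the inner index type is empty, nothing forces B ≥ 0, but both sides are then zero.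
  rcases isEmpty_or_nonempty q with h | ⟨⟨j0⟩⟩
  · simp [Matrix.mul_apply, entrySum]
  have hB0 : 0 ≤ B := (norm_nonneg _).trans (hB j0)
  rw [Matrix.mul_apply]
  calc ‖∑ j, M i j * N j k‖ ≤ ∑ j, ‖M i j * N j k‖ := norm_sum_le _ _
    _ ≤ ∑ j, ‖M i j‖ * B := Finset.sum_le_sum fun j _ => by
        rw [norm_mul]; exact mul_le_mul_of_nonneg_left (hB j) (norm_nonneg _)
    _ = (∑ j, ‖M i j‖) * B := by rw [Finset.sum_mul]
    _ ≤ _ := mul_le_mul_of_nonneg_right (row_le_entrySum M i) hB0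

lemma intervalIntegrable_entrySum {M : ℝ → Matrix p q ℂ} {r : ℝ}
    (h : ∀ i k, IntervalIntegrable (fun x => M x i k) volume 0 r) :
    IntervalIntegrable (fun x => entrySum (M x)) volume 0 r := by
  unfold entrySum
  have := IntervalIntegrable.sum (μ := volume) (a := 0) (b := r) Finset.univ
    (f := fun i x => ∑ k, ‖M x i k‖) fun i _ => by
      have := IntervalIntegrable.sum (μ := volume) (a := 0) (b := r) Finset.univ
        (f := fun k x => ‖M x i k‖) fun k _ => (h i k).norm
      simpa only [Finset.sum_fn] using this
  simpa only [Finset.sum_fn] using this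

omit [Fintype p] in
lemma measurable_mul_entry {α : Type*} [MeasurableSpace α] {M : α → Matrix p q ℂ}
    {N : α → Matrix q s ℂ} (hM : ∀ i k, Measurable fun x => M x i k)
    (hN : ∀ i k, Measurable fun x => N x i k) (i : p) (k : s) :
    Measurable fun x => (M x * N x) i k := by
  simp only [Matrix.mul_apply]
  exact Finset.measurable_sum _ fun j _ => (hM i j).mul (hN j k)

end EntrySum

/-! ### Linearity and bounds for the d'Alembert sum -/

section DAlembert

variable {r : ℝ} {φ ψ : ℝ → ℝ → ℂ} {c d : ℝ → ℝ}

lemma dAlembert_congr {x ζ : ℝ} (hζ : 0 ≤ ζ) (hζx : ζ ≤ x) (hx : x ≤ r)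
    (h : ∀ t η, 0 ≤ η → η ≤ t → t ≤ r → φ t η = ψ t η) : dAlembert φ x ζ = dAlembert ψ x ζ := by
  unfold dAlembert
  congr 2
  · congr 1
    · refine intervalIntegral.integral_congr fun t ht => ?_
      rw [uIcc_of_le (by linarith)] at ht
      exact h _ _ (by linarith [ht.1]) (by linarith) (by linarith [ht.2])
    · refine intervalIntegral.integral_congr fun t ht => ?_
      rw [uIcc_of_le (by linarith)] at ht
      exact h _ _ (by linarith [ht.2]) (by linarith [ht.1]) (by linarith [ht.2])
  · refine intervalIntegral.integral_congr fun t ht => ?_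
    rw [uIcc_of_le (by linarith)] at ht
    exact h _ _ (by linarith [ht.2]) (by linarith [ht.1]) (by linarith [ht.2])

variable (hr : 0 ≤ r) (hφm : Measurable (Function.uncurry φ)) (hc : IntervalIntegrable c volume 0 r)
  (hφ : ∀ t η, 0 ≤ η → η ≤ t → t ≤ r → ‖φ t η‖ ≤ c η)
  (hψm : Measurable (Function.uncurry ψ)) (hd : IntervalIntegrable d volume 0 r)
  (hψ : ∀ t η, 0 ≤ η → η ≤ t → t ≤ r → ‖ψ t η‖ ≤ d η)

include hr hφm hc hφ

lemma intervalIntegrable_evenKer_line (ζ x y z : ℝ) :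
    IntervalIntegrable (fun t => evenKer r φ t (x - t + ζ)) volume y z := by
  refine intervalIntegrable_evenKer_comp (a := fun t => x - t + ζ) hφm hφ (by fun_prop) ?_ y z
  have := (integrable_evenExt hr hc).comp_sub_left (x + ζ)
  refine this.congr (by filter_upwards with t; congr 1; ring)

/-- Each characteristic sees a reflected translate of the majorant, whose integral is at most its
total mass. This serves the first term of the series, whose source is only integrable in η. -/
lemma norm_dAlembert_le {x ζ : ℝ} (hζ : 0 ≤ ζ) (hζx : ζ ≤ x) (hx : x ≤ r) :
    ‖dAlembert φ x ζ‖ ≤ ∫ η, evenExt r c η := by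
  have hce := integrable_evenExt hr hc
  have hnn : ∀ η, 0 ≤ evenExt r c η := fun η =>
    (norm_nonneg _).trans (norm_evenKer_le hφ 0 η)
  have key : ∀ ζ, ‖∫ t in (0 : ℝ)..x, evenKer r φ t (x - t + ζ)‖ ≤ ∫ η, evenExt r c η := by
    intro ζ
    have hi : Integrable fun t => evenExt r c (x + ζ - t) := hce.comp_sub_left (x + ζ)
    calc _ ≤ ∫ t in (0 : ℝ)..x, evenExt r c (x + ζ - t) := by
          refine intervalIntegral.norm_integral_le_of_norm_le (hζ.trans hζx) ?_
            hi.intervalIntegrable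
          filter_upwards with t _
          refine (norm_evenKer_le hφ _ _).trans (le_of_eq ?_)
          congr 1; ring
      _ ≤ ∫ t, evenExt r c (x + ζ - t) := by
          rw [intervalIntegral.integral_of_le (hζ.trans hζx)]
          exact setIntegral_le_integral hi (by filter_upwards with t using hnn _)
      _ = _ := integral_sub_left_eq_self (evenExt r c) volume (x + ζ)
  rw [dAlembert_eq hr hφm hc hφ hζ hζx hx, norm_mul]
  have h1 := norm_add_le (∫ t in (0 : ℝ)..x, evenKer r φ t (x - t + ζ))
    (∫ t in (0 : ℝ)..x, evenKer r φ t (x - t + -ζ))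
  have h2 := key ζ
  have h3 := key (-ζ)
  have h4 : ‖(1 / 2 : ℂ)‖ = 1 / 2 := by norm_num
  rw [h4]
  linarith

/-- A majorant in t instead of η keeps the integral over [0,x], and this is what produces the
factorials on iteration. -/
lemma norm_dAlembert_le_integral {μ : ℝ → ℝ} {x ζ : ℝ} (hμ : IntervalIntegrable μ volume 0 x)
    (hφμ : ∀ t η, 0 ≤ η → η ≤ t → t ≤ x → ‖φ t η‖ ≤ μ t)
    (hζ : 0 ≤ ζ) (hζx : ζ ≤ x) (hx : x ≤ r) :
    ‖dAlembert φ x ζ‖ ≤ ∫ t in (0 : ℝ)..x, μ t := by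
  have key : ∀ ζ, ‖∫ t in (0 : ℝ)..x, evenKer r φ t (x - t + ζ)‖ ≤ ∫ t in (0 : ℝ)..x, μ t := by
    intro ζ
    refine intervalIntegral.norm_integral_le_of_norm_le (hζ.trans hζx) ?_ hμ
    filter_upwards with t ht
    unfold evenKer
    split_ifs with h
    · exact hφμ _ _ (abs_nonneg _) h.1 ht.2
    · rw [norm_zero]
      exact (norm_nonneg _).trans (hφμ t 0 le_rfl ht.1.le ht.2)
  rw [dAlembert_eq hr hφm hc hφ hζ hζx hx, norm_mul]
  have h1 := norm_add_le (∫ t in (0 : ℝ)..x, evenKer r φ t (x - t + ζ))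
    (∫ t in (0 : ℝ)..x, evenKer r φ t (x - t + -ζ))
  have h2 := key ζ
  have h3 := key (-ζ)
  have h4 : ‖(1 / 2 : ℂ)‖ = 1 / 2 := by norm_num
  rw [h4]
  linarith

include hψm hd hψ

lemma dAlembert_add {x ζ : ℝ} (hζ : 0 ≤ ζ) (hζx : ζ ≤ x) (hx : x ≤ r) :
    dAlembert (fun t η => φ t η + ψ t η) x ζ = dAlembert φ x ζ + dAlembert ψ x ζ := by
  have hs : ∀ t η, 0 ≤ η → η ≤ t → t ≤ r → ‖φ t η + ψ t η‖ ≤ c η + d η := fun t η h1 h2 h3 =>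
    (norm_add_le _ _).trans (add_le_add (hφ t η h1 h2 h3) (hψ t η h1 h2 h3))
  have he : ∀ t η, evenKer r (fun t η => φ t η + ψ t η) t η = evenKer r φ t η + evenKer r ψ t η := by
    intro t η
    unfold evenKer
    split_ifs <;> simp
  have hm : Measurable (Function.uncurry fun t η => φ t η + ψ t η) := hφm.add hψm
  rw [dAlembert_eq hr hm (hc.add hd) hs hζ hζx hx,
    dAlembert_eq hr hφm hc hφ hζ hζx hx, dAlembert_eq hr hψm hd hψ hζ hζx hx]
  simp only [he]
  rw [intervalIntegral.integral_add (intervalIntegrable_evenKer_line hr hφm hc hφ _ _ _ _)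
      (intervalIntegrable_evenKer_line hr hψm hd hψ _ _ _ _),
    intervalIntegral.integral_add (intervalIntegrable_evenKer_line hr hφm hc hφ _ _ _ _)
      (intervalIntegrable_evenKer_line hr hψm hd hψ _ _ _ _)]
  ring

omit hr hφm hc hφ hψm hd hψ in
lemma dAlembert_neg (φ : ℝ → ℝ → ℂ) (x ζ : ℝ) :
    dAlembert (fun t η => -φ t η) x ζ = -dAlembert φ x ζ := by
  simp only [dAlembert, intervalIntegral.integral_neg]
  ring

lemma dAlembert_sub {x ζ : ℝ} (hζ : 0 ≤ ζ) (hζx : ζ ≤ x) (hx : x ≤ r) :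
    dAlembert (fun t η => φ t η - ψ t η) x ζ = dAlembert φ x ζ - dAlembert ψ x ζ := by
  simp only [sub_eq_add_neg]
  rw [← dAlembert_neg]
  have hm : Measurable (Function.uncurry fun t η => -ψ t η) := hψm.neg
  exact dAlembert_add hr hφm hc hφ hm hd (fun t η h1 h2 h3 => by
    rw [norm_neg]; exact hψ t η h1 h2 h3) hζ hζx hx

end DAlembert

/-! ### The kernel series: measurability and bounds -/

lemma integral_mono_of_subinterval {r : ℝ} {g : ℝ → ℝ} (hg : IntervalIntegrable g volume 0 r)
    (h0 : ∀ x, 0 ≤ g x) {x y : ℝ} (hx : 0 ≤ x) (hxy : x ≤ y) (hy : y ≤ r) :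
    ∫ t in x..y, g t ≤ ∫ t in (0 : ℝ)..r, g t :=
  intervalIntegral.integral_mono_interval hx hxy hy (by filter_upwards with t using h0 t) hg

lemma intervalIntegrable_of_norm_le {f : ℝ → ℂ} {g : ℝ → ℝ} {x y : ℝ} (hxy : x ≤ y)
    (hf : Measurable f) (hg : IntervalIntegrable g volume x y)
    (h : ∀ t ∈ Icc x y, ‖f t‖ ≤ g t) : IntervalIntegrable f volume x y := by
  rw [intervalIntegrable_iff_integrableOn_Ioc_of_le hxy] at hg ⊢
  refine hg.mono' hf.aestronglyMeasurable ?_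
  filter_upwards [ae_restrict_mem measurableSet_Ioc] with t ht
  exact h t (Ioc_subset_Icc_self ht)

section Kernel

variable {m : Type*} [Fintype m] {n : ℕ} {r : ℝ}

/-- Entrywise measurable coefficient functions, integrable on `[0,r]`. -/
structure IsCoef {p q : Type*} (r : ℝ) (v : ℝ → Matrix p q ℂ) : Prop where
  measurable : ∀ i k, Measurable fun x => v x i k
  intervalIntegrable : ∀ i k, IntervalIntegrable (fun x => v x i k) volume 0 r

/-- Entrywise measurable kernels bounded on the triangle `0 ≤ ζ ≤ x ≤ r`. -/
structure IsBddKer (r : ℝ) (W : ℝ → ℝ → Matrix (Fin n) (Fin n) ℂ) (B : ℝ) : Prop where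
  measurable : ∀ i k, Measurable fun p : ℝ × ℝ => W p.1 p.2 i k
  bound : ∀ x ζ, 0 ≤ ζ → ζ ≤ x → x ≤ r → ∀ i k, ‖W x ζ i k‖ ≤ B

variable {v : ℝ → Matrix (Fin n) (Fin n) ℂ} {a : ℝ → Matrix (Fin n) m ℂ}
  {b : ℝ → Matrix m (Fin n) ℂ} {W W' : ℝ → ℝ → Matrix (Fin n) (Fin n) ℂ} {B B' : ℝ}

lemma IsCoef.intervalIntegrable_entrySum {p q : Type*} [Fintype p] [Fintype q]
    {v : ℝ → Matrix p q ℂ} (hv : IsCoef r v) :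
    IntervalIntegrable (fun x => entrySum (v x)) volume 0 r :=
  CanonSim.intervalIntegrable_entrySum hv.intervalIntegrable

lemma IsCoef.integral_entrySum_le {p q : Type*} [Fintype p] [Fintype q]
    {v : ℝ → Matrix p q ℂ} (hv : IsCoef r v) {x y : ℝ} (hx : 0 ≤ x) (hxy : x ≤ y) (hy : y ≤ r) :
    ∫ t in x..y, entrySum (v t) ≤ ∫ t in (0 : ℝ)..r, entrySum (v t) :=
  integral_mono_of_subinterval hv.intervalIntegrable_entrySum (fun _ => entrySum_nonneg _) hx hxy hy

lemma IsCoef.integral_entrySum_nonneg {p q : Type*} [Fintype p] [Fintype q]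
    {v : ℝ → Matrix p q ℂ} (hr : 0 ≤ r) : 0 ≤ ∫ t in (0 : ℝ)..r, entrySum (v t) :=
  intervalIntegral.integral_nonneg hr fun _ _ => entrySum_nonneg _

lemma measurable_innerPot (hv : ∀ i k, Measurable fun x => v x i k)
    (hW : ∀ i k, Measurable fun p : ℝ × ℝ => W p.1 p.2 i k) (i k : Fin n) :
    Measurable (Function.uncurry fun t η => innerPot v W t η i k) := by
  refine measurable_intervalIntegral (α := ℝ × ℝ) (F := fun p s => (v s * W s p.2) i k)
    ?_ measurable_snd measurable_fst
  exact measurable_mul_entry (M := fun q : (ℝ × ℝ) × ℝ => v q.2)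
    (N := fun q : (ℝ × ℝ) × ℝ => W q.2 q.1.2)
    (fun i k => (hv i k).comp measurable_snd)
    (fun i k => (hW i k).comp (f := fun q : (ℝ × ℝ) × ℝ => (q.2, q.1.2)) (by fun_prop)) i k

lemma measurable_innerSep_inner (ha : ∀ i k, Measurable fun x => a x i k)
    (hb : ∀ i k, Measurable fun x => b x i k)
    (hW : ∀ i k, Measurable fun p : ℝ × ℝ => W p.1 p.2 i k) (i k : Fin n) :
    Measurable fun p : ℝ × ℝ => matInt p.2 p.1 (fun ξ => a p.1 * b ξ * W ξ p.2) i k := by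
  refine measurable_intervalIntegral (α := ℝ × ℝ) (F := fun p ξ => (a p.1 * b ξ * W ξ p.2) i k)
    ?_ measurable_snd measurable_fst
  refine measurable_mul_entry (M := fun q : (ℝ × ℝ) × ℝ => a q.1.1 * b q.2)
    (N := fun q : (ℝ × ℝ) × ℝ => W q.2 q.1.2) (fun i k => ?_)
    (fun i k => (hW i k).comp (f := fun q : (ℝ × ℝ) × ℝ => (q.2, q.1.2)) (by fun_prop)) i k
  exact measurable_mul_entry (fun i k => (ha i k).comp (by fun_prop))
    (fun i k => (hb i k).comp (by fun_prop)) i k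

lemma measurable_innerSep (ha : ∀ i k, Measurable fun x => a x i k)
    (hb : ∀ i k, Measurable fun x => b x i k)
    (hW : ∀ i k, Measurable fun p : ℝ × ℝ => W p.1 p.2 i k) (i k : Fin n) :
    Measurable (Function.uncurry fun t η => innerSep a b W t η i k) := by
  refine measurable_intervalIntegral (α := ℝ × ℝ)
    (F := fun p s => matInt p.2 s (fun ξ => a s * b ξ * W ξ p.2) i k)
    ?_ measurable_snd measurable_fst
  exact (measurable_innerSep_inner ha hb hW i k).comp
    (f := fun q : (ℝ × ℝ) × ℝ => (q.2, q.1.2)) (by fun_prop)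

lemma measurable_Fbreve (ha : ∀ i k, Measurable fun x => a x i k)
    (hb : ∀ i k, Measurable fun x => b x i k) (i k : Fin n) :
    Measurable (Function.uncurry fun t η => Fbreve a b t η i k) := by
  refine measurable_intervalIntegral (α := ℝ × ℝ)
    (F := fun p s => (a s * b p.2) i k) ?_ measurable_snd measurable_fst
  exact measurable_mul_entry (M := fun q : (ℝ × ℝ) × ℝ => a q.2)
    (N := fun q : (ℝ × ℝ) × ℝ => b q.1.2) (fun i k => (ha i k).comp (by fun_prop))
    (fun i k => (hb i k).comp (by fun_prop)) i k

/-! ### Bounds for the source terms and the d'Alembert form of the recursion. -/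

section Bounds

variable (hr : 0 ≤ r) (hv : IsCoef r v) (ha : IsCoef r a) (hb : IsCoef r b)

include ha in
lemma norm_Fbreve_le {t η : ℝ} (hη : 0 ≤ η) (hηt : η ≤ t) (ht : t ≤ r) (i k : Fin n) :
    ‖Fbreve a b t η i k‖ ≤ (∫ s in (0 : ℝ)..r, entrySum (a s)) * entrySum (b η) := by
  have hi : IntervalIntegrable (fun s => entrySum (a s)) volume η t :=
    intervalIntegrable_mono ha.intervalIntegrable_entrySum ⟨hη, hηt.trans ht⟩ ⟨hη.trans hηt, ht⟩
  calc ‖Fbreve a b t η i k‖ ≤ ∫ s in η..t, entrySum (a s) * entrySum (b η) := by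
        refine intervalIntegral.norm_integral_le_of_norm_le hηt ?_ (hi.mul_const _)
        filter_upwards with s _
        exact norm_mul_entry_le _ _ _ _ fun j => norm_entry_le_entrySum _ _ _
    _ = (∫ s in η..t, entrySum (a s)) * entrySum (b η) := intervalIntegral.integral_mul_const _ _
    _ ≤ _ := mul_le_mul_of_nonneg_right (ha.integral_entrySum_le hη hηt ht) (entrySum_nonneg _)

include hv in
lemma norm_innerPot_le {M t η : ℝ} (hη : 0 ≤ η) (hηt : η ≤ t) (ht : t ≤ r)
    (hW : ∀ s ∈ Icc η t, ∀ i k, ‖W s η i k‖ ≤ M) (i k : Fin n) :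
    ‖innerPot v W t η i k‖ ≤ (∫ s in (0 : ℝ)..r, entrySum (v s)) * M := by
  have hM : 0 ≤ M := (norm_nonneg _).trans (hW η ⟨le_rfl, hηt⟩ i k)
  have hi : IntervalIntegrable (fun s => entrySum (v s)) volume η t :=
    intervalIntegrable_mono hv.intervalIntegrable_entrySum ⟨hη, hηt.trans ht⟩ ⟨hη.trans hηt, ht⟩
  calc ‖innerPot v W t η i k‖ ≤ ∫ s in η..t, entrySum (v s) * M := by
        refine intervalIntegral.norm_integral_le_of_norm_le hηt ?_ (hi.mul_const _)
        filter_upwards with s hs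
        exact norm_mul_entry_le _ _ _ _ fun j => hW s (Ioc_subset_Icc_self hs) _ _
    _ = (∫ s in η..t, entrySum (v s)) * M := intervalIntegral.integral_mul_const _ _
    _ ≤ _ := mul_le_mul_of_nonneg_right (hv.integral_entrySum_le hη hηt ht) hM

include hb in
lemma norm_innerSep_inner_le {M s η : ℝ} (hη : 0 ≤ η) (hηs : η ≤ s) (hs : s ≤ r)
    (hW : ∀ ξ ∈ Icc η s, ∀ i k, ‖W ξ η i k‖ ≤ M) (i k : Fin n) :
    ‖matInt η s (fun ξ => a s * b ξ * W ξ η) i k‖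
      ≤ entrySum (a s) * ((∫ s in (0 : ℝ)..r, entrySum (b s)) * M) := by
  have hM : 0 ≤ M := (norm_nonneg _).trans (hW η ⟨le_rfl, hηs⟩ i k)
  have hi : IntervalIntegrable (fun s => entrySum (b s)) volume η s :=
    intervalIntegrable_mono hb.intervalIntegrable_entrySum ⟨hη, hηs.trans hs⟩ ⟨hη.trans hηs, hs⟩
  calc _ ≤ ∫ ξ in η..s, entrySum (a s) * (entrySum (b ξ) * M) := by
        refine intervalIntegral.norm_integral_le_of_norm_le hηs ?_ ((hi.mul_const _).const_mul _)
        filter_upwards with ξ hξ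
        rw [Matrix.mul_assoc]
        exact norm_mul_entry_le _ _ _ _ fun j => norm_mul_entry_le _ _ _ _ fun j' =>
          hW ξ (Ioc_subset_Icc_self hξ) _ _
    _ = entrySum (a s) * ((∫ s in η..s, entrySum (b s)) * M) := by
        rw [intervalIntegral.integral_const_mul, intervalIntegral.integral_mul_const]
    _ ≤ _ := mul_le_mul_of_nonneg_left (mul_le_mul_of_nonneg_right
        (hb.integral_entrySum_le hη hηs hs) hM) (entrySum_nonneg _)

include ha hb in
lemma norm_innerSep_le {M t η : ℝ} (hη : 0 ≤ η) (hηt : η ≤ t) (ht : t ≤ r)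
    (hW : ∀ s ∈ Icc η t, ∀ i k, ‖W s η i k‖ ≤ M) (i k : Fin n) :
    ‖innerSep a b W t η i k‖
      ≤ (∫ s in (0 : ℝ)..r, entrySum (a s)) * ((∫ s in (0 : ℝ)..r, entrySum (b s)) * M) := by
  have hM : 0 ≤ M := (norm_nonneg _).trans (hW η ⟨le_rfl, hηt⟩ i k)
  have hi : IntervalIntegrable (fun s => entrySum (a s)) volume η t :=
    intervalIntegrable_mono ha.intervalIntegrable_entrySum ⟨hη, hηt.trans ht⟩ ⟨hη.trans hηt, ht⟩
  calc ‖innerSep a b W t η i k‖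
      ≤ ∫ s in η..t, entrySum (a s) * ((∫ s in (0 : ℝ)..r, entrySum (b s)) * M) := by
        refine intervalIntegral.norm_integral_le_of_norm_le hηt ?_ (hi.mul_const _)
        filter_upwards with s hs
        exact norm_innerSep_inner_le hb hη hs.1.le (hs.2.trans ht)
          (fun ξ hξ => hW ξ ⟨hξ.1, hξ.2.trans hs.2⟩) i k
    _ = (∫ s in η..t, entrySum (a s)) * ((∫ s in (0 : ℝ)..r, entrySum (b s)) * M) :=
        intervalIntegral.integral_mul_const _ _
    _ ≤ _ := mul_le_mul_of_nonneg_right (ha.integral_entrySum_le hη hηt ht)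
        (mul_nonneg (intervalIntegral.integral_nonneg (hη.trans (hηt.trans ht))
          fun _ _ => entrySum_nonneg _) hM)

/-- The function `φ` of the recursion step. -/
def stepPhi (v : ℝ → Matrix (Fin n) (Fin n) ℂ) (a : ℝ → Matrix (Fin n) m ℂ)
    (b : ℝ → Matrix m (Fin n) ℂ) (W : ℝ → ℝ → Matrix (Fin n) (Fin n) ℂ) (t η : ℝ) :
    Matrix (Fin n) (Fin n) ℂ := innerPot v W t η - innerSep a b W t η

/-- The constant in the bound for the recursion step. -/
def stepConst (r : ℝ) (v : ℝ → Matrix (Fin n) (Fin n) ℂ) (a : ℝ → Matrix (Fin n) m ℂ)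
    (b : ℝ → Matrix m (Fin n) ℂ) : ℝ :=
  (∫ s in (0 : ℝ)..r, entrySum (v s))
    + (∫ s in (0 : ℝ)..r, entrySum (a s)) * (∫ s in (0 : ℝ)..r, entrySum (b s))

omit hr hv ha hb in
lemma stepConst_nonneg (hr : 0 ≤ r) : 0 ≤ stepConst r v a b :=
  add_nonneg (IsCoef.integral_entrySum_nonneg hr)
    (mul_nonneg (IsCoef.integral_entrySum_nonneg hr) (IsCoef.integral_entrySum_nonneg hr))

include hv ha hb in
lemma norm_stepPhi_le {M t η : ℝ} (hη : 0 ≤ η) (hηt : η ≤ t) (ht : t ≤ r)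
    (hW : ∀ s ∈ Icc η t, ∀ i k, ‖W s η i k‖ ≤ M) (i k : Fin n) :
    ‖stepPhi v a b W t η i k‖ ≤ stepConst r v a b * M := by
  have h1 := norm_innerPot_le hv hη hηt ht hW i k
  have h2 := norm_innerSep_le ha hb hη hηt ht hW i k
  have h3 := norm_sub_le (innerPot v W t η i k) (innerSep a b W t η i k)
  calc _ ≤ _ := h3
    _ ≤ _ := add_le_add h1 h2
    _ = _ := by rw [stepConst]; ring

include hv ha hb in
lemma measurable_stepPhi (hW : ∀ i k, Measurable fun p : ℝ × ℝ => W p.1 p.2 i k) (i k : Fin n) :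
    Measurable (Function.uncurry fun t η => stepPhi v a b W t η i k) :=
  (measurable_innerPot hv.measurable hW i k).sub
    (measurable_innerSep ha.measurable hb.measurable hW i k)

include hr hv ha hb in
-- The six integrals group into d'Alembert sums of the potential part and of the separable part.
-- Boundedness of W supplies the integrability needed to subtract under the integrals.
lemma kernelStep_apply (hW : IsBddKer r W B) {x ζ : ℝ} (hζ : 0 ≤ ζ) (hζx : ζ ≤ x) (hx : x ≤ r)
    (i k : Fin n) :
    kernelStep v a b W x ζ i k = dAlembert (fun t η => stepPhi v a b W t η i k) x ζ := by
  have e := dAlembert_sub (r := r) (φ := fun t η => innerPot v W t η i k)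
    (ψ := fun t η => innerSep a b W t η i k) hr
    (measurable_innerPot hv.measurable hW.measurable i k) intervalIntegrable_const
    (fun t η h1 h2 h3 => norm_innerPot_le hv h1 h2 h3
      (fun s hs => hW.bound s η h1 hs.1 (hs.2.trans h3)) i k)
    (measurable_innerSep ha.measurable hb.measurable hW.measurable i k) intervalIntegrable_const
    (fun t η h1 h2 h3 => norm_innerSep_le ha hb h1 h2 h3
      (fun s hs => hW.bound s η h1 hs.1 (hs.2.trans h3)) i k) hζ hζx hx
  simp only [stepPhi, Matrix.sub_apply]
  rw [e]
  simp only [kernelStep, dAlembert, matInt, Matrix.smul_apply, Matrix.sub_apply, Matrix.add_apply,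
    Matrix.of_apply, smul_eq_mul]
  ring

include hv ha hb in
lemma measurable_kernelStep (hW : ∀ i k, Measurable fun p : ℝ × ℝ => W p.1 p.2 i k)
    (i k : Fin n) : Measurable fun p : ℝ × ℝ => kernelStep v a b W p.1 p.2 i k := by
  have h1 := measurable_innerPot hv.measurable hW i k
  have h2 := measurable_innerSep ha.measurable hb.measurable hW i k
  have key : ∀ {F : ℝ → ℝ → ℂ}, Measurable (Function.uncurry F) →
      ∀ {e : ℝ × ℝ → ℝ → ℝ} {α β : ℝ × ℝ → ℝ}, Measurable (Function.uncurry e) → Measurable α →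
      Measurable β → Measurable fun p => ∫ t in (α p)..(β p), F t (e p t) := by
    intro F hF e α β he hα hβ
    exact measurable_intervalIntegral (F := fun p t => F t (e p t))
      (hF.comp (measurable_snd.prodMk he)) hα hβ
  simp only [kernelStep, matInt, Matrix.smul_apply, Matrix.sub_apply, Matrix.add_apply,
    Matrix.of_apply, smul_eq_mul]
  refine Measurable.const_mul ?_ _
  refine ((((Measurable.add (Measurable.add ?_ ?_) ?_).sub ?_).sub ?_).sub ?_)
  · exact key h1 (by fun_prop) (by fun_prop) (by fun_prop)
  · exact key h1 (by fun_prop) (by fun_prop) (by fun_prop)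
  · exact key h1 (by fun_prop) (by fun_prop) (by fun_prop)
  · exact key h2 (by fun_prop) (by fun_prop) (by fun_prop)
  · exact key h2 (by fun_prop) (by fun_prop) (by fun_prop)
  · exact key h2 (by fun_prop) (by fun_prop) (by fun_prop)

include hv ha hb in
lemma measurable_kernelFirst (i k : Fin n) :
    Measurable fun p : ℝ × ℝ => kernelFirst v a b p.1 p.2 i k := by
  have h1 : Measurable (Function.uncurry fun (_ : ℝ × ℝ) t => v t i k) :=
    (hv.measurable i k).comp measurable_snd
  have h2 := measurable_Fbreve ha.measurable hb.measurable i k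
  have key : ∀ {F : ℝ → ℝ → ℂ}, Measurable (Function.uncurry F) →
      ∀ {e : ℝ × ℝ → ℝ → ℝ} {α β : ℝ × ℝ → ℝ}, Measurable (Function.uncurry e) → Measurable α →
      Measurable β → Measurable fun p => ∫ t in (α p)..(β p), F t (e p t) := by
    intro F hF e α β he hα hβ
    exact measurable_intervalIntegral (F := fun p t => F t (e p t))
      (hF.comp (measurable_snd.prodMk he)) hα hβ
  simp only [kernelFirst, matInt, Matrix.smul_apply, Matrix.sub_apply, Matrix.add_apply,
    Matrix.of_apply, smul_eq_mul]
  refine Measurable.const_mul ?_ _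
  refine ((((Measurable.add ?_ ?_).sub ?_).sub ?_).sub ?_)
  · exact measurable_intervalIntegral h1 (by fun_prop) (by fun_prop)
  · exact measurable_intervalIntegral h1 (by fun_prop) (by fun_prop)
  · exact key h2 (by fun_prop) (by fun_prop) (by fun_prop)
  · exact key h2 (by fun_prop) (by fun_prop) (by fun_prop)
  · exact key h2 (by fun_prop) (by fun_prop) (by fun_prop)

include hr hv ha hb in
-- For the source v(η), which does not involve t, the three segments give the integrals of v over
-- [0,ζ], [ζ,(x+ζ)/2] and [0,(x−ζ)/2]. The first two join, leaving the two potential integrals of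
-- the definition.
lemma kernelFirst_apply {x ζ : ℝ} (hζ : 0 ≤ ζ) (hζx : ζ ≤ x) (hx : x ≤ r) (i k : Fin n) :
    kernelFirst v a b x ζ i k = dAlembert (fun t η => v η i k - Fbreve a b t η i k) x ζ := by
  have e := dAlembert_sub (r := r) (φ := fun _ η => v η i k)
    (ψ := fun t η => Fbreve a b t η i k) hr
    ((hv.measurable i k).comp measurable_snd) hv.intervalIntegrable_entrySum
    (fun t η h1 h2 h3 => norm_entry_le_entrySum _ _ _)
    (measurable_Fbreve ha.measurable hb.measurable i k)
    (hb.intervalIntegrable_entrySum.const_mul _)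
    (fun t η h1 h2 h3 => norm_Fbreve_le ha h1 h2 h3 i k) hζ hζx hx
  have hi : ∀ {y z}, y ∈ Icc 0 r → z ∈ Icc 0 r →
      IntervalIntegrable (fun t => v t i k) volume y z := fun hy hz =>
    intervalIntegrable_mono (hv.intervalIntegrable i k) hy hz
  have e1 : ∫ t in (x - ζ)..x, v (ζ + t - x) i k = ∫ t in (0 : ℝ)..ζ, v t i k := by
    have := intervalIntegral.integral_comp_add_right (a := x - ζ) (b := x)
      (fun t => v t i k) (ζ - x)
    rw [show x - ζ + (ζ - x) = 0 by ring, show x + (ζ - x) = ζ by ring] at this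
    rw [← this]
    refine intervalIntegral.integral_congr fun t _ => ?_
    congr 2
    ring
  have e2 : ∫ t in ((x + ζ) / 2)..x, v (ζ + x - t) i k = ∫ t in ζ..((x + ζ) / 2), v t i k := by
    have := intervalIntegral.integral_comp_sub_left (a := (x + ζ) / 2) (b := x)
      (fun t => v t i k) (ζ + x)
    rw [this]
    congr 1 <;> ring
  have e3 : ∫ t in ((x - ζ) / 2)..(x - ζ), v (x - t - ζ) i k
      = ∫ t in (0 : ℝ)..((x - ζ) / 2), v t i k := by
    have := intervalIntegral.integral_comp_sub_left (a := (x - ζ) / 2) (b := x - ζ)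
      (fun t => v t i k) (x - ζ)
    rw [show x - ζ - (x - ζ) = 0 by ring, show x - ζ - (x - ζ) / 2 = (x - ζ) / 2 by ring] at this
    rw [← this]
    refine intervalIntegral.integral_congr fun t _ => ?_
    rw [sub_right_comm]
  have e4 := intervalIntegral.integral_add_adjacent_intervals
    (hi ⟨le_rfl, hr⟩ ⟨hζ, hζx.trans hx⟩)
    (hi (y := ζ) (z := (x + ζ) / 2) ⟨hζ, hζx.trans hx⟩ ⟨by linarith, by linarith⟩)
  have e5 : ∀ t, x - t + ζ = ζ + x - t := fun t => by ring
  rw [e]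
  simp only [kernelFirst, dAlembert, matInt, Matrix.smul_apply, Matrix.sub_apply, Matrix.add_apply,
    Matrix.of_apply, smul_eq_mul, e5]
  rw [e1, e2, e3, ← e4]
  ring

end Bounds

end Kernel

/-! ### The kernel series: convergence and the fixed point equation -/

section Kernel

variable {m : Type*} [Fintype m] {n : ℕ} {r : ℝ}
  {v : ℝ → Matrix (Fin n) (Fin n) ℂ} {a : ℝ → Matrix (Fin n) m ℂ}
  {b : ℝ → Matrix m (Fin n) ℂ} {W W' : ℝ → ℝ → Matrix (Fin n) (Fin n) ℂ} {B B' : ℝ}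

lemma intervalIntegrable_mul_ker (hv : IsCoef r v) (hW : IsBddKer r W B) {η t : ℝ} (hη : 0 ≤ η)
    (hηt : η ≤ t) (ht : t ≤ r) (i k : Fin n) :
    IntervalIntegrable (fun s => (v s * W s η) i k) volume η t := by
  have hi : IntervalIntegrable (fun s => entrySum (v s)) volume η t :=
    intervalIntegrable_mono hv.intervalIntegrable_entrySum ⟨hη, hηt.trans ht⟩ ⟨hη.trans hηt, ht⟩
  refine intervalIntegrable_of_norm_le hηt ?_ (hi.mul_const B) fun s hs => ?_
  · exact measurable_mul_entry hv.measurable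
      (fun i k => (hW.measurable i k).comp (f := fun s => (s, η)) (by fun_prop)) i k
  · exact norm_mul_entry_le _ _ _ _ fun j => hW.bound s η hη hs.1 (hs.2.trans ht) _ _

lemma intervalIntegrable_sep_inner (hb : IsCoef r b) (hW : IsBddKer r W B) {η s : ℝ}
    (A : Matrix (Fin n) m ℂ) (hη : 0 ≤ η) (hηs : η ≤ s) (hs : s ≤ r) (i k : Fin n) :
    IntervalIntegrable (fun ξ => (A * b ξ * W ξ η) i k) volume η s := by
  have hi : IntervalIntegrable (fun s => entrySum (b s)) volume η s :=
    intervalIntegrable_mono hb.intervalIntegrable_entrySum ⟨hη, hηs.trans hs⟩ ⟨hη.trans hηs, hs⟩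
  refine intervalIntegrable_of_norm_le hηs ?_ ((hi.mul_const B).const_mul (entrySum A))
    fun ξ hξ => ?_
  · have h1 : ∀ i k, Measurable fun ξ => (A * b ξ) i k := fun i k =>
      measurable_mul_entry (M := fun _ => A) (fun _ _ => measurable_const) hb.measurable i k
    have h2 : ∀ i k, Measurable fun ξ => W ξ η i k := fun i k =>
      (hW.measurable i k).comp (f := fun s => (s, η)) (by fun_prop)
    exact measurable_mul_entry h1 h2 i k
  · rw [Matrix.mul_assoc]
    exact norm_mul_entry_le _ _ _ _ fun j => norm_mul_entry_le _ _ _ _ fun j' =>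
      hW.bound ξ η hη hξ.1 (hξ.2.trans hs) _ _

lemma intervalIntegrable_sep (ha : IsCoef r a) (hb : IsCoef r b) (hW : IsBddKer r W B) {η t : ℝ}
    (hη : 0 ≤ η) (hηt : η ≤ t) (ht : t ≤ r) (i k : Fin n) :
    IntervalIntegrable (fun s => matInt η s (fun ξ => a s * b ξ * W ξ η) i k) volume η t := by
  have hi : IntervalIntegrable (fun s => entrySum (a s)) volume η t :=
    intervalIntegrable_mono ha.intervalIntegrable_entrySum ⟨hη, hηt.trans ht⟩ ⟨hη.trans hηt, ht⟩
  refine intervalIntegrable_of_norm_le hηt ?_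
    (hi.mul_const ((∫ s in (0 : ℝ)..r, entrySum (b s)) * B)) fun s hs => ?_
  · exact (measurable_innerSep_inner ha.measurable hb.measurable hW.measurable i k).comp
      (f := fun s => (s, η)) (by fun_prop)
  · exact norm_innerSep_inner_le hb hη hs.1 (hs.2.trans ht)
      (fun ξ hξ => hW.bound ξ η hη hξ.1 (hξ.2.trans (hs.2.trans ht))) i k

lemma IsBddKer.add (hW : IsBddKer r W B) (hW' : IsBddKer r W' B') :
    IsBddKer r (fun x ζ => W x ζ + W' x ζ) (B + B') :=
  ⟨fun i k => (hW.measurable i k).add (hW'.measurable i k), fun x ζ h1 h2 h3 i k =>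
    (norm_add_le _ _).trans (add_le_add (hW.bound x ζ h1 h2 h3 i k) (hW'.bound x ζ h1 h2 h3 i k))⟩

variable (hr : 0 ≤ r) (hv : IsCoef r v) (ha : IsCoef r a) (hb : IsCoef r b)

include hv ha hb

lemma stepPhi_add (hW : IsBddKer r W B) (hW' : IsBddKer r W' B') {t η : ℝ} (hη : 0 ≤ η)
    (hηt : η ≤ t) (ht : t ≤ r) (i k : Fin n) :
    stepPhi v a b (fun x ζ => W x ζ + W' x ζ) t η i k
      = stepPhi v a b W t η i k + stepPhi v a b W' t η i k := by
  simp only [stepPhi, innerPot, innerSep, Matrix.sub_apply]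
  have e1 : matInt η t (fun s => v s * (W s η + W' s η)) i k
      = matInt η t (fun s => v s * W s η) i k + matInt η t (fun s => v s * W' s η) i k := by
    simp only [matInt, Matrix.of_apply, Matrix.mul_add, Matrix.add_apply]
    exact intervalIntegral.integral_add (intervalIntegrable_mul_ker hv hW hη hηt ht i k)
      (intervalIntegrable_mul_ker hv hW' hη hηt ht i k)
  have e2 : matInt η t (fun s => matInt η s fun ξ => a s * b ξ * (W ξ η + W' ξ η)) i k
      = matInt η t (fun s => matInt η s fun ξ => a s * b ξ * W ξ η) i k
        + matInt η t (fun s => matInt η s fun ξ => a s * b ξ * W' ξ η) i k := by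
    have := intervalIntegral.integral_add (intervalIntegrable_sep ha hb hW hη hηt ht i k)
      (intervalIntegrable_sep ha hb hW' hη hηt ht i k)
    refine Eq.trans ?_ this
    refine intervalIntegral.integral_congr fun s hs => ?_
    rw [uIcc_of_le hηt] at hs
    simp only [matInt, Matrix.of_apply, Matrix.mul_add, Matrix.add_apply]
    exact intervalIntegral.integral_add
      (intervalIntegrable_sep_inner hb hW _ hη hs.1 (hs.2.trans ht) i k)
      (intervalIntegrable_sep_inner hb hW' _ hη hs.1 (hs.2.trans ht) i k)
  rw [e1, e2]
  ring

include hr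

lemma kernelStep_add (hW : IsBddKer r W B) (hW' : IsBddKer r W' B') {x ζ : ℝ} (hζ : 0 ≤ ζ)
    (hζx : ζ ≤ x) (hx : x ≤ r) (i k : Fin n) :
    kernelStep v a b (fun x ζ => W x ζ + W' x ζ) x ζ i k
      = kernelStep v a b W x ζ i k + kernelStep v a b W' x ζ i k := by
  rw [kernelStep_apply hr hv ha hb (hW.add hW') hζ hζx hx,
    kernelStep_apply hr hv ha hb hW hζ hζx hx, kernelStep_apply hr hv ha hb hW' hζ hζx hx,
    ← dAlembert_add (r := r) hr (measurable_stepPhi hv ha hb hW.measurable i k)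
      intervalIntegrable_const
      (fun t η h1 h2 h3 => norm_stepPhi_le hv ha hb h1 h2 h3
        (fun s hs => hW.bound s η h1 hs.1 (hs.2.trans h3)) i k)
      (measurable_stepPhi hv ha hb hW'.measurable i k) intervalIntegrable_const
      (fun t η h1 h2 h3 => norm_stepPhi_le hv ha hb h1 h2 h3
        (fun s hs => hW'.bound s η h1 hs.1 (hs.2.trans h3)) i k) hζ hζx hx]
  exact dAlembert_congr hζ hζx hx fun t η h1 h2 h3 =>
    stepPhi_add hv ha hb hW hW' h1 h2 h3 i k

/-- The source at (t,η) uses W(s,η) only for s ≤ t, where the monotone μ is at most μ(t). Hence only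
the integration in t survives in the estimate. -/
lemma norm_kernelStep_le {μ : ℝ → ℝ} (hμ : MonotoneOn μ (Icc 0 r)) (hW : IsBddKer r W B)
    (hWμ : ∀ x ζ, 0 ≤ ζ → ζ ≤ x → x ≤ r → ∀ i k, ‖W x ζ i k‖ ≤ μ x)
    {x ζ : ℝ} (hζ : 0 ≤ ζ) (hζx : ζ ≤ x) (hx : x ≤ r) (i k : Fin n) :
    ‖kernelStep v a b W x ζ i k‖ ≤ ∫ t in (0 : ℝ)..x, stepConst r v a b * μ t := by
  have hμi : IntervalIntegrable μ volume 0 x := by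
    refine MonotoneOn.intervalIntegrable ?_
    rw [uIcc_of_le (hζ.trans hζx)]
    exact hμ.mono (Icc_subset_Icc_right hx)
  rw [kernelStep_apply hr hv ha hb hW hζ hζx hx]
  refine norm_dAlembert_le_integral (r := r) hr (measurable_stepPhi hv ha hb hW.measurable i k)
    intervalIntegrable_const (fun t η h1 h2 h3 => norm_stepPhi_le hv ha hb h1 h2 h3
        (fun s hs => hW.bound s η h1 hs.1 (hs.2.trans h3)) i k) (hμi.const_mul _) ?_ hζ hζx hx
  intro t η h1 h2 h3
  refine norm_stepPhi_le hv ha hb h1 h2 (h3.trans hx) (fun s hs i k => ?_) i k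
  have hs' : s ≤ r := hs.2.trans (h3.trans hx)
  exact (hWμ s η h1 hs.1 hs' i k).trans
    (hμ ⟨h1.trans hs.1, hs'⟩ ⟨h1.trans h2, h3.trans hx⟩ hs.2)

/-- The coefficients of the kernel series decay factorially. -/
lemma kernelTerm_bound : ∃ M : ℝ, 0 ≤ M ∧ ∀ N : ℕ,
    (∀ i k, Measurable fun p : ℝ × ℝ => kernelTerm v a b N p.1 p.2 i k) ∧
    ∀ x ζ, 0 ≤ ζ → ζ ≤ x → x ≤ r → ∀ i k,
      ‖kernelTerm v a b N x ζ i k‖ ≤ M * ((stepConst r v a b * x) ^ N / N.factorial) := by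
  -- c majorizes the source v(η) − ℱ̆(t,η) of the first term, and M, the mass of its even extension,
  -- bounds that term.
  set c : ℝ → ℝ := fun η => entrySum (v η)
    + (∫ s in (0 : ℝ)..r, entrySum (a s)) * entrySum (b η) with hc
  have hci : IntervalIntegrable c volume 0 r :=
    hv.intervalIntegrable_entrySum.add (hb.intervalIntegrable_entrySum.const_mul _)
  have hc0 : ∀ η, 0 ≤ c η := fun η => add_nonneg (entrySum_nonneg _)
    (mul_nonneg (IsCoef.integral_entrySum_nonneg hr) (entrySum_nonneg _))
  have hC := stepConst_nonneg (v := v) (a := a) (b := b) hr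
  set C := stepConst r v a b with hCdef
  set M := ∫ η, evenExt r c η with hM
  have hM0 : 0 ≤ M := integral_nonneg fun η => by
    simp only [evenExt]; split_ifs <;> simp [hc0]
  refine ⟨M, hM0, fun N => ?_⟩
  induction N with
  | zero =>
    refine ⟨measurable_kernelFirst hv ha hb, fun x ζ h1 h2 h3 i k => ?_⟩
    simp only [kernelTerm, pow_zero, Nat.factorial_zero, Nat.cast_one, div_one, mul_one]
    rw [kernelFirst_apply hr hv ha hb h1 h2 h3]
    refine norm_dAlembert_le hr ?_ hci (fun t η h1 h2 h3 => ?_) h1 h2 h3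
    · exact ((hv.measurable i k).comp measurable_snd).sub
        (measurable_Fbreve ha.measurable hb.measurable i k)
    · exact (norm_sub_le _ _).trans (add_le_add (norm_entry_le_entrySum _ _ _)
        (norm_Fbreve_le ha h1 h2 h3 i k))
  | succ N ih =>
    refine ⟨measurable_kernelStep hv ha hb ih.1, fun x ζ h1 h2 h3 i k => ?_⟩
    have hmono : MonotoneOn (fun x : ℝ => M * ((C * x) ^ N / N.factorial)) (Icc 0 r) := by
      intro x hx y hy hxy
      have := hx.1
      simp only
      gcongr
    have hB : IsBddKer r (kernelTerm v a b N) (M * ((C * r) ^ N / N.factorial)) :=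
      ⟨ih.1, fun x ζ h1 h2 h3 i k => (ih.2 x ζ h1 h2 h3 i k).trans
        (hmono ⟨h1.trans h2, h3⟩ ⟨hr, le_rfl⟩ h3)⟩
    refine (norm_kernelStep_le hr hv ha hb hmono hB ih.2 h1 h2 h3 i k).trans (le_of_eq ?_)
    have e : ∀ t : ℝ, C * (M * ((C * t) ^ N / N.factorial))
        = (C * M * C ^ N / N.factorial) * t ^ N := fun t => by rw [mul_pow]; ring
    simp only [← hCdef, e]
    rw [intervalIntegral.integral_const_mul, integral_pow, Nat.factorial_succ]
    push_cast
    have : (N.factorial : ℝ) ≠ 0 := by positivity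
    have : (N : ℝ) + 1 ≠ 0 := by positivity
    field_simp
    ring

/-- The sum of the kernel series, with its fixed point equation. -/
lemma exists_kernelSum : ∃ (W : ℝ → ℝ → Matrix (Fin n) (Fin n) ℂ) (B : ℝ), IsBddKer r W B ∧
    (∀ x ζ, 0 ≤ ζ → ζ ≤ x → x ≤ r → HasSum (fun N => kernelTerm v a b N x ζ) (W x ζ)) ∧
    ∀ x ζ, 0 ≤ ζ → ζ ≤ x → x ≤ r → ∀ i k, W x ζ i k
      = dAlembert (fun t η => v η i k - Fbreve a b t η i k + stepPhi v a b W t η i k) x ζ := by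
  obtain ⟨M, hM0, hM⟩ := kernelTerm_bound hr hv ha hb
  have hC := stepConst_nonneg (v := v) (a := a) (b := b) hr
  set C := stepConst r v a b with hCdef
  set T : Set (ℝ × ℝ) := {p | 0 ≤ p.2 ∧ p.2 ≤ p.1 ∧ p.1 ≤ r} with hT
  have hTm : MeasurableSet T := by
    refine (measurableSet_le measurable_const measurable_snd).inter
      ((measurableSet_le measurable_snd measurable_fst).inter
        (measurableSet_le measurable_fst measurable_const))
  set b' : ℕ → ℝ := fun N => M * ((C * r) ^ N / N.factorial) with hb'
  have hb's : Summable b' := (Real.summable_pow_div_factorial _).mul_left _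
  have hb'0 : ∀ N, 0 ≤ b' N := fun N => by positivity
  -- The terms are cut off to the triangle, so that the series converges everywhere and its sum is
  -- measurable on the plane.
  set t' : ℕ → ℝ → ℝ → Matrix (Fin n) (Fin n) ℂ := fun N x ζ =>
    T.indicator (fun p => kernelTerm v a b N p.1 p.2) (x, ζ) with ht'
  have htT : ∀ N x ζ, (x, ζ) ∈ T → t' N x ζ = kernelTerm v a b N x ζ := fun N x ζ h => by
    simp only [ht', indicator_of_mem h]
  have htn : ∀ N x ζ i k, ‖t' N x ζ i k‖ ≤ b' N := by
    intro N x ζ i k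
    by_cases h : (x, ζ) ∈ T
    · rw [htT N x ζ h]
      refine ((hM N).2 x ζ h.1 h.2.1 h.2.2 i k).trans ?_
      have : 0 ≤ x := h.1.trans h.2.1
      have := h.2.2
      simp only [hb']
      gcongr
    · simp only [ht', indicator_of_notMem h, Matrix.zero_apply, norm_zero]
      exact hb'0 N
  have htm : ∀ N i k, Measurable fun p : ℝ × ℝ => t' N p.1 p.2 i k := by
    intro N i k
    have : (fun p : ℝ × ℝ => t' N p.1 p.2 i k)
        = T.indicator fun p => kernelTerm v a b N p.1 p.2 i k := by
      ext p
      simp only [ht', indicator]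
      split_ifs <;> rfl
    rw [this]
    exact ((hM N).1 i k).indicator hTm
  have hsum : ∀ x ζ i k, Summable fun N => t' N x ζ i k := fun x ζ i k =>
    Summable.of_norm_bounded hb's fun N => htn N x ζ i k
  set W : ℝ → ℝ → Matrix (Fin n) (Fin n) ℂ := fun x ζ =>
    Matrix.of fun i k => ∑' N, t' N x ζ i k with hW
  have hSW : ∀ x ζ i k, Filter.Tendsto (fun N => ∑ l ∈ Finset.range N, t' l x ζ i k) Filter.atTop
      (nhds (W x ζ i k)) := fun x ζ i k => (hsum x ζ i k).hasSum.tendsto_sum_nat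
  have hWm : ∀ i k, Measurable fun p : ℝ × ℝ => W p.1 p.2 i k := by
    intro i k
    refine measurable_of_tendsto_metrizable
      (f := fun N p => ∑ l ∈ Finset.range N, t' l p.1 p.2 i k)
      (fun N => Finset.measurable_sum _ fun l _ => htm l i k) ?_
    rw [tendsto_pi_nhds]
    exact fun p => hSW p.1 p.2 i k
  have hWb : IsBddKer r W (∑' N, b' N) :=
    ⟨hWm, fun x ζ _ _ _ i k => tsum_of_norm_bounded hb's.hasSum fun N => htn N x ζ i k⟩
  refine ⟨W, ∑' N, b' N, hWb, fun x ζ h1 h2 h3 => ?_, fun x ζ h1 h2 h3 i k => ?_⟩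
  · refine Pi.hasSum.2 fun i => Pi.hasSum.2 fun k => ?_
    have : HasSum (fun N => t' N x ζ i k) (W x ζ i k) := (hsum x ζ i k).hasSum
    simpa only [htT _ x ζ ⟨h1, h2, h3⟩] using this
  -- the partial sums
  set S : ℕ → ℝ → ℝ → Matrix (Fin n) (Fin n) ℂ := fun N x ζ =>
    Matrix.of fun i k => ∑ l ∈ Finset.range N, t' l x ζ i k with hS
  have htB : ∀ N, IsBddKer r (t' N) (b' N) := fun N => ⟨htm N, fun x ζ _ _ _ => htn N x ζ⟩
  have hSB : ∀ N, IsBddKer r (S N) (∑ l ∈ Finset.range N, b' l) := fun N =>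
    ⟨fun i k => show Measurable fun p : ℝ × ℝ => ∑ l ∈ Finset.range N, t' l p.1 p.2 i k from
        Finset.measurable_sum _ fun l _ => htm l i k,
      fun x ζ _ _ _ i k => norm_sum_le_of_le (Finset.range N) fun l _ => htn l x ζ i k⟩
  have hstep_congr : ∀ N, kernelStep v a b (t' N) x ζ i k = kernelTerm v a b (N + 1) x ζ i k := by
    intro N
    have hB : IsBddKer r (kernelTerm v a b N) (b' N) :=
      ⟨(hM N).1, fun x ζ h1 h2 h3 i k => by
        rw [← htT N x ζ ⟨h1, h2, h3⟩]; exact htn N x ζ i k⟩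
    rw [kernelTerm, kernelStep_apply hr hv ha hb (htB N) h1 h2 h3,
      kernelStep_apply hr hv ha hb hB h1 h2 h3]
    refine dAlembert_congr h1 h2 h3 fun t η h4 h5 h6 => ?_
    simp only [stepPhi, innerPot, innerSep, matInt, Matrix.sub_apply, Matrix.of_apply]
    congr 1
    · refine intervalIntegral.integral_congr fun s hs => ?_
      rw [uIcc_of_le h5] at hs
      rw [htT N s η ⟨h4, hs.1, hs.2.trans h6⟩]
    · refine intervalIntegral.integral_congr fun s hs => ?_
      rw [uIcc_of_le h5] at hs
      refine intervalIntegral.integral_congr fun ξ hξ => ?_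
      rw [uIcc_of_le hs.1] at hξ
      rw [htT N ξ η ⟨h4, hξ.1, hξ.2.trans (hs.2.trans h6)⟩]
  have hstepS : ∀ N, kernelStep v a b (S N) x ζ i k
      = ∑ l ∈ Finset.range N, kernelTerm v a b (l + 1) x ζ i k := by
    intro N
    induction N with
    | zero =>
      have : S 0 = fun _ _ => 0 := by
        ext x ζ i k
        simp [hS]
      rw [this]
      simp [kernelStep, innerPot, innerSep, matInt]
    | succ N ih =>
      have : S (N + 1) = fun x ζ => S N x ζ + t' N x ζ := by
        ext x ζ i k
        simp [hS, Finset.sum_range_succ]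
      rw [this, kernelStep_add hr hv ha hb (hSB N) (htB N) h1 h2 h3, ih, hstep_congr,
        Finset.sum_range_succ]
  -- By additivity the recursion step acts on the tail W − S_N alone, and it is bounded by Cx times
  -- the supremum of that tail.
  have hdiff : ∀ N, ‖kernelStep v a b W x ζ i k - kernelStep v a b (S N) x ζ i k‖
      ≤ C * x * (∑' l, b' (l + N)) := by
    intro N
    have hneg : IsBddKer r (fun x ζ => W x ζ + -S N x ζ) (∑' l, b' (l + N)) := by
      refine ⟨fun i k => (hWm i k).add ((hSB N).measurable i k).neg, fun x ζ h1 h2 h3 i k => ?_⟩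
      have e := (hsum x ζ i k).sum_add_tsum_nat_add N
      have : (W x ζ + -S N x ζ) i k = ∑' l, t' (l + N) x ζ i k := by
        simp only [hW, hS, Matrix.add_apply, Matrix.neg_apply, Matrix.of_apply]
        rw [← e]
        ring
      rw [this]
      exact tsum_of_norm_bounded ((summable_nat_add_iff N).2 hb's).hasSum
        fun l => htn (l + N) x ζ i k
    have e1 := kernelStep_add hr hv ha hb hneg (hSB N) h1 h2 h3 i k
    simp only [neg_add_cancel_right] at e1
    rw [e1, add_sub_cancel_right]
    refine (norm_kernelStep_le hr hv ha hb (μ := fun _ => ∑' l, b' (l + N))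
      (fun _ _ _ _ _ => le_rfl) hneg hneg.bound h1 h2 h3 i k).trans (le_of_eq ?_)
    simp [hCdef]
    ring
  have hlim1 : Filter.Tendsto (fun N => kernelStep v a b (S N) x ζ i k) Filter.atTop
      (nhds (kernelStep v a b W x ζ i k)) := by
    rw [tendsto_iff_norm_sub_tendsto_zero]
    have h0 := (tendsto_sum_nat_add b').const_mul (C * x)
    rw [mul_zero] at h0
    refine squeeze_zero (fun N => norm_nonneg _) (fun N => ?_) h0
    rw [norm_sub_rev]
    exact hdiff N
  -- One step applied to the N-th partial sum is the next partial sum without its first term.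
  -- Comparing the two limits gives the fixed point equation.
  have hlim2 : Filter.Tendsto (fun N => kernelStep v a b (S N) x ζ i k) Filter.atTop
      (nhds (W x ζ i k - kernelTerm v a b 0 x ζ i k)) := by
    have h0 := ((hSW x ζ i k).comp (Filter.tendsto_add_atTop_nat 1)).sub_const
      (kernelTerm v a b 0 x ζ i k)
    refine h0.congr fun N => ?_
    rw [hstepS, Function.comp_apply, Finset.sum_range_succ']
    simp only [htT _ x ζ ⟨h1, h2, h3⟩]
    ring
  have hfix := tendsto_nhds_unique hlim1 hlim2
  have e0 : W x ζ i k = kernelFirst v a b x ζ i k + kernelStep v a b W x ζ i k := by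
    rw [hfix, kernelTerm]
    ring
  rw [e0, kernelFirst_apply hr hv ha hb h1 h2 h3, kernelStep_apply hr hv ha hb hWb h1 h2 h3]
  refine (dAlembert_add (r := r) hr ?_ (hv.intervalIntegrable_entrySum.add
    (hb.intervalIntegrable_entrySum.const_mul (∫ s in (0 : ℝ)..r, entrySum (a s)))) ?_
    (measurable_stepPhi hv ha hb hWm i k) intervalIntegrable_const
    (fun t η h1 h2 h3 => norm_stepPhi_le hv ha hb h1 h2 h3
      (fun s hs => hWb.bound s η h1 hs.1 (hs.2.trans h3)) i k) h1 h2 h3).symm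
  · exact ((hv.measurable i k).comp measurable_snd).sub
      (measurable_Fbreve ha.measurable hb.measurable i k)
  · intro t η h1 h2 h3
    exact (norm_sub_le _ _).trans (add_le_add (norm_entry_le_entrySum _ _ _)
      (norm_Fbreve_le ha h1 h2 h3 i k))

end Kernel

/-! ### The operator with the kernel `𝒱` -/

/-- The bound is available only on the triangle, so the integrand is cut off there; the product
majorant then makes it integrable on the square. -/
lemma integral_triangle_swap_of_le {x : ℝ} (hx : 0 ≤ x) {F : ℝ → ℝ → ℂ}
    (hF : Measurable (Function.uncurry F)) {α γ : ℝ → ℝ} (hα : IntervalIntegrable α volume 0 x)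
    (hγ : IntervalIntegrable γ volume 0 x)
    (h : ∀ s η, 0 ≤ η → η ≤ s → s ≤ x → ‖F s η‖ ≤ α s * γ η) :
    ∫ η in (0 : ℝ)..x, ∫ s in η..x, F s η = ∫ s in (0 : ℝ)..x, ∫ η in (0 : ℝ)..s, F s η := by
  set T : Set (ℝ × ℝ) := {p | p.2 ≤ p.1} with hT
  have hTm : MeasurableSet T := measurableSet_le measurable_snd measurable_fst
  set F' : ℝ → ℝ → ℂ := fun s η => T.indicator (Function.uncurry F) (s, η) with hF'
  rw [intervalIntegrable_iff_integrableOn_Ioc_of_le hx] at hα hγ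
  have hI : IntegrableOn (Function.uncurry F') (Ioc 0 x ×ˢ Ioc 0 x) := by
    have h1 : IntegrableOn (fun p : ℝ × ℝ => ‖α p.1‖ * ‖γ p.2‖) (Ioc 0 x ×ˢ Ioc 0 x) := by
      rw [IntegrableOn, Measure.volume_eq_prod, ← Measure.prod_restrict]
      exact Integrable.mul_prod hα.norm hγ.norm
    refine h1.mono' (hF.indicator hTm).aestronglyMeasurable ?_
    filter_upwards [ae_restrict_mem (measurableSet_Ioc.prod measurableSet_Ioc)] with p hp
    by_cases hpT : p ∈ T
    · have : Function.uncurry F' p = F p.1 p.2 := by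
        simp only [hF', Function.uncurry]
        exact indicator_of_mem hpT _
      rw [this, ← norm_mul]
      exact (h _ _ hp.2.1.le hpT hp.1.2).trans (Real.le_norm_self _)
    · have : Function.uncurry F' p = 0 := by
        simp only [hF', Function.uncurry]
        exact indicator_of_notMem hpT _
      rw [this, norm_zero]
      positivity
  have e : ∀ s η, η ≤ s → F' s η = F s η := fun s η h => indicator_of_mem (s := T) (a := (s, η)) h _
  have := integral_triangle_swap hx hI
  convert this using 1
  · refine intervalIntegral.integral_congr fun η hη => ?_
    rw [uIcc_of_le hx] at hη
    refine intervalIntegral.integral_congr fun s hs => ?_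
    rw [uIcc_of_le hη.2] at hs
    exact (e s η hs.1).symm
  · refine intervalIntegral.integral_congr fun s hs => ?_
    rw [uIcc_of_le hx] at hs
    refine intervalIntegral.integral_congr fun η hη => ?_
    rw [uIcc_of_le hs.1] at hη
    exact (e s η hη.2).symm

/-- Cauchy's formula for repeated integration, by exchanging the order over the triangle. -/
lemma integral_integral_eq_integral_sub_mul {x : ℝ} (hx : 0 ≤ x) {h : ℝ → ℂ}
    (hh : IntervalIntegrable h volume 0 x) :
    ∫ t in (0 : ℝ)..x, ∫ s in (0 : ℝ)..t, h s = ∫ s in (0 : ℝ)..x, ((x - s : ℝ) : ℂ) * h s := by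
  have := integral_triangle_swap hx (F := fun t s => (1 : ℂ) * h s)
    (integrableOn_mul_prod (p := fun _ => 1) (by simp)
      ((intervalIntegrable_iff_integrableOn_Ioc_of_le hx).1 hh))
  simp only [one_mul] at this
  rw [← this]
  refine intervalIntegral.integral_congr fun s _ => ?_
  simp [intervalIntegral.integral_const]

section MatInt

variable {p q s : Type*} [Fintype p] [Fintype q] [Fintype s]

omit [Fintype p] [Fintype s] in
lemma matInt_const_mul {x y : ℝ} (M : Matrix p q ℂ) {G : ℝ → Matrix q s ℂ}
    (hG : ∀ i k, IntervalIntegrable (fun t => G t i k) volume x y) :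
    matInt x y (fun t => M * G t) = M * matInt x y G := by
  ext i k
  simp only [matInt, Matrix.of_apply, Matrix.mul_apply]
  rw [intervalIntegral.integral_finsetSum fun j _ => (hG j k).const_mul _]
  simp only [intervalIntegral.integral_const_mul]

omit [Fintype p] [Fintype q] in
lemma matInt_add {x y : ℝ} {G H : ℝ → Matrix p q ℂ}
    (hG : ∀ i k, IntervalIntegrable (fun t => G t i k) volume x y)
    (hH : ∀ i k, IntervalIntegrable (fun t => H t i k) volume x y) :
    matInt x y (fun t => G t + H t) = matInt x y G + matInt x y H := by
  ext i k
  exact intervalIntegral.integral_add (hG i k) (hH i k)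

omit [Fintype p] [Fintype q] in
lemma matInt_sub {x y : ℝ} {G H : ℝ → Matrix p q ℂ}
    (hG : ∀ i k, IntervalIntegrable (fun t => G t i k) volume x y)
    (hH : ∀ i k, IntervalIntegrable (fun t => H t i k) volume x y) :
    matInt x y (fun t => G t - H t) = matInt x y G - matInt x y H := by
  ext i k
  exact intervalIntegral.integral_sub (hG i k) (hH i k)

omit [Fintype p] [Fintype q] in
lemma matInt_congr {x y : ℝ} (hxy : x ≤ y) {G H : ℝ → Matrix p q ℂ}
    (h : ∀ t ∈ Icc x y, G t = H t) : matInt x y G = matInt x y H := by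
  ext i k
  refine intervalIntegral.integral_congr fun t ht => ?_
  rw [uIcc_of_le hxy] at ht
  simp only [h t ht]

/-- Entrywise measurable functions that are bounded on `[0,r]`. -/
structure IsBddFun (r : ℝ) (g : ℝ → Matrix p q ℂ) (G : ℝ) : Prop where
  measurable : ∀ i k, Measurable fun x => g x i k
  bound : ∀ x ∈ Icc (0 : ℝ) r, ∀ i k, ‖g x i k‖ ≤ G

variable {r : ℝ} {g : ℝ → Matrix q s ℂ} {G : ℝ}

omit [Fintype s] in
lemma IsCoef.intervalIntegrable_mul {v : ℝ → Matrix p q ℂ} (hv : IsCoef r v) (hg : IsBddFun r g G)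
    {x y : ℝ} (hx : 0 ≤ x) (hxy : x ≤ y) (hy : y ≤ r) (i : p) (k : s) :
    IntervalIntegrable (fun t => (v t * g t) i k) volume x y := by
  have hi : IntervalIntegrable (fun s => entrySum (v s)) volume x y :=
    intervalIntegrable_mono hv.intervalIntegrable_entrySum ⟨hx, hxy.trans hy⟩ ⟨hx.trans hxy, hy⟩
  refine intervalIntegrable_of_norm_le hxy (measurable_mul_entry hv.measurable hg.measurable i k)
    (hi.mul_const G) fun t ht => ?_
  exact norm_mul_entry_le _ _ _ _ fun j => hg.bound t ⟨hx.trans ht.1, ht.2.trans hy⟩ _ _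

omit [Fintype p] [Fintype s] in
lemma matInt_triangle_swap {P : ℝ → ℝ → Matrix p q ℂ}
    (hP : ∀ i k, Measurable fun z : ℝ × ℝ => P z.1 z.2 i k) (hg : IsBddFun r g G) {t : ℝ}
    (ht0 : 0 ≤ t) (ht : t ≤ r) {α γ : ℝ → ℝ} (hα : IntervalIntegrable α volume 0 r)
    (hγ : IntervalIntegrable γ volume 0 r)
    (h : ∀ s η, 0 ≤ η → η ≤ s → s ≤ r → ∀ i k, ‖P s η i k‖ ≤ α s * γ η) :
    matInt 0 t (fun η => matInt η t (fun s => P s η) * g η)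
      = matInt 0 t (fun s => matInt 0 s (fun η => P s η * g η)) := by
  have hr : 0 ≤ r := ht0.trans ht
  ext i k
  have hswap := integral_triangle_swap_of_le ht0 (F := fun s η => (P s η * g η) i k)
    (α := fun s => α s * ((Fintype.card q : ℝ) * G)) (γ := γ) ?_
    ((intervalIntegrable_mono hα ⟨le_rfl, hr⟩ ⟨ht0, ht⟩).mul_const _)
    (intervalIntegrable_mono hγ ⟨le_rfl, hr⟩ ⟨ht0, ht⟩) ?_
  · simp only [matInt, Matrix.of_apply]
    rw [← hswap]
    refine intervalIntegral.integral_congr fun η hη => ?_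
    rw [uIcc_of_le ht0] at hη
    simp only [Matrix.mul_apply, Matrix.of_apply]
    rw [intervalIntegral.integral_finsetSum]
    · simp only [intervalIntegral.integral_mul_const]
    · intro j _
      refine IntervalIntegrable.mul_const ?_ _
      refine intervalIntegrable_of_norm_le hη.2
        ((hP i j).comp (f := fun s => (s, η)) (by fun_prop))
        (g := fun s => α s * γ η) ((intervalIntegrable_mono hα ⟨hη.1, hη.2.trans ht⟩
          ⟨ht0, ht⟩).mul_const _) fun s hs => h s η hη.1 hs.1 (hs.2.trans ht) i j
  · exact measurable_mul_entry (M := fun z : ℝ × ℝ => P z.1 z.2) hP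
      (fun i k => (hg.measurable i k).comp measurable_snd) i k
  · intro s η h1 h2 h3
    rw [Matrix.mul_apply]
    have hGj : ∀ j, ‖g η j k‖ ≤ G := fun j => hg.bound η ⟨h1, h2.trans (h3.trans ht)⟩ j k
    calc ‖∑ j, P s η i j * g η j k‖ ≤ ∑ j, ‖P s η i j * g η j k‖ := norm_sum_le _ _
      _ ≤ ∑ _j : q, (α s * γ η) * G := Finset.sum_le_sum fun j _ => by
          rw [norm_mul]
          have h4 := h s η h1 h2 (h3.trans ht) i j
          exact mul_le_mul h4 (hGj j) (norm_nonneg _) ((norm_nonneg _).trans h4)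
      _ = _ := by
          rw [Finset.sum_const, Finset.card_univ, nsmul_eq_mul]
          ring

end MatInt

/-- `∫_0^x W(x,ζ) g(ζ) dζ`. -/
def kerApp {n : ℕ} {q : Type*} (W : ℝ → ℝ → Matrix (Fin n) (Fin n) ℂ) (g : ℝ → Matrix (Fin n) q ℂ)
    (x : ℝ) : Matrix (Fin n) q ℂ := matInt 0 x fun ζ => W x ζ * g ζ

section Kernel

variable {m : Type*} [Fintype m] {n : ℕ} {q : Type*} [Fintype q] {r : ℝ}
  {v : ℝ → Matrix (Fin n) (Fin n) ℂ} {a : ℝ → Matrix (Fin n) m ℂ}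
  {b : ℝ → Matrix m (Fin n) ℂ} {W : ℝ → ℝ → Matrix (Fin n) (Fin n) ℂ} {B : ℝ}
  {g : ℝ → Matrix (Fin n) q ℂ} {G : ℝ}

omit [Fintype q] in
lemma measurable_kerApp (hW : ∀ i k, Measurable fun p : ℝ × ℝ => W p.1 p.2 i k)
    (hg : ∀ i k, Measurable fun x => g x i k) (i : Fin n) (k : q) :
    Measurable fun x => kerApp W g x i k := by
  refine measurable_intervalIntegral (F := fun x ζ => (W x ζ * g ζ) i k) ?_ measurable_const
    measurable_id
  exact measurable_mul_entry (M := fun z : ℝ × ℝ => W z.1 z.2) hW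
    (fun i k => (hg i k).comp measurable_snd) i k

lemma IsBddKer.entrySum_le (hW : IsBddKer r W B) {x ζ : ℝ} (h1 : 0 ≤ ζ) (h2 : ζ ≤ x)
    (h3 : x ≤ r) : entrySum (W x ζ) ≤ n * (n * B) := by
  calc entrySum (W x ζ) ≤ ∑ _i : Fin n, ∑ _k : Fin n, B :=
        Finset.sum_le_sum fun i _ => Finset.sum_le_sum fun k _ => hW.bound x ζ h1 h2 h3 i k
    _ = _ := by simp

/-- The operator with a bounded kernel maps integrable functions to bounded ones. -/
lemma IsBddKer.kerApp_isBddFun (hW : IsBddKer r W B) (hg : IsCoef r g) (hr : 0 ≤ r) :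
    ∃ G', IsBddFun r (kerApp W g) G' := by
  rcases Nat.eq_zero_or_pos n with hn | hn
  · subst hn
    exact ⟨0, fun i => i.elim0, fun _ _ i => i.elim0⟩
  have hB : 0 ≤ B := (norm_nonneg _).trans (hW.bound 0 0 le_rfl le_rfl hr ⟨0, hn⟩ ⟨0, hn⟩)
  refine ⟨(n * (n * B)) * ∫ t in (0 : ℝ)..r, entrySum (g t),
    fun i k => measurable_kerApp hW.measurable hg.measurable i k, fun x hx i k => ?_⟩
  have hi : IntervalIntegrable (fun t => entrySum (g t)) volume 0 x :=
    intervalIntegrable_mono hg.intervalIntegrable_entrySum ⟨le_rfl, hr⟩ hx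
  calc _ ≤ ∫ ζ in (0 : ℝ)..x, (n * (n * B)) * entrySum (g ζ) := by
        refine intervalIntegral.norm_integral_le_of_norm_le hx.1 ?_ (hi.const_mul _)
        filter_upwards with ζ hζ
        refine (norm_mul_entry_le _ _ _ _ fun j => norm_entry_le_entrySum (g ζ) j k).trans ?_
        exact mul_le_mul_of_nonneg_right (hW.entrySum_le hζ.1.le hζ.2 hx.2) (entrySum_nonneg _)
    _ = (n * (n * B)) * ∫ ζ in (0 : ℝ)..x, entrySum (g ζ) :=
        intervalIntegral.integral_const_mul _ _
    _ ≤ _ := mul_le_mul_of_nonneg_left (hg.integral_entrySum_le le_rfl hx.1 hx.2) (by positivity)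

omit [Fintype q] in
lemma IsBddFun.isCoef (hr : 0 ≤ r) {p : Type*} {g : ℝ → Matrix p q ℂ}
    (hg : IsBddFun r g G) : IsCoef r g :=
  ⟨hg.measurable, fun i k => intervalIntegrable_of_norm_le hr (hg.measurable i k)
    (intervalIntegrable_const (c := G)) fun t ht => hg.bound t ht i k⟩

/-- The function `φ` belonging to the full kernel. -/
def fullPhi (v : ℝ → Matrix (Fin n) (Fin n) ℂ) (a : ℝ → Matrix (Fin n) m ℂ)
    (b : ℝ → Matrix m (Fin n) ℂ) (W : ℝ → ℝ → Matrix (Fin n) (Fin n) ℂ) (t η : ℝ) :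
    Matrix (Fin n) (Fin n) ℂ := v η - Fbreve a b t η + stepPhi v a b W t η

omit [Fintype q] in
lemma IsCoef.matInt_mul_isBddFun {p : Type*} [Fintype p] {b : ℝ → Matrix p (Fin n) ℂ}
    (hb : IsCoef r b) (hg : IsBddFun r g G) (hr : 0 ≤ r) :
    ∃ G', IsBddFun r (fun s => matInt 0 s (fun ξ => b ξ * g ξ)) G' := by
  refine ⟨(∫ t in (0 : ℝ)..r, entrySum (b t)) * |G|, fun i k => ?_, fun x hx i k => ?_⟩
  · exact measurable_intervalIntegral (F := fun _ ξ => (b ξ * g ξ) i k)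
      ((measurable_mul_entry hb.measurable hg.measurable i k).comp measurable_snd)
      measurable_const measurable_id
  · have hi : IntervalIntegrable (fun t => entrySum (b t)) volume 0 x :=
      intervalIntegrable_mono hb.intervalIntegrable_entrySum ⟨le_rfl, hr⟩ hx
    calc _ ≤ ∫ ζ in (0 : ℝ)..x, entrySum (b ζ) * |G| := by
          refine intervalIntegral.norm_integral_le_of_norm_le hx.1 ?_ (hi.mul_const _)
          filter_upwards with ζ hζ
          exact norm_mul_entry_le _ _ _ _ fun j =>
            (hg.bound ζ ⟨hζ.1.le, hζ.2.trans hx.2⟩ j k).trans (le_abs_self G)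
      _ = (∫ ζ in (0 : ℝ)..x, entrySum (b ζ)) * |G| := intervalIntegral.integral_mul_const _ _
      _ ≤ _ := mul_le_mul_of_nonneg_right (hb.integral_entrySum_le le_rfl hx.1 hx.2) (abs_nonneg _)

omit [Fintype q] in
lemma IsBddFun.mono {p : Type*} {g : ℝ → Matrix p q ℂ} (hg : IsBddFun r g G) {t : ℝ} (ht : t ≤ r) :
    IsBddFun t g G :=
  ⟨hg.measurable, fun x hx => hg.bound x ⟨hx.1, hx.2.trans ht⟩⟩

/-- With z = g + 𝒱g, the terms v(η) and `innerPot` give vg and v𝒱g, while `Fbreve` and `innerSep`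
give a∫bg and a∫b𝒱g. Each follows by exchanging integrals over a triangle, twice for the last. In
this way the source of the wave equation becomes the right side of the equation for z. -/
lemma matInt_fullPhi_mul (hr : 0 ≤ r) (hv : IsCoef r v) (ha : IsCoef r a) (hb : IsCoef r b)
    (hW : IsBddKer r W B) (hg : IsBddFun r g G) {t : ℝ} (ht0 : 0 ≤ t) (ht : t ≤ r) :
    matInt 0 t (fun η => fullPhi v a b W t η * g η)
      = matInt 0 t (fun s => v s * (g s + kerApp W g s)
          - a s * matInt 0 s (fun ξ => b ξ * (g ξ + kerApp W g ξ))) := by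
  obtain ⟨G', hWg⟩ := hW.kerApp_isBddFun (hg.isCoef hr) hr
  have hone : IntervalIntegrable (fun _ : ℝ => (1 : ℝ)) volume 0 r := intervalIntegrable_const
  have hker : ∀ {x : ℝ}, 0 ≤ x → x ≤ r → ∀ i k,
      IntervalIntegrable (fun ζ => (W x ζ * g ζ) i k) volume 0 x := by
    intro x hx0 hx i k
    refine intervalIntegrable_of_norm_le hx0 ?_
      (intervalIntegrable_const (c := (n * (n * B)) * G)) fun ζ hζ => ?_
    · exact measurable_mul_entry (fun i k => (hW.measurable i k).comp (f := fun ζ => (x, ζ))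
        (by fun_prop)) hg.measurable i k
    · have h1 : ∀ j, ‖g ζ j k‖ ≤ G := fun j => hg.bound ζ ⟨hζ.1, hζ.2.trans hx⟩ j k
      exact (norm_mul_entry_le _ _ _ _ h1).trans (mul_le_mul_of_nonneg_right
        (hW.entrySum_le hζ.1 hζ.2 hx) ((norm_nonneg _).trans (h1 i)))
  -- the three swapped integrals
  have e1 : matInt 0 t (fun η => innerPot v W t η * g η)
      = matInt 0 t (fun s => v s * kerApp W g s) := by
    have := matInt_triangle_swap (P := fun s η => v s * W s η) (g := g) (r := r) (t := t)
      (α := fun s => entrySum (v s) * B) (γ := fun _ => 1)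
      (fun i k => measurable_mul_entry (M := fun z : ℝ × ℝ => v z.1) (N := fun z => W z.1 z.2)
        (fun i k => (hv.measurable i k).comp measurable_fst) hW.measurable i k) hg ht0 ht
      (hv.intervalIntegrable_entrySum.mul_const B) hone (fun s η h1 h2 h3 i k => by
        rw [mul_one]
        exact norm_mul_entry_le _ _ _ _ fun j => hW.bound s η h1 h2 h3 j k)
    simp only [innerPot]
    rw [this]
    refine matInt_congr ht0 fun s hs => ?_
    simp only [Matrix.mul_assoc]
    rw [matInt_const_mul _ (hker hs.1 (hs.2.trans ht)), kerApp]
  have e2 : matInt 0 t (fun η => Fbreve a b t η * g η)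
      = matInt 0 t (fun s => a s * matInt 0 s (fun ξ => b ξ * g ξ)) := by
    have := matInt_triangle_swap (P := fun s η => a s * b η) (g := g) (r := r) (t := t)
      (α := fun s => entrySum (a s)) (γ := fun s => entrySum (b s))
      (fun i k => measurable_mul_entry (M := fun z : ℝ × ℝ => a z.1) (N := fun z => b z.2)
        (fun i k => (ha.measurable i k).comp measurable_fst)
        (fun i k => (hb.measurable i k).comp measurable_snd) i k) hg ht0 ht
      ha.intervalIntegrable_entrySum hb.intervalIntegrable_entrySum (fun s η h1 h2 h3 i k =>
        norm_mul_entry_le _ _ _ _ fun j => norm_entry_le_entrySum _ _ _)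
    simp only [Fbreve]
    rw [this]
    refine matInt_congr ht0 fun s hs => ?_
    simp only [Matrix.mul_assoc]
    rw [matInt_const_mul _ (hb.intervalIntegrable_mul hg le_rfl hs.1 (hs.2.trans ht))]
  have e3 : matInt 0 t (fun η => innerSep a b W t η * g η)
      = matInt 0 t (fun s => a s * matInt 0 s (fun ξ => b ξ * kerApp W g ξ)) := by
    have := matInt_triangle_swap
      (P := fun s η => matInt η s (fun ξ => a s * b ξ * W ξ η)) (g := g) (r := r) (t := t)
      (α := fun s => entrySum (a s) * ((∫ s in (0 : ℝ)..r, entrySum (b s)) * B)) (γ := fun _ => 1)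
      (fun i k => measurable_innerSep_inner ha.measurable hb.measurable hW.measurable i k)
      hg ht0 ht (ha.intervalIntegrable_entrySum.mul_const _) hone (fun s η h1 h2 h3 i k => by
        rw [mul_one]
        exact norm_innerSep_inner_le hb h1 h2 h3
          (fun ξ hξ => hW.bound ξ η h1 hξ.1 (hξ.2.trans h3)) i k)
    simp only [innerSep]
    rw [this]
    refine matInt_congr ht0 fun s hs => ?_
    have h2 := matInt_triangle_swap (P := fun ξ η => a s * b ξ * W ξ η) (g := g) (r := r) (t := s)
      (α := fun ξ => entrySum (a s) * (entrySum (b ξ) * B)) (γ := fun _ => 1)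
      (fun i k => measurable_mul_entry (M := fun z : ℝ × ℝ => a s * b z.1)
        (N := fun z => W z.1 z.2) (fun i k => measurable_mul_entry (M := fun _ : ℝ × ℝ => a s)
          (fun _ _ => measurable_const)
          (fun i k => (hb.measurable i k).comp measurable_fst) i k) hW.measurable i k)
      hg hs.1 (hs.2.trans ht) ((hb.intervalIntegrable_entrySum.mul_const B).const_mul _) hone
      (fun ξ η h1 h2 h3 i k => by
        rw [mul_one, Matrix.mul_assoc]
        exact norm_mul_entry_le _ _ _ _ fun j => norm_mul_entry_le _ _ _ _ fun j' =>
          hW.bound ξ η h1 h2 h3 _ _)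
    rw [h2, ← matInt_const_mul _ (hb.intervalIntegrable_mul hWg le_rfl hs.1 (hs.2.trans ht))]
    refine matInt_congr hs.1 fun ξ hξ => ?_
    have h3 : (fun η => a s * b ξ * W ξ η * g η) = fun η => (a s * b ξ) * (W ξ η * g η) := by
      ext1 η; rw [Matrix.mul_assoc]
    rw [h3, matInt_const_mul _ (hker hξ.1 (hξ.2.trans (hs.2.trans ht))), Matrix.mul_assoc, kerApp]
  -- integrability of the single terms
  have hg' := hg.mono ht
  have sec : ∀ {X : ℝ → ℝ → Matrix (Fin n) (Fin n) ℂ},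
      (∀ i k, Measurable (Function.uncurry fun t η => X t η i k)) →
      ∀ {c : ℝ → ℝ}, IntervalIntegrable c volume 0 r →
      (∀ η, 0 ≤ η → η ≤ t → ∀ i k, ‖X t η i k‖ ≤ c η) → ∀ i k,
      IntervalIntegrable (fun η => (X t η * g η) i k) volume 0 t := by
    intro X hX c hc hXc i k
    have : IsCoef t (X t) := ⟨fun i k => (hX i k).comp (f := fun η => (t, η)) (by fun_prop),
      fun i k => intervalIntegrable_of_norm_le ht0 ((hX i k).comp (f := fun η => (t, η))
        (by fun_prop)) (intervalIntegrable_mono hc ⟨le_rfl, hr⟩ ⟨ht0, ht⟩)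
        fun η hη => hXc η hη.1 hη.2 i k⟩
    exact this.intervalIntegrable_mul hg' le_rfl ht0 le_rfl i k
  have i0 : ∀ i k, IntervalIntegrable (fun η => (v η * g η) i k) volume 0 t := fun i k =>
    hv.intervalIntegrable_mul hg le_rfl ht0 ht i k
  have i1 := sec (X := innerPot v W) (measurable_innerPot hv.measurable hW.measurable)
    intervalIntegrable_const (fun η h1 h2 i k => norm_innerPot_le hv h1 h2 ht
      (fun s hs => hW.bound s η h1 hs.1 (hs.2.trans ht)) i k)
  have i2 := sec (X := Fbreve a b) (measurable_Fbreve ha.measurable hb.measurable)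
    (hb.intervalIntegrable_entrySum.const_mul _) (fun η h1 h2 i k => norm_Fbreve_le ha h1 h2 ht i k)
  have i3 := sec (X := innerSep a b W) (measurable_innerSep ha.measurable hb.measurable
    hW.measurable) intervalIntegrable_const (fun η h1 h2 i k => norm_innerSep_le ha hb h1 h2 ht
      (fun s hs => hW.bound s η h1 hs.1 (hs.2.trans ht)) i k)
  obtain ⟨G₁, hbg⟩ := hb.matInt_mul_isBddFun hg hr
  obtain ⟨G₂, hbWg⟩ := hb.matInt_mul_isBddFun hWg hr
  have j1 : ∀ i k, IntervalIntegrable (fun s => (v s * kerApp W g s) i k) volume 0 t := fun i k =>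
    hv.intervalIntegrable_mul hWg le_rfl ht0 ht i k
  have j2 : ∀ i k, IntervalIntegrable
      (fun s => (a s * matInt 0 s (fun ξ => b ξ * g ξ)) i k) volume 0 t := fun i k =>
    ha.intervalIntegrable_mul hbg le_rfl ht0 ht i k
  have j3 : ∀ i k, IntervalIntegrable
      (fun s => (a s * matInt 0 s (fun ξ => b ξ * kerApp W g ξ)) i k) volume 0 t := fun i k =>
    ha.intervalIntegrable_mul hbWg le_rfl ht0 ht i k
  have l1 : matInt 0 t (fun η => fullPhi v a b W t η * g η)
      = matInt 0 t (fun η => v η * g η) - matInt 0 t (fun η => Fbreve a b t η * g η)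
        + (matInt 0 t (fun η => innerPot v W t η * g η)
          - matInt 0 t (fun η => innerSep a b W t η * g η)) := by
    have k1 : ∀ i k, IntervalIntegrable (fun η => (v η * g η - Fbreve a b t η * g η) i k)
        volume 0 t := fun i k => (i0 i k).sub (i2 i k)
    have k2 : ∀ i k, IntervalIntegrable
        (fun η => (innerPot v W t η * g η - innerSep a b W t η * g η) i k) volume 0 t :=
      fun i k => (i1 i k).sub (i3 i k)
    rw [← matInt_sub i0 i2, ← matInt_sub i1 i3, ← matInt_add k1 k2]
    simp only [fullPhi, stepPhi, Matrix.add_mul, Matrix.sub_mul]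
  have l2 : matInt 0 t (fun s => v s * (g s + kerApp W g s)
          - a s * matInt 0 s (fun ξ => b ξ * (g ξ + kerApp W g ξ)))
      = (matInt 0 t (fun η => v η * g η) + matInt 0 t (fun s => v s * kerApp W g s))
        - (matInt 0 t (fun s => a s * matInt 0 s (fun ξ => b ξ * g ξ))
          + matInt 0 t (fun s => a s * matInt 0 s (fun ξ => b ξ * kerApp W g ξ))) := by
    have k1 : ∀ i k, IntervalIntegrable (fun s => (v s * g s + v s * kerApp W g s) i k)
        volume 0 t := fun i k => (i0 i k).add (j1 i k)
    have k2 : ∀ i k, IntervalIntegrable (fun s => (a s * matInt 0 s (fun ξ => b ξ * g ξ)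
        + a s * matInt 0 s (fun ξ => b ξ * kerApp W g ξ)) i k) volume 0 t :=
      fun i k => (j2 i k).add (j3 i k)
    rw [← matInt_add i0 j1, ← matInt_add j2 j3, ← matInt_sub k1 k2]
    refine matInt_congr ht0 fun s hs => ?_
    have : matInt 0 s (fun ξ => b ξ * (g ξ + kerApp W g ξ))
        = matInt 0 s (fun ξ => b ξ * g ξ) + matInt 0 s (fun ξ => b ξ * kerApp W g ξ) := by
      rw [← matInt_add (fun i k => hb.intervalIntegrable_mul hg le_rfl hs.1 (hs.2.trans ht) i k)
        (fun i k => hb.intervalIntegrable_mul hWg le_rfl hs.1 (hs.2.trans ht) i k)]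
      simp only [Matrix.mul_add]
    rw [this, Matrix.mul_add, Matrix.mul_add]
  rw [l1, l2, e1, e2, e3]
  abel

lemma measurable_fullPhi (hv : IsCoef r v) (ha : IsCoef r a) (hb : IsCoef r b)
    (hW : IsBddKer r W B) (i k : Fin n) :
    Measurable (Function.uncurry fun t η => fullPhi v a b W t η i k) :=
  (((hv.measurable i k).comp measurable_snd).sub
    (measurable_Fbreve ha.measurable hb.measurable i k)).add
    (measurable_stepPhi hv ha hb hW.measurable i k)

/-- A bound for `φ`. -/
def fullPhiBound (r : ℝ) (v : ℝ → Matrix (Fin n) (Fin n) ℂ) (a : ℝ → Matrix (Fin n) m ℂ)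
    (b : ℝ → Matrix m (Fin n) ℂ) (B : ℝ) (η : ℝ) : ℝ :=
  entrySum (v η) + (∫ s in (0 : ℝ)..r, entrySum (a s)) * entrySum (b η) + stepConst r v a b * B

lemma intervalIntegrable_fullPhiBound (hv : IsCoef r v) (hb : IsCoef r b) :
    IntervalIntegrable (fullPhiBound r v a b B) volume 0 r :=
  (hv.intervalIntegrable_entrySum.add (hb.intervalIntegrable_entrySum.const_mul _)).add
    intervalIntegrable_const

lemma norm_fullPhi_le (hv : IsCoef r v) (ha : IsCoef r a) (hb : IsCoef r b)
    (hW : IsBddKer r W B) (i k : Fin n) (t η : ℝ) (h1 : 0 ≤ η) (h2 : η ≤ t) (h3 : t ≤ r) :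
    ‖fullPhi v a b W t η i k‖ ≤ fullPhiBound r v a b B η :=
  (norm_add_le _ _).trans (add_le_add ((norm_sub_le _ _).trans
    (add_le_add (norm_entry_le_entrySum _ _ _) (norm_Fbreve_le ha h1 h2 h3 i k)))
    (norm_stepPhi_le hv ha hb h1 h2 h3
      (fun s hs => hW.bound s η h1 hs.1 (hs.2.trans h3)) i k))

end Kernel

/-! ### The intertwining identity for the kernel `𝒱` -/

lemma intervalIntegrable_integral_mul {r : ℝ} {φ : ℝ → ℝ → ℂ} {c : ℝ → ℝ} {k : ℝ → ℂ} {K : ℝ}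
    (hφm : Measurable (Function.uncurry φ)) (hc : IntervalIntegrable c volume 0 r)
    (hφ : ∀ t η, 0 ≤ η → η ≤ t → t ≤ r → ‖φ t η‖ ≤ c η) (hk : Measurable k)
    (hkK : ∀ x ∈ Icc (0 : ℝ) r, ‖k x‖ ≤ K) {x : ℝ} (hx0 : 0 ≤ x) (hx : x ≤ r) :
    IntervalIntegrable (fun t => ∫ η in (0 : ℝ)..t, φ t η * k η) volume 0 x := by
  have hr : 0 ≤ r := hx0.trans hx
  have hc0 : ∀ η ∈ Icc 0 r, 0 ≤ c η := fun η hη =>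
    (norm_nonneg _).trans (hφ η η hη.1 le_rfl hη.2)
  have hK0 : 0 ≤ K := (norm_nonneg _).trans (hkK 0 ⟨le_rfl, hr⟩)
  refine intervalIntegrable_of_norm_le hx0 ?_
    (intervalIntegrable_const (c := (∫ t in (0 : ℝ)..r, c t) * K)) fun t ht => ?_
  · exact measurable_intervalIntegral (F := fun t η => φ t η * k η)
      (hφm.mul (hk.comp measurable_snd)) measurable_const measurable_id
  · have htr : t ≤ r := ht.2.trans hx
    calc _ ≤ ∫ η in (0 : ℝ)..t, c η * K := by
          refine intervalIntegral.norm_integral_le_of_norm_le ht.1 ?_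
            ((intervalIntegrable_mono hc ⟨le_rfl, hr⟩ ⟨ht.1, htr⟩).mul_const K)
          filter_upwards with η hη
          rw [norm_mul]
          exact mul_le_mul (hφ t η hη.1.le hη.2 htr) (hkK η ⟨hη.1.le, hη.2.trans htr⟩)
            (norm_nonneg _) (hc0 η ⟨hη.1.le, hη.2.trans htr⟩)
      _ = (∫ η in (0 : ℝ)..t, c η) * K := intervalIntegral.integral_mul_const _ _
      _ ≤ _ := by
          refine mul_le_mul_of_nonneg_right ?_ hK0
          refine intervalIntegral.integral_mono_interval le_rfl ht.1 htr ?_ hc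
          filter_upwards [ae_restrict_mem measurableSet_Ioc] with η hη
          exact hc0 η (Ioc_subset_Icc_self hη)

section Kernel

variable {m : Type*} [Fintype m] {n : ℕ} {q : Type*} [Fintype q] {r : ℝ}
  {v : ℝ → Matrix (Fin n) (Fin n) ℂ} {a : ℝ → Matrix (Fin n) m ℂ}
  {b : ℝ → Matrix m (Fin n) ℂ} {W : ℝ → ℝ → Matrix (Fin n) (Fin n) ℂ} {B : ℝ}
  {g f : ℝ → Matrix (Fin n) q ℂ} {G : ℝ}

/-- The inhomogeneity arising from the potential and from the semi-separable term. -/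
def potTerm (v : ℝ → Matrix (Fin n) (Fin n) ℂ) (a : ℝ → Matrix (Fin n) m ℂ)
    (b : ℝ → Matrix m (Fin n) ℂ) (z : ℝ → Matrix (Fin n) q ℂ) (s : ℝ) : Matrix (Fin n) q ℂ :=
  v s * z s - a s * matInt 0 s (fun ξ => b ξ * z ξ)

omit [Fintype q] in
lemma intervalIntegrable_potTerm (hv : IsCoef r v) (ha : IsCoef r a) (hb : IsCoef r b)
    (hg : IsBddFun r g G) {x : ℝ} (hx0 : 0 ≤ x) (hx : x ≤ r) (i : Fin n) (k : q) :
    IntervalIntegrable (fun s => potTerm v a b g s i k) volume 0 x := by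
  obtain ⟨G₁, h1⟩ := hb.matInt_mul_isBddFun hg (hx0.trans hx)
  exact (hv.intervalIntegrable_mul hg le_rfl hx0 hx i k).sub
    (ha.intervalIntegrable_mul h1 le_rfl hx0 hx i k)

lemma IsBddFun.add_kerApp (hr : 0 ≤ r) (hW : IsBddKer r W B) (hg : IsBddFun r g G) :
    ∃ G', IsBddFun r (fun x => g x + kerApp W g x) G' := by
  obtain ⟨G₁, h1⟩ := hW.kerApp_isBddFun (hg.isCoef hr) hr
  exact ⟨G + G₁, fun i k => (hg.measurable i k).add (h1.measurable i k), fun x hx i k =>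
    (norm_add_le _ _).trans (add_le_add (hg.bound x hx i k) (h1.bound x hx i k))⟩

/-- Passage from the scalar Duhamel identity to the operator identity. -/
lemma kerApp_eq_of_duhamel (hr : 0 ≤ r) (hv : IsCoef r v) (ha : IsCoef r a) (hb : IsCoef r b)
    (hW : IsBddKer r W B)
    (hfix : ∀ x ζ, 0 ≤ ζ → ζ ≤ x → x ≤ r → ∀ i k, W x ζ i k
      = dAlembert (fun t η => fullPhi v a b W t η i k) x ζ)
    (hg : IsBddFun r g G) {F : ℝ → Matrix (Fin n) q ℂ} {D : ℝ → Fin n → Fin n → q → ℂ}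
    (hDi : ∀ i j k x, 0 ≤ x → x ≤ r → IntervalIntegrable (fun y => D y i j k) volume 0 x)
    (hDF : ∀ y ∈ Icc 0 r, ∀ i k, F y i k = ∑ j, D y i j k)
    (hduh : ∀ i j k x, 0 ≤ x → x ≤ r →
      ∫ ζ in (0 : ℝ)..x, dAlembert (fun t η => fullPhi v a b W t η i j) x ζ * g ζ j k
        = (∫ t in (0 : ℝ)..x, ∫ η in (0 : ℝ)..t, fullPhi v a b W t η i j * g η j k)
          + ∫ y in (0 : ℝ)..x, ((x - y : ℝ) : ℂ) * D y i j k)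
    {x : ℝ} (hx0 : 0 ≤ x) (hx : x ≤ r) :
    kerApp W g x = matInt 0 x (fun t => matInt 0 t (fun s =>
      potTerm v a b (fun x => g x + kerApp W g x) s + F s)) := by
  obtain ⟨Gz, hz⟩ := hg.add_kerApp hr hW
  ext i k
  have hFi : ∀ y, 0 ≤ y → y ≤ r → IntervalIntegrable (fun s => F s i k) volume 0 y := by
    intro y hy0 hy
    have h1 : IntervalIntegrable (fun s => ∑ j, D s i j k) volume 0 y := by
      have := IntervalIntegrable.sum (μ := volume) (a := 0) (b := y) Finset.univ
        (f := fun j s => D s i j k) fun j _ => hDi i j k y hy0 hy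
      simpa only [Finset.sum_fn] using this
    refine h1.congr_uIoo fun s hs => ?_
    rw [uIoo_of_le hy0] at hs
    exact (hDF s ⟨hs.1.le, hs.2.le.trans hy⟩ i k).symm
  have hWg : ∀ j, IntervalIntegrable (fun ζ => W x ζ i j * g ζ j k) volume 0 x := by
    intro j
    refine intervalIntegrable_of_norm_le hx0 ?_ (intervalIntegrable_const (c := B * G))
      fun ζ hζ => ?_
    · exact ((hW.measurable i j).comp (f := fun ζ => (x, ζ)) (by fun_prop)).mul (hg.measurable j k)
    · rw [norm_mul]
      have h1 := hW.bound x ζ hζ.1 hζ.2 hx i j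
      exact mul_le_mul h1 (hg.bound ζ ⟨hζ.1, hζ.2.trans hx⟩ j k) (norm_nonneg _)
        ((norm_nonneg _).trans h1)
  have hφi : ∀ j t, 0 ≤ t → t ≤ r → IntervalIntegrable
      (fun η => fullPhi v a b W t η i j * g η j k) volume 0 t := by
    intro j t ht0 ht
    have hc := intervalIntegrable_mono (intervalIntegrable_fullPhiBound (B := B) (a := a) hv hb)
      ⟨le_rfl, hr⟩ ⟨ht0, ht⟩
    refine intervalIntegrable_of_norm_le ht0 ?_ (hc.mul_const G) fun η hη => ?_
    · exact ((measurable_fullPhi hv ha hb hW i j).comp (f := fun η => (t, η)) (by fun_prop)).mul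
        (hg.measurable j k)
    · rw [norm_mul]
      have h1 := norm_fullPhi_le hv ha hb hW i j t η hη.1 hη.2 ht
      exact mul_le_mul h1 (hg.bound η ⟨hη.1, hη.2.trans ht⟩ j k) (norm_nonneg _)
        ((norm_nonneg _).trans h1)
  have hpi : ∀ y, 0 ≤ y → y ≤ r → IntervalIntegrable
      (fun s => potTerm v a b (fun x => g x + kerApp W g x) s i k) volume 0 y := fun y h1 h2 =>
    intervalIntegrable_potTerm hv ha hb hz h1 h2 i k
  have e1 : kerApp W g x i k = ∑ j, ∫ ζ in (0 : ℝ)..x,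
      dAlembert (fun t η => fullPhi v a b W t η i j) x ζ * g ζ j k := by
    simp only [kerApp, matInt, Matrix.of_apply, Matrix.mul_apply]
    rw [intervalIntegral.integral_finsetSum fun j _ => hWg j]
    refine Finset.sum_congr rfl fun j _ => ?_
    refine intervalIntegral.integral_congr fun ζ hζ => ?_
    rw [uIcc_of_le hx0] at hζ
    simp only [hfix x ζ hζ.1 hζ.2 hx]
  have e2 : ∑ j, ∫ t in (0 : ℝ)..x, ∫ η in (0 : ℝ)..t, fullPhi v a b W t η i j * g η j k
      = ∫ t in (0 : ℝ)..x, ∫ s in (0 : ℝ)..t,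
          potTerm v a b (fun x => g x + kerApp W g x) s i k := by
    rw [← intervalIntegral.integral_finsetSum fun j _ =>
      intervalIntegrable_integral_mul (measurable_fullPhi hv ha hb hW i j)
        (intervalIntegrable_fullPhiBound (B := B) (a := a) hv hb) (norm_fullPhi_le hv ha hb hW i j)
        (hg.measurable j k) (fun y hy => hg.bound y hy j k) hx0 hx]
    refine intervalIntegral.integral_congr fun t ht => ?_
    rw [uIcc_of_le hx0] at ht
    have := congrFun (congrFun (matInt_fullPhi_mul hr hv ha hb hW hg ht.1 (ht.2.trans hx)) i) k
    simp only [matInt, Matrix.of_apply, Matrix.mul_apply] at this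
    rw [intervalIntegral.integral_finsetSum fun j _ => hφi j t ht.1 (ht.2.trans hx)] at this
    rw [this]
    simp only [potTerm, matInt, Matrix.sub_apply, Matrix.mul_apply, Matrix.of_apply]
  -- The Duhamel remainder, with its weight x − y, is rewritten as an iterated integral so that it
  -- merges with the potential term.
  have e3 : ∑ j, ∫ y in (0 : ℝ)..x, ((x - y : ℝ) : ℂ) * D y i j k
      = ∫ t in (0 : ℝ)..x, ∫ s in (0 : ℝ)..t, F s i k := by
    rw [integral_integral_eq_integral_sub_mul hx0 (hFi x hx0 hx),
      ← intervalIntegral.integral_finsetSum fun j _ =>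
        (hDi i j k x hx0 hx).continuousOn_mul (by fun_prop)]
    refine intervalIntegral.integral_congr fun y hy => ?_
    rw [uIcc_of_le hx0] at hy
    simp only [hDF y ⟨hy.1, hy.2.trans hx⟩, Finset.mul_sum]
  have hprim : ∀ {h : ℝ → ℂ}, IntervalIntegrable h volume 0 x →
      IntervalIntegrable (fun t => ∫ s in (0 : ℝ)..t, h s) volume 0 x := by
    intro h hh
    refine ContinuousOn.intervalIntegrable ?_
    rw [uIcc_of_le hx0]
    exact continuousOn_primitive_Icc hx0 hh
  rw [e1, Finset.sum_congr rfl fun j _ => hduh i j k x hx0 hx, Finset.sum_add_distrib, e2, e3,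
    ← intervalIntegral.integral_add (hprim (hpi x hx0 hx)) (hprim (hFi x hx0 hx))]
  refine intervalIntegral.integral_congr fun t ht => ?_
  rw [uIcc_of_le hx0] at ht
  exact (intervalIntegral.integral_add (hpi t ht.1 (ht.2.trans hx))
    (hFi t ht.1 (ht.2.trans hx))).symm

lemma isBddFun_second_primitive (hr : 0 ≤ r) (hf : IsCoef r f) (g0 : Matrix (Fin n) q ℂ) :
    ∃ G, IsBddFun r (fun x => g0 + matInt 0 x (fun τ => ((x - τ : ℝ) : ℂ) • f τ)) G := by
  refine ⟨entrySum g0 + r * ∫ t in (0 : ℝ)..r, entrySum (f t), fun i k => ?_, fun x hx i k => ?_⟩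
  · refine Measurable.const_add ?_ _
    refine measurable_intervalIntegral (F := fun x τ => ((x - τ : ℝ) : ℂ) * f τ i k) ?_
      measurable_const measurable_id
    refine Measurable.mul ?_ ((hf.measurable i k).comp measurable_snd)
    fun_prop
  · refine (norm_add_le _ _).trans (add_le_add (norm_entry_le_entrySum _ _ _) ?_)
    have hi : IntervalIntegrable (fun t => entrySum (f t)) volume 0 x :=
      intervalIntegrable_mono hf.intervalIntegrable_entrySum ⟨le_rfl, hr⟩ hx
    calc _ ≤ ∫ ζ in (0 : ℝ)..x, r * entrySum (f ζ) := by
          refine intervalIntegral.norm_integral_le_of_norm_le hx.1 ?_ (hi.const_mul _)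
          filter_upwards with ζ hζ
          simp only [Matrix.smul_apply, smul_eq_mul, norm_mul, Complex.norm_real]
          refine mul_le_mul ?_ (norm_entry_le_entrySum _ _ _) (norm_nonneg _) hr
          rw [Real.norm_eq_abs, abs_le]
          constructor <;> linarith [hζ.1, hζ.2, hx.2]
      _ = r * ∫ ζ in (0 : ℝ)..x, entrySum (f ζ) := intervalIntegral.integral_const_mul _ _
      _ ≤ _ := mul_le_mul_of_nonneg_left (hf.integral_entrySum_le le_rfl hx.1 hx.2) hr

/-- The operator with kernel `𝒱` on second primitives. -/
lemma kerApp_second_primitive (hr : 0 ≤ r) (hv : IsCoef r v) (ha : IsCoef r a) (hb : IsCoef r b)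
    (hW : IsBddKer r W B)
    (hfix : ∀ x ζ, 0 ≤ ζ → ζ ≤ x → x ≤ r → ∀ i k, W x ζ i k
      = dAlembert (fun t η => fullPhi v a b W t η i k) x ζ)
    (hf : IsCoef r f) (g0 : Matrix (Fin n) q ℂ)
    (hg : ∀ x, g x = g0 + matInt 0 x (fun τ => ((x - τ : ℝ) : ℂ) • f τ))
    {x : ℝ} (hx0 : 0 ≤ x) (hx : x ≤ r) :
    kerApp W g x = matInt 0 x (fun t => matInt 0 t (fun s =>
      potTerm v a b (fun x => g x + kerApp W g x) s + kerApp W f s)) := by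
  obtain ⟨G, hG⟩ := isBddFun_second_primitive hr hf g0
  have hg' : g = fun x => g0 + matInt 0 x (fun τ => ((x - τ : ℝ) : ℂ) • f τ) := funext hg
  rw [← hg'] at hG
  have hWf : ∀ i j k y, 0 ≤ y → y ≤ r →
      IntervalIntegrable (fun ζ => W y ζ i j * f ζ j k) volume 0 y := by
    intro i j k y hy0 hy
    refine intervalIntegrable_of_norm_le hy0 ?_
      ((intervalIntegrable_mono hf.intervalIntegrable_entrySum ⟨le_rfl, hr⟩ ⟨hy0, hy⟩).const_mul B)
      fun ζ hζ => ?_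
    · exact ((hW.measurable i j).comp (f := fun ζ => (y, ζ)) (by fun_prop)).mul (hf.measurable j k)
    · rw [norm_mul]
      have h1 := hW.bound y ζ hζ.1 hζ.2 hy i j
      exact mul_le_mul h1 (norm_entry_le_entrySum _ _ _) (norm_nonneg _)
        ((norm_nonneg _).trans h1)
  refine kerApp_eq_of_duhamel hr hv ha hb hW hfix hG
    (D := fun y i j k => ∫ ζ in (0 : ℝ)..y, W y ζ i j * f ζ j k) ?_ ?_ ?_ hx0 hx
  · intro i j k x hx0 hx
    have hB : 0 ≤ B := (norm_nonneg _).trans (hW.bound 0 0 le_rfl le_rfl hr i i)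
    refine intervalIntegrable_of_norm_le hx0 ?_
      (intervalIntegrable_const (c := B * ∫ t in (0 : ℝ)..r, entrySum (f t))) fun y hy => ?_
    · exact measurable_intervalIntegral (F := fun y ζ => W y ζ i j * f ζ j k)
        ((hW.measurable i j).mul ((hf.measurable j k).comp measurable_snd)) measurable_const
        measurable_id
    · have hi := (intervalIntegrable_mono hf.intervalIntegrable_entrySum ⟨le_rfl, hr⟩
        ⟨hy.1, hy.2.trans hx⟩)
      calc _ ≤ ∫ ζ in (0 : ℝ)..y, B * entrySum (f ζ) := by
            refine intervalIntegral.norm_integral_le_of_norm_le hy.1 ?_ (hi.const_mul _)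
            filter_upwards with ζ hζ
            rw [norm_mul]
            exact mul_le_mul (hW.bound y ζ hζ.1.le hζ.2 (hy.2.trans hx) i j)
              (norm_entry_le_entrySum _ _ _) (norm_nonneg _) hB
        _ = B * ∫ ζ in (0 : ℝ)..y, entrySum (f ζ) := intervalIntegral.integral_const_mul _ _
        _ ≤ _ := mul_le_mul_of_nonneg_left
            (hf.integral_entrySum_le le_rfl hy.1 (hy.2.trans hx)) hB
  · intro y hy i k
    simp only [kerApp, matInt, Matrix.of_apply, Matrix.mul_apply]
    exact intervalIntegral.integral_finsetSum fun j _ => hWf i j k y hy.1 hy.2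
  · intro i j k x hx0 hx
    have := integral_dAlembert_second_primitive hr (measurable_fullPhi hv ha hb hW i j)
      (intervalIntegrable_fullPhiBound (B := B) (a := a) hv hb) (norm_fullPhi_le hv ha hb hW i j)
      (hf.measurable j k) (hf.intervalIntegrable j k) (g0 j k) hx0 hx
    have hgjk : ∀ x, g x j k = g0 j k + ∫ τ in (0 : ℝ)..x, ((x - τ : ℝ) : ℂ) * f τ j k := by
      intro x
      rw [hg]
      rfl
    simp only [hgjk]
    rw [this]
    congr 1
    refine intervalIntegral.integral_congr fun y hy => ?_
    rw [uIcc_of_le hx0] at hy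
    congr 1
    refine intervalIntegral.integral_congr fun ζ hζ => ?_
    rw [uIcc_of_le hy.1] at hζ
    simp only [hfix y ζ hζ.1 hζ.2 (hy.2.trans hx)]

/-- The operator with kernel `𝒱` on linear functions. -/
lemma kerApp_linear (hr : 0 ≤ r) (hv : IsCoef r v) (ha : IsCoef r a) (hb : IsCoef r b)
    (hW : IsBddKer r W B)
    (hfix : ∀ x ζ, 0 ≤ ζ → ζ ≤ x → x ≤ r → ∀ i k, W x ζ i k
      = dAlembert (fun t η => fullPhi v a b W t η i k) x ζ)
    (g1 : Matrix (Fin n) q ℂ) (hg : ∀ x : ℝ, g x = (x : ℂ) • g1)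
    {x : ℝ} (hx0 : 0 ≤ x) (hx : x ≤ r) :
    kerApp W g x = matInt 0 x (fun t => matInt 0 t (fun s =>
      potTerm v a b (fun x => g x + kerApp W g x) s + W s 0 * g1)) := by
  have hG : IsBddFun r g (r * entrySum g1) := by
    refine ⟨fun i k => ?_, fun x hx i k => ?_⟩
    · simp only [hg, Matrix.smul_apply, smul_eq_mul]
      fun_prop
    · rw [hg, Matrix.smul_apply, norm_smul, Complex.norm_real, Real.norm_of_nonneg hx.1]
      exact mul_le_mul hx.2 (norm_entry_le_entrySum _ _ _) (norm_nonneg _) hr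
  refine kerApp_eq_of_duhamel hr hv ha hb hW hfix hG
    (D := fun y i j k => W y 0 i j * g1 j k) ?_ ?_ ?_ hx0 hx
  · intro i j k x hx0 hx
    refine IntervalIntegrable.mul_const ?_ _
    refine intervalIntegrable_of_norm_le hx0 ?_ (intervalIntegrable_const (c := B)) fun y hy => ?_
    · exact (hW.measurable i j).comp (f := fun y => (y, 0)) (by fun_prop)
    · exact hW.bound y 0 le_rfl hy.1 (hy.2.trans hx) i j
  · intro y hy i k
    rw [Matrix.mul_apply]
  · intro i j k x hx0 hx
    have := integral_dAlembert_id hr (measurable_fullPhi hv ha hb hW i j)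
      (intervalIntegrable_fullPhiBound (B := B) (a := a) hv hb) (norm_fullPhi_le hv ha hb hW i j)
      hx0 hx
    simp only [hg, Matrix.smul_apply, smul_eq_mul, ← mul_assoc, intervalIntegral.integral_mul_const]
    rw [this, add_mul]
    congr 2
    refine intervalIntegral.integral_congr fun y hy => ?_
    rw [uIcc_of_le hx0] at hy
    simp only [hfix y 0 le_rfl hy.1 (hy.2.trans hx)]

end Kernel

/-! ### Independence of the representatives of the coefficients -/

section Congr

variable {m : Type*} [Fintype m] {n : ℕ} {r : ℝ}
  {v v' : ℝ → Matrix (Fin n) (Fin n) ℂ} {a a' : ℝ → Matrix (Fin n) m ℂ}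
  {b b' : ℝ → Matrix m (Fin n) ℂ} {W W' : ℝ → ℝ → Matrix (Fin n) (Fin n) ℂ}

/-- The coefficients are only almost everywhere measurable, whereas the parameter integrals of the
series need Borel functions of several variables. The kernel is therefore built from Borel
representatives, and the congruence lemmas below bring it back to the given coefficients. -/
lemma exists_isCoef {p q : Type*} {v : ℝ → Matrix p q ℂ}
    (hr : 0 ≤ r) (hv : ∀ i k, IntervalIntegrable (fun x => v x i k) volume 0 r) :
    ∃ v', IsCoef r v' ∧ ∀ i k, ∀ᵐ x ∂(volume.restrict (Ioo 0 r)), v x i k = v' x i k := by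
  have h : ∀ i k, AEMeasurable (fun x => v x i k) (volume.restrict (Ioo 0 r)) := fun i k =>
    ((intervalIntegrable_iff_integrableOn_Ioo_of_le hr).1 (hv i k)).aestronglyMeasurable.aemeasurable
  refine ⟨fun x => Matrix.of fun i k => (h i k).mk _ x, ⟨fun i k => (h i k).measurable_mk,
    fun i k => ?_⟩, fun i k => (h i k).ae_eq_mk⟩
  rw [intervalIntegrable_iff_integrableOn_Ioo_of_le hr]
  exact ((intervalIntegrable_iff_integrableOn_Ioo_of_le hr).1 (hv i k)).congr (h i k).ae_eq_mk

lemma matInt_congr_ae {p q : Type*} {x y : ℝ} (hxy : x ≤ y) {G H : ℝ → Matrix p q ℂ}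
    (h : ∀ᵐ t, t ∈ Icc x y → G t = H t) : matInt x y G = matInt x y H := by
  ext i k
  refine intervalIntegral.integral_congr_ae ?_
  filter_upwards [h] with t ht ht'
  rw [uIoc_of_le hxy] at ht'
  rw [ht (Ioc_subset_Icc_self ht')]

variable (hv : ∀ᵐ x, x ∈ Icc 0 r → v x = v' x) (ha : ∀ᵐ x, x ∈ Icc 0 r → a x = a' x)
  (hb : ∀ᵐ x, x ∈ Icc 0 r → b x = b' x)

include ha in
lemma Fbreve_congr {t η : ℝ} (h0 : 0 ≤ η) (h1 : η ≤ t) (h2 : t ≤ r) (hbη : b η = b' η) :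
    Fbreve a b t η = Fbreve a' b' t η := by
  refine matInt_congr_ae h1 ?_
  filter_upwards [ha] with s hs hs'
  rw [hs ⟨h0.trans hs'.1, hs'.2.trans h2⟩, hbη]

include hv in
lemma innerPot_congr (hW : ∀ x ζ, 0 ≤ ζ → ζ ≤ x → x ≤ r → W x ζ = W' x ζ) {t η : ℝ}
    (h0 : 0 ≤ η) (h1 : η ≤ t) (h2 : t ≤ r) : innerPot v W t η = innerPot v' W' t η := by
  refine matInt_congr_ae h1 ?_
  filter_upwards [hv] with s hs hs'
  rw [hs ⟨h0.trans hs'.1, hs'.2.trans h2⟩, hW s η h0 hs'.1 (hs'.2.trans h2)]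

include ha hb in
lemma innerSep_congr (hW : ∀ x ζ, 0 ≤ ζ → ζ ≤ x → x ≤ r → W x ζ = W' x ζ) {t η : ℝ}
    (h0 : 0 ≤ η) (h1 : η ≤ t) (h2 : t ≤ r) : innerSep a b W t η = innerSep a' b' W' t η := by
  refine matInt_congr_ae h1 ?_
  filter_upwards [ha] with s hs hs'
  refine matInt_congr_ae hs'.1 ?_
  filter_upwards [hb] with ξ hξ hξ'
  rw [hs ⟨h0.trans hs'.1, hs'.2.trans h2⟩,
    hξ ⟨h0.trans hξ'.1, hξ'.2.trans (hs'.2.trans h2)⟩,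
    hW ξ η h0 hξ'.1 (hξ'.2.trans (hs'.2.trans h2))]

include hv ha hb

/-- The factor b is evaluated pointwise along the characteristics. Since t ↦ d − t and t ↦ t + d
preserve Lebesgue measure, changing b on a null set affects only a null set of t. -/
lemma kernelFirst_congr {x ζ : ℝ} (h0 : 0 ≤ ζ) (h1 : ζ ≤ x) (h2 : x ≤ r) :
    kernelFirst v a b x ζ = kernelFirst v' a' b' x ζ := by
  have hpot : ∀ {y}, 0 ≤ y → y ≤ r → matInt 0 y v = matInt 0 y v' := fun hy0 hy => by
    refine matInt_congr_ae hy0 ?_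
    filter_upwards [hv] with s hs hs' using hs ⟨hs'.1, hs'.2.trans hy⟩
  have hsub : ∀ d : ℝ, ∀ᵐ t, d - t ∈ Icc 0 r → b (d - t) = b' (d - t) := fun d =>
    (Measure.measurePreserving_sub_left volume d).quasiMeasurePreserving.ae hb
  have hadd : ∀ d : ℝ, ∀ᵐ t, t + d ∈ Icc 0 r → b (t + d) = b' (t + d) := fun d =>
    (measurePreserving_add_right volume d).quasiMeasurePreserving.ae hb
  have e1 : matInt ((x + ζ) / 2) x (fun t => Fbreve a b t (x - t + ζ))
      = matInt ((x + ζ) / 2) x (fun t => Fbreve a' b' t (x - t + ζ)) := by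
    refine matInt_congr_ae (by linarith) ?_
    filter_upwards [hsub (x + ζ)] with t ht ht'
    rw [show x - t + ζ = x + ζ - t by ring]
    exact Fbreve_congr ha (by linarith [ht'.2]) (by linarith [ht'.1]) (by linarith [ht'.2])
      (ht ⟨by linarith [ht'.2], by linarith [ht'.1]⟩)
  have e2 : matInt ((x - ζ) / 2) (x - ζ) (fun t => Fbreve a b t (x - t - ζ))
      = matInt ((x - ζ) / 2) (x - ζ) (fun t => Fbreve a' b' t (x - t - ζ)) := by
    refine matInt_congr_ae (by linarith) ?_
    filter_upwards [hsub (x - ζ)] with t ht ht'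
    rw [show x - t - ζ = x - ζ - t by ring]
    exact Fbreve_congr ha (by linarith [ht'.2]) (by linarith [ht'.1]) (by linarith [ht'.2])
      (ht ⟨by linarith [ht'.2], by linarith [ht'.1]⟩)
  have e3 : matInt (x - ζ) x (fun t => Fbreve a b t (ζ + t - x))
      = matInt (x - ζ) x (fun t => Fbreve a' b' t (ζ + t - x)) := by
    refine matInt_congr_ae (by linarith) ?_
    filter_upwards [hadd (ζ - x)] with t ht ht'
    rw [show ζ + t - x = t + (ζ - x) by ring]
    exact Fbreve_congr ha (by linarith [ht'.1]) (by linarith [ht'.2]) (by linarith [ht'.2])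
      (ht ⟨by linarith [ht'.1], by linarith [ht'.2]⟩)
  rw [kernelFirst, kernelFirst, e1, e2, e3, hpot (y := (x + ζ) / 2) (by linarith) (by linarith),
    hpot (y := (x - ζ) / 2) (by linarith) (by linarith)]

lemma kernelStep_congr (hW : ∀ x ζ, 0 ≤ ζ → ζ ≤ x → x ≤ r → W x ζ = W' x ζ) {x ζ : ℝ}
    (h0 : 0 ≤ ζ) (h1 : ζ ≤ x) (h2 : x ≤ r) :
    kernelStep v a b W x ζ = kernelStep v' a' b' W' x ζ := by
  have e : ∀ {y z : ℝ} {e : ℝ → ℝ}, y ≤ z → (∀ t ∈ Icc y z, 0 ≤ e t ∧ e t ≤ t ∧ t ≤ r) →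
      matInt y z (fun t => innerPot v W t (e t)) = matInt y z (fun t => innerPot v' W' t (e t)) ∧
      matInt y z (fun t => innerSep a b W t (e t))
        = matInt y z (fun t => innerSep a' b' W' t (e t)) := fun hyz he =>
    ⟨matInt_congr hyz fun t ht =>
      innerPot_congr hv hW (he t ht).1 (he t ht).2.1 (he t ht).2.2,
    matInt_congr hyz fun t ht =>
      innerSep_congr ha hb hW (he t ht).1 (he t ht).2.1 (he t ht).2.2⟩
  have e1 := e (y := x - ζ) (z := x) (e := fun t => ζ + t - x) (by linarith) fun t ht =>
    ⟨by linarith [ht.1], by linarith, by linarith [ht.2]⟩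
  have e2 := e (y := (x + ζ) / 2) (z := x) (e := fun t => ζ + x - t) (by linarith) fun t ht =>
    ⟨by linarith [ht.2], by linarith [ht.1], by linarith [ht.2]⟩
  have e3 := e (y := (x - ζ) / 2) (z := x - ζ) (e := fun t => x - t - ζ) (by linarith) fun t ht =>
    ⟨by linarith [ht.2], by linarith [ht.1], by linarith [ht.2]⟩
  simp only [kernelStep, e1.1, e1.2, e2.1, e2.2, e3.1, e3.2]

lemma kernelTerm_congr (N : ℕ) : ∀ x ζ, 0 ≤ ζ → ζ ≤ x → x ≤ r →
    kernelTerm v a b N x ζ = kernelTerm v' a' b' N x ζ := by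
  induction N with
  | zero => exact fun x ζ h0 h1 h2 => kernelFirst_congr hv ha hb h0 h1 h2
  | succ N ih => exact fun x ζ h0 h1 h2 => kernelStep_congr hv ha hb ih h0 h1 h2

end Congr

/-! ### Volterra operators in `L₂` -/

section HilbertSchmidt

variable {E : Type*} [NormedAddCommGroup E] [NormedSpace ℂ E]

omit [NormedSpace ℂ E] in
lemma integral_mul_norm_le {μ : Measure ℝ} {c : ℝ → ℝ} (hc : MemLp c 2 μ) (f : Lp E 2 μ) :
    Integrable (fun t => c t * ‖f t‖) μ ∧ ∫ t, c t * ‖f t‖ ∂μ ≤ ‖hc.toLp c‖ * ‖f‖ := by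
  have hf : MemLp (fun t => ‖f t‖) 2 μ := (Lp.memLp f).norm
  refine ⟨hc.integrable_mul hf, ?_⟩
  have h1 : ‖hf.toLp _‖ = ‖f‖ := by
    rw [Lp.norm_toLp, Lp.norm_def, eLpNorm_norm]
  rw [← h1]
  refine le_trans (le_of_eq ?_) (real_inner_le_norm (hc.toLp c) (hf.toLp _))
  rw [L2.inner_def]
  refine integral_congr_ae ?_
  filter_upwards [hc.coeFn_toLp, hf.coeFn_toLp] with t h2 h3
  rw [h2, h3]
  simp [mul_comm]

variable {μ : Measure ℝ} {κ : ℝ → ℝ → E →L[ℂ] E} {c : ℝ → ℝ}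

lemma norm_kernel_apply_le (hκ : ∀ x t, ‖κ x t‖ ≤ c x * c t) (x t : ℝ) (y : E) :
    ‖κ x t y‖ ≤ c x * (c t * ‖y‖) := by
  rw [← mul_assoc]
  exact (κ x t).le_of_opNorm_le (hκ x t) y

lemma integrable_kernel_apply (hm : StronglyMeasurable (Function.uncurry κ))
    (hc : MemLp c 2 μ) (hκ : ∀ x t, ‖κ x t‖ ≤ c x * c t) (f : Lp E 2 μ) (x : ℝ) :
    Integrable (fun t => κ x t (f t)) μ := by
  refine Integrable.mono' ((integral_mul_norm_le hc f).1.const_mul (c x)) ?_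
    (Filter.Eventually.of_forall fun t => norm_kernel_apply_le hκ x t (f t))
  have h1 : StronglyMeasurable (fun t => κ x t) :=
    hm.comp_measurable (measurable_const.prodMk measurable_id)
  exact (isBoundedBilinearMap_apply (𝕜 := ℂ) (E := E) (F := E)).continuous.comp_aestronglyMeasurable
    (h1.aestronglyMeasurable.prodMk (Lp.aestronglyMeasurable f))

lemma norm_integral_kernel_le (hc : MemLp c 2 μ) (hc0 : ∀ x, 0 ≤ c x)
    (hκ : ∀ x t, ‖κ x t‖ ≤ c x * c t) (f : Lp E 2 μ) (x : ℝ) :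
    ‖∫ t, κ x t (f t) ∂μ‖ ≤ c x * (‖hc.toLp c‖ * ‖f‖) := by
  have h1 := integral_mul_norm_le hc f
  calc ‖∫ t, κ x t (f t) ∂μ‖ ≤ ∫ t, c x * (c t * ‖f t‖) ∂μ :=
        norm_integral_le_of_norm_le (h1.1.const_mul _)
          (Filter.Eventually.of_forall fun t => norm_kernel_apply_le hκ x t (f t))
    _ = c x * ∫ t, c t * ‖f t‖ ∂μ := integral_const_mul _ _
    _ ≤ _ := mul_le_mul_of_nonneg_left h1.2 (hc0 x)

lemma memLp_integral_kernel [SFinite μ] (hm : StronglyMeasurable (Function.uncurry κ))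
    (hc : MemLp c 2 μ) (hc0 : ∀ x, 0 ≤ c x) (hκ : ∀ x t, ‖κ x t‖ ≤ c x * c t) (f : Lp E 2 μ) :
    MemLp (fun x => ∫ t, κ x t (f t) ∂μ) 2 μ := by
  refine MemLp.of_le_mul (c := ‖hc.toLp c‖ * ‖f‖) hc ?_ (Filter.Eventually.of_forall fun x => ?_)
  · have h1 : StronglyMeasurable (fun p : ℝ × ℝ => κ p.1 p.2 (f p.2)) :=
      (isBoundedBilinearMap_apply (𝕜 := ℂ) (E := E) (F := E)).continuous.comp_stronglyMeasurable
        (hm.prodMk ((Lp.stronglyMeasurable f).comp_measurable measurable_snd))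
    exact h1.integral_prod_right.aestronglyMeasurable
  · rw [Real.norm_of_nonneg (hc0 x), mul_comm]
    exact norm_integral_kernel_le hc hc0 hκ f x

/-- By Cauchy–Schwarz in t, the product bound c(x)c(t) gives ‖Tf(x)‖ ≤ c(x)‖c‖‖f‖. This pointwise
form, stronger than a bound on the norm, is what can be iterated later. -/
lemma exists_integralOperator [SFinite μ] (hm : StronglyMeasurable (Function.uncurry κ))
    (hc : MemLp c 2 μ) (hc0 : ∀ x, 0 ≤ c x) (hκ : ∀ x t, ‖κ x t‖ ≤ c x * c t) :
    ∃ T : Lp E 2 μ →L[ℂ] Lp E 2 μ, ∀ f, T f =ᵐ[μ] fun x => ∫ t, κ x t (f t) ∂μ := by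
  have hM := fun f => memLp_integral_kernel hm hc hc0 hκ f
  let L : Lp E 2 μ →ₗ[ℂ] Lp E 2 μ :=
    { toFun := fun f => (hM f).toLp _
      map_add' := fun f g => by
        rw [← MemLp.toLp_add]
        refine MemLp.toLp_congr _ _ (Filter.Eventually.of_forall fun x => ?_)
        simp only [Pi.add_apply]
        rw [← integral_add (integrable_kernel_apply hm hc hκ f x)
          (integrable_kernel_apply hm hc hκ g x)]
        refine integral_congr_ae ?_
        filter_upwards [Lp.coeFn_add f g] with t ht
        rw [ht, Pi.add_apply, map_add]
      map_smul' := fun a f => by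
        rw [RingHom.id_apply, ← MemLp.toLp_const_smul]
        refine MemLp.toLp_congr _ _ (Filter.Eventually.of_forall fun x => ?_)
        simp only [Pi.smul_apply]
        rw [← integral_smul]
        refine integral_congr_ae ?_
        filter_upwards [Lp.coeFn_smul a f] with t ht
        rw [ht, Pi.smul_apply, map_smul] }
  refine ⟨L.mkContinuous (‖hc.toLp c‖ * ‖hc.toLp c‖) fun f => ?_, fun f => (hM f).coeFn_toLp⟩
  have : ‖(hM f).toLp _‖ ≤ (‖hc.toLp c‖ * ‖f‖) * ‖hc.toLp c‖ := by
    refine Lp.norm_le_mul_norm_of_ae_le_mul ?_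
    filter_upwards [(hM f).coeFn_toLp, hc.coeFn_toLp] with x h1 h2
    rw [h1, h2, Real.norm_of_nonneg (hc0 x), mul_comm]
    exact norm_integral_kernel_le hc hc0 hκ f x
  calc ‖L f‖ ≤ _ := this
    _ = _ := by ring

end HilbertSchmidt

/-- The powers of a primitive are differentiated by the product rule for absolutely continuous
functions. The passage through ℂ is only there to use that rule. -/
lemma integral_mul_pow_primitive {r : ℝ} {h : ℝ → ℝ} (hh : IntervalIntegrable h volume 0 r)
    (N : ℕ) {x : ℝ} (hx : x ∈ Icc 0 r) :
    ∫ t in (0 : ℝ)..x, h t * (∫ s in (0 : ℝ)..t, h s) ^ N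
      = (∫ s in (0 : ℝ)..x, h s) ^ (N + 1) / (N + 1) := by
  have hr : 0 ≤ r := hx.1.trans hx.2
  have hC : IntervalIntegrable (fun t => (h t : ℂ)) volume 0 r :=
    ⟨hh.1.ofReal, hh.2.ofReal⟩
  have hD := isAC_primitive hC
  have key : ∀ N : ℕ, IsAC r (fun x => (∫ t in (0 : ℝ)..x, (h t : ℂ)) ^ (N + 1))
      (fun x => (N + 1 : ℂ) * ((h x : ℂ) * (∫ t in (0 : ℝ)..x, (h t : ℂ)) ^ N)) := by
    intro N
    induction N with
    | zero => simpa using hD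
    | succ N ih =>
      refine (ih.mul hr hD).congr hr (fun x _ => by simp only [pow_succ])
        (Filter.Eventually.of_forall fun x => ?_)
      push_cast
      ring
  have h1 := (key N).2 x hx
  rw [intervalIntegral.integral_same, zero_pow (Nat.succ_ne_zero N), zero_add,
    intervalIntegral.integral_const_mul] at h1
  have h2 : ((N : ℂ) + 1) ≠ 0 := by exact_mod_cast Nat.succ_ne_zero N
  have h3 : ((∫ t in (0 : ℝ)..x, h t * (∫ s in (0 : ℝ)..t, h s) ^ N : ℝ) : ℂ)
      = (((∫ s in (0 : ℝ)..x, h s) ^ (N + 1) / (N + 1) : ℝ) : ℂ) := by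
    push_cast
    simp only [intervalIntegral.integral_ofReal] at h1
    rw [h1, mul_div_cancel_left₀ _ h2, ← intervalIntegral.integral_ofReal]
    push_cast
    rfl
  exact_mod_cast h3

/-! ### Factorial decay of Volterra powers and invertibility. -/

section Volterra

variable {E : Type*} [NormedAddCommGroup E] [NormedSpace ℂ E] [CompleteSpace E]
  {r : ℝ} {κ : ℝ → ℝ → E →L[ℂ] E} {c : ℝ → ℝ}

omit [CompleteSpace E] in
-- The kernel vanishes for t > x, so each application of T integrates c² times the previous bound
-- over (0,x), which raises the power of ∫c² and the factorial by one. The first application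
-- contributes the global factor ‖c‖‖f‖, hence the exponent N against T^(N+1).
lemma norm_volterra_pow_le (hr : 0 ≤ r) (hc : MemLp c 2 (volume.restrict (Ioo 0 r)))
    (hc0 : ∀ x, 0 ≤ c x) (hκ : ∀ x t, ‖κ x t‖ ≤ c x * c t) (h0 : ∀ x t, x < t → κ x t = 0)
    {T : Lp E 2 (volume.restrict (Ioo 0 r)) →L[ℂ] Lp E 2 (volume.restrict (Ioo 0 r))}
    (hT : ∀ f, T f =ᵐ[volume.restrict (Ioo 0 r)]
      fun x => ∫ t, κ x t (f t) ∂(volume.restrict (Ioo 0 r)))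
    (f : Lp E 2 (volume.restrict (Ioo 0 r))) (N : ℕ) :
    ∀ᵐ x ∂(volume.restrict (Ioo 0 r)), ‖(T ^ (N + 1)) f x‖
      ≤ c x * ((∫ s in (0 : ℝ)..x, c s ^ 2) ^ N / N.factorial * (‖hc.toLp c‖ * ‖f‖)) := by
  set M := ‖hc.toLp c‖ * ‖f‖
  have hsq : IntervalIntegrable (fun s => c s ^ 2) volume 0 r := by
    rw [intervalIntegrable_iff_integrableOn_Ioo_of_le hr]
    exact hc.integrable_sq
  induction N with
  | zero =>
    filter_upwards [hT f] with x hx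
    simpa only [zero_add, pow_one, hx, pow_zero, Nat.factorial_zero, Nat.cast_one, div_one, one_mul]
      using norm_integral_kernel_le hc hc0 hκ f x
  | succ N ih =>
    have e : (T ^ (N + 1 + 1)) f = T ((T ^ (N + 1)) f) := by rw [pow_succ' T (N + 1)]; rfl
    rw [e]
    filter_upwards [hT ((T ^ (N + 1)) f), ae_restrict_mem measurableSet_Ioo] with x hx hxr
    have hxr' : x ∈ Icc 0 r := Ioo_subset_Icc_self hxr
    rw [hx]
    have e1 : ∫ t, κ x t ((T ^ (N + 1)) f t) ∂(volume.restrict (Ioo 0 r))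
        = ∫ t in Ioc 0 x, κ x t ((T ^ (N + 1)) f t) := by
      refine setIntegral_eq_of_subset_of_forall_sdiff_eq_zero measurableSet_Ioo
        (fun t ht => ⟨ht.1, ht.2.trans_lt hxr.2⟩) fun t ht => ?_
      have : x < t := by
        by_contra h
        exact ht.2 ⟨ht.1.1, not_lt.1 h⟩
      rw [h0 x t this]
      rfl
    have hle : Ioc 0 x ⊆ Ioo 0 r := fun t ht => ⟨ht.1, ht.2.trans_lt hxr.2⟩
    have hint : IntervalIntegrable (fun t => c t ^ 2 * (∫ s in (0 : ℝ)..t, c s ^ 2) ^ N)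
        volume 0 x :=
      (intervalIntegrable_mono hsq (zero_mem_Icc hxr') hxr').mul_continuousOn (by
        rw [uIcc_of_le hxr.1.le]
        exact ((continuousOn_primitive_Icc hr hsq).pow N).mono (Icc_subset_Icc_right hxr.2.le))
    calc ‖∫ t, κ x t ((T ^ (N + 1)) f t) ∂(volume.restrict (Ioo 0 r))‖
        ≤ ∫ t in Ioc 0 x, (c x * M / N.factorial) *
            (c t ^ 2 * (∫ s in (0 : ℝ)..t, c s ^ 2) ^ N) := by
          rw [e1]
          refine norm_integral_le_of_norm_le
            (((intervalIntegrable_iff_integrableOn_Ioc_of_le hxr.1.le).1 hint).const_mul _) ?_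
          filter_upwards [ae_restrict_of_ae_restrict_of_subset hle ih] with t ht
          refine (norm_kernel_apply_le hκ x t _).trans ?_
          calc c x * (c t * ‖(T ^ (N + 1)) f t‖) ≤ c x * (c t * _) :=
                mul_le_mul_of_nonneg_left (mul_le_mul_of_nonneg_left ht (hc0 t)) (hc0 x)
            _ = _ := by ring
      _ = (c x * M / N.factorial) * ((∫ s in (0 : ℝ)..x, c s ^ 2) ^ (N + 1) / (N + 1)) := by
          rw [integral_const_mul, ← intervalIntegral.integral_of_le hxr.1.le,
            integral_mul_pow_primitive hsq N hxr']
      _ = _ := by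
          rw [Nat.factorial_succ]
          have : (N.factorial : ℝ) ≠ 0 := by exact_mod_cast N.factorial_ne_zero
          push_cast
          field_simp

lemma isUnit_one_add_of_volterra (hr : 0 ≤ r) (hc : MemLp c 2 (volume.restrict (Ioo 0 r)))
    (hc0 : ∀ x, 0 ≤ c x) (hκ : ∀ x t, ‖κ x t‖ ≤ c x * c t) (h0 : ∀ x t, x < t → κ x t = 0)
    {T : Lp E 2 (volume.restrict (Ioo 0 r)) →L[ℂ] Lp E 2 (volume.restrict (Ioo 0 r))}
    (hT : ∀ f, T f =ᵐ[volume.restrict (Ioo 0 r)]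
      fun x => ∫ t, κ x t (f t) ∂(volume.restrict (Ioo 0 r))) :
    IsUnit (1 + T) := by
  set D := ∫ s in (0 : ℝ)..r, c s ^ 2
  have hsq : IntervalIntegrable (fun s => c s ^ 2) volume 0 r := by
    rw [intervalIntegrable_iff_integrableOn_Ioo_of_le hr]
    exact hc.integrable_sq
  have hN : ∀ N : ℕ, ‖T ^ (N + 1)‖ ≤ D ^ N / N.factorial * (‖hc.toLp c‖ * ‖hc.toLp c‖) := by
    intro N
    have hD : 0 ≤ D := intervalIntegral.integral_nonneg hr fun s _ => sq_nonneg _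
    refine ContinuousLinearMap.opNorm_le_bound _ (by positivity) fun f => ?_
    have : ‖(T ^ (N + 1)) f‖
        ≤ (D ^ N / N.factorial * (‖hc.toLp c‖ * ‖f‖)) * ‖hc.toLp c‖ := by
      refine Lp.norm_le_mul_norm_of_ae_le_mul ?_
      filter_upwards [norm_volterra_pow_le hr hc hc0 hκ h0 hT f N, hc.coeFn_toLp,
        ae_restrict_mem measurableSet_Ioo] with x h1 h2 hx
      rw [h2, Real.norm_of_nonneg (hc0 x), mul_comm]
      refine h1.trans (mul_le_mul_of_nonneg_left ?_ (hc0 x))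
      have h3 : ∫ s in (0 : ℝ)..x, c s ^ 2 ≤ D :=
        intervalIntegral.integral_mono_interval le_rfl hx.1.le hx.2.le
          (Filter.Eventually.of_forall fun s => sq_nonneg _) hsq
      have h4 : 0 ≤ ∫ s in (0 : ℝ)..x, c s ^ 2 :=
        intervalIntegral.integral_nonneg hx.1.le fun s _ => sq_nonneg _
      gcongr
    calc _ ≤ _ := this
      _ = _ := by ring
  have hlim : Filter.Tendsto (fun N : ℕ => D ^ N / N.factorial * (‖hc.toLp c‖ * ‖hc.toLp c‖))
      Filter.atTop (nhds 0) := by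
    simpa using (FloorSemiring.tendsto_pow_div_factorial_atTop D).mul_const
      (‖hc.toLp c‖ * ‖hc.toLp c‖)
  obtain ⟨N, hN1⟩ := (hlim.eventually (gt_mem_nhds one_pos)).exists
  have hu : IsUnit (1 - (-T) ^ (N + 1)) := by
    refine isUnit_one_sub_of_norm_lt_one ?_
    rcases Nat.even_or_odd (N + 1) with h | h
    · rw [h.neg_pow]; exact (hN N).trans_lt hN1
    · rw [h.neg_pow, norm_neg]; exact (hN N).trans_lt hN1
  -- 1 − (−T)^(N+1) is the product of 1 + T with a polynomial in T. The factors commute, so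
  -- invertibility of the product passes to 1 + T.
  rw [← mul_neg_geom_sum] at hu
  have hcomm : Commute (1 - -T) (∑ i ∈ Finset.range (N + 1), (-T) ^ i) :=
    Commute.sum_right _ _ _ fun i _ =>
      (Commute.sub_left (Commute.one_left _) ((Commute.refl (-T)).pow_right i))
  simpa [sub_neg_eq_add] using (hcomm.isUnit_mul_iff.1 hu).1

end Volterra

/-! ### Volterra operators with matrix kernels -/

section MatrixVolterra

variable {ι : Type*} [Fintype ι] [DecidableEq ι]

lemma toEuclideanCLM_eq_sum (M : Matrix ι ι ℂ) :
    Matrix.toEuclideanCLM (n := ι) (𝕜 := ℂ) M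
      = ∑ i, ∑ j, M i j • Matrix.toEuclideanCLM (n := ι) (𝕜 := ℂ) (Matrix.single i j 1) := by
  conv_lhs => rw [Matrix.matrix_eq_sum_single M]
  simp only [map_sum]
  refine Finset.sum_congr rfl fun i _ => Finset.sum_congr rfl fun j _ => ?_
  rw [← map_smul, Matrix.smul_single, smul_eq_mul, mul_one]

lemma norm_toEuclideanCLM_single_le (i j : ι) :
    ‖Matrix.toEuclideanCLM (n := ι) (𝕜 := ℂ) (Matrix.single i j 1)‖ ≤ 1 := by
  refine ContinuousLinearMap.opNorm_le_bound _ zero_le_one fun y => ?_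
  have : Matrix.toEuclideanCLM (n := ι) (𝕜 := ℂ) (Matrix.single i j 1) y
      = EuclideanSpace.single i (y j) := by
    ext l
    rw [Matrix.ofLp_toEuclideanCLM, Matrix.single_mulVec]
    simp [Function.update_apply]
  rw [this, PiLp.norm_single, one_mul]
  exact PiLp.norm_apply_le y j

lemma norm_toEuclideanCLM_le (M : Matrix ι ι ℂ) :
    ‖Matrix.toEuclideanCLM (n := ι) (𝕜 := ℂ) M‖ ≤ entrySum M := by
  rw [toEuclideanCLM_eq_sum]
  refine (norm_sum_le _ _).trans (Finset.sum_le_sum fun i _ => (norm_sum_le _ _).trans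
    (Finset.sum_le_sum fun j _ => ?_))
  rw [norm_smul]
  exact mul_le_of_le_one_right (norm_nonneg _) (norm_toEuclideanCLM_single_le i j)

lemma stronglyMeasurable_toEuclideanCLM {α : Type*} [MeasurableSpace α] {M : α → Matrix ι ι ℂ}
    (h : ∀ i k, Measurable fun x => M x i k) :
    StronglyMeasurable fun x => Matrix.toEuclideanCLM (n := ι) (𝕜 := ℂ) (M x) := by
  simp only [toEuclideanCLM_eq_sum (M _)]
  exact Finset.stronglyMeasurable_fun_sum _ fun i _ => Finset.stronglyMeasurable_fun_sum _
    fun j _ => (h i j).stronglyMeasurable.smul_const _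

/-- A vector function as a function with values in the one-column matrices. -/
def colFun {ι : Type*} (f : ℝ → EuclideanSpace ℂ ι) (x : ℝ) : Matrix ι Unit ℂ :=
  Matrix.of fun i _ => f x i

/-- The kernel is cut off to the triangle 0 < t ≤ x < r, so the product bound is required only
there; the cut-off leaves the integrals over (0,x) unchanged for x in (0,r). -/
lemma exists_matrixVolterra {r : ℝ} (hr : 0 ≤ r) {k : ℝ → ℝ → Matrix ι ι ℂ} {c : ℝ → ℝ}
    (hk : ∀ i j, Measurable fun p : ℝ × ℝ => k p.1 p.2 i j)
    (hc : MemLp c 2 (volume.restrict (Ioo 0 r))) (hc0 : ∀ x, 0 ≤ c x)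
    (hkc : ∀ x t, 0 < t → t ≤ x → x < r → entrySum (k x t) ≤ c x * c t) :
    ∃ T : Lp (EuclideanSpace ℂ ι) 2 (volume.restrict (Ioo 0 r)) →L[ℂ]
        Lp (EuclideanSpace ℂ ι) 2 (volume.restrict (Ioo 0 r)),
      (∀ f, ∀ᵐ x ∂(volume.restrict (Ioo 0 r)),
        colFun (T f) x = matInt 0 x (fun t => k x t * colFun f t)) ∧ IsUnit (1 + T) := by
  classical
  set S : Set (ℝ × ℝ) := {p | 0 < p.2 ∧ p.2 ≤ p.1 ∧ p.1 < r}
  have hS : MeasurableSet S :=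
    (measurableSet_lt measurable_const measurable_snd).inter
      ((measurableSet_le measurable_snd measurable_fst).inter
        (measurableSet_lt measurable_fst measurable_const))
  set κ : ℝ → ℝ → EuclideanSpace ℂ ι →L[ℂ] EuclideanSpace ℂ ι := fun x t =>
    S.indicator (fun p => Matrix.toEuclideanCLM (n := ι) (𝕜 := ℂ) (k p.1 p.2)) (x, t)
  have hm : StronglyMeasurable (Function.uncurry κ) :=
    (stronglyMeasurable_toEuclideanCLM (M := fun p : ℝ × ℝ => k p.1 p.2) hk).indicator hS
  have hκ : ∀ x t, ‖κ x t‖ ≤ c x * c t := by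
    intro x t
    by_cases h : (x, t) ∈ S
    · simp only [κ, indicator_of_mem h]
      exact (norm_toEuclideanCLM_le _).trans (hkc x t h.1 h.2.1 h.2.2)
    · simp only [κ, indicator_of_notMem h, norm_zero]
      exact mul_nonneg (hc0 x) (hc0 t)
  have h0 : ∀ x t, x < t → κ x t = 0 := fun x t hxt =>
    indicator_of_notMem (fun h => absurd h.2.1 (not_le.2 hxt)) _
  obtain ⟨T, hT⟩ := exists_integralOperator hm hc hc0 hκ
  refine ⟨T, fun f => ?_, isUnit_one_add_of_volterra hr hc hc0 hκ h0 hT⟩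
  filter_upwards [hT f, ae_restrict_mem measurableSet_Ioo] with x hx hxr
  ext i j
  have hint := integrable_kernel_apply hm hc hκ f x
  simp only [colFun, Matrix.of_apply, hx, matInt]
  rw [eval_integral_piLp hint.eval_piLp, intervalIntegral.integral_of_le hxr.1.le,
    setIntegral_eq_of_subset_of_forall_sdiff_eq_zero measurableSet_Ioo
      (s := Ioc 0 x) (fun t ht => ⟨ht.1, ht.2.trans_lt hxr.2⟩)]
  · refine setIntegral_congr_fun measurableSet_Ioc fun t ht => ?_
    have h : (x, t) ∈ S := ⟨ht.1, ht.2, hxr.2⟩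
    simp only [κ, indicator_of_mem h, Matrix.ofLp_toEuclideanCLM]
    rfl
  · intro t ht
    rw [h0 x t (by by_contra h; exact ht.2 ⟨ht.1.1, not_lt.1 h⟩)]
    rfl

end MatrixVolterra

/-! ### Classes of matrix functions -/

/-- Entrywise continuity on `[0,r]`. -/
def IsContMat {p q : Type*} (r : ℝ) (F : ℝ → Matrix p q ℂ) : Prop :=
  ∀ i k, ContinuousOn (fun x => F x i k) (Icc 0 r)

/-- Entrywise square integrability on `(0,r)`. -/
def IsL2Mat {p q : Type*} (r : ℝ) (F : ℝ → Matrix p q ℂ) : Prop :=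
  ∀ i k, MemLp (fun x => F x i k) 2 (volume.restrict (Ioo (0 : ℝ) r))

/-- `F` is entrywise absolutely continuous on `[0,r]` with derivative `F'`. -/
def IsACMat {p q : Type*} (r : ℝ) (F F' : ℝ → Matrix p q ℂ) : Prop :=
  ∀ i k, IsAC r (fun x => F x i k) (fun x => F' x i k)

section Classes

variable {p q s : Type*} {r : ℝ} {F F' F'' : ℝ → Matrix p q ℂ} {G G' G'' : ℝ → Matrix p q ℂ}
  {H H' H'' : ℝ → Matrix q s ℂ}

lemma memLp_mul_continuousOn {f g : ℝ → ℂ} (hf : MemLp f 2 (volume.restrict (Ioo (0 : ℝ) r)))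
    (hg : ContinuousOn g (Icc 0 r)) :
    MemLp (fun x => f x * g x) 2 (volume.restrict (Ioo (0 : ℝ) r)) := by
  obtain ⟨C, hC⟩ := isCompact_Icc.exists_bound_of_continuousOn hg
  refine MemLp.of_le_mul (c := C) hf ?_ ?_
  · exact hf.aestronglyMeasurable.mul
      ((hg.mono Ioo_subset_Icc_self).aestronglyMeasurable measurableSet_Ioo)
  · filter_upwards [ae_restrict_mem measurableSet_Ioo] with x hx
    rw [norm_mul, mul_comm]
    exact mul_le_mul_of_nonneg_right (hC x (Ioo_subset_Icc_self hx)) (norm_nonneg _)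

lemma continuousOn_memLp {g : ℝ → ℂ} (hg : ContinuousOn g (Icc 0 r)) :
    MemLp g 2 (volume.restrict (Ioo (0 : ℝ) r)) := by
  simpa using memLp_mul_continuousOn (f := fun _ => 1) (memLp_const 1) hg

lemma IsContMat.isL2Mat (hF : IsContMat r F) : IsL2Mat r F := fun i k => continuousOn_memLp (hF i k)

lemma IsContMat.add (hF : IsContMat r F) (hG : IsContMat r G) : IsContMat r (fun x => F x + G x) :=
  fun i k => (hF i k).add (hG i k)

lemma IsContMat.smul (c : ℂ) (hF : IsContMat r F) : IsContMat r (fun x => c • F x) :=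
  fun i k => (hF i k).const_smul c

lemma isContMat_const (M : Matrix p q ℂ) : IsContMat r (fun _ => M) := fun _ _ => continuousOn_const

lemma IsContMat.conjTranspose (hF : IsContMat r F) : IsContMat r (fun x => (F x)ᴴ) :=
  fun i k => (hF k i).star

lemma IsContMat.mul [Fintype q] (hF : IsContMat r F) (hH : IsContMat r H) :
    IsContMat r (fun x => F x * H x) := fun i k => by
  simp only [Matrix.mul_apply]
  exact continuousOn_finsetSum _ fun j _ => (hF i j).mul (hH j k)

lemma IsL2Mat.add (hF : IsL2Mat r F) (hG : IsL2Mat r G) : IsL2Mat r (fun x => F x + G x) :=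
  fun i k => (hF i k).add (hG i k)

lemma IsL2Mat.sub (hF : IsL2Mat r F) (hG : IsL2Mat r G) : IsL2Mat r (fun x => F x - G x) :=
  fun i k => (hF i k).sub (hG i k)

lemma IsL2Mat.smul (c : ℂ) (hF : IsL2Mat r F) : IsL2Mat r (fun x => c • F x) :=
  fun i k => (hF i k).const_smul c

lemma IsL2Mat.conjTranspose (hF : IsL2Mat r F) : IsL2Mat r (fun x => (F x)ᴴ) :=
  fun i k => (hF k i).star

lemma IsL2Mat.mul_isContMat [Fintype q] (hF : IsL2Mat r F) (hH : IsContMat r H) :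
    IsL2Mat r (fun x => F x * H x) := fun i k => by
  simp only [Matrix.mul_apply]
  exact memLp_finsetSum _ fun j _ => memLp_mul_continuousOn (hF i j) (hH j k)

lemma IsContMat.mul_isL2Mat [Fintype q] (hF : IsContMat r F) (hH : IsL2Mat r H) :
    IsL2Mat r (fun x => F x * H x) := fun i k => by
  simp only [Matrix.mul_apply, mul_comm (F _ _ _)]
  exact memLp_finsetSum _ fun j _ => memLp_mul_continuousOn (hH j k) (hF i j)

lemma IsL2Mat.intervalIntegrable (hr : 0 ≤ r) (hF : IsL2Mat r F) (i : p) (k : q) :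
    IntervalIntegrable (fun x => F x i k) volume 0 r := memLp_intervalIntegrable hr (hF i k)

lemma IsL2Mat.congr (hF : IsL2Mat r F)
    (h : ∀ᵐ x ∂(volume.restrict (Ioo 0 r)), F x = G x) : IsL2Mat r G := fun i k =>
  (hF i k).ae_eq (by filter_upwards [h] with x hx using by rw [hx])

lemma IsACMat.isContMat (hF : IsACMat r F F') : IsContMat r F := fun i k => (hF i k).continuousOn

lemma isACMat_const (M : Matrix p q ℂ) : IsACMat r (fun _ => M) (fun _ => 0) :=
  fun i k => isAC_const (M i k)

lemma IsACMat.add (hF : IsACMat r F F') (hG : IsACMat r G G') :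
    IsACMat r (fun x => F x + G x) (fun x => F' x + G' x) := fun i k => (hF i k).add (hG i k)

lemma IsACMat.sub (hF : IsACMat r F F') (hG : IsACMat r G G') :
    IsACMat r (fun x => F x - G x) (fun x => F' x - G' x) := fun i k => (hF i k).sub (hG i k)

lemma IsACMat.smul (c : ℂ) (hF : IsACMat r F F') :
    IsACMat r (fun x => c • F x) (fun x => c • F' x) := fun i k => (hF i k).const_mul c

lemma IsACMat.conjTranspose (hF : IsACMat r F F') :
    IsACMat r (fun x => (F x)ᴴ) (fun x => (F' x)ᴴ) := fun i k => (hF k i).conj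

lemma IsACMat.transpose (hF : IsACMat r F F') :
    IsACMat r (fun x => (F x)ᵀ) (fun x => (F' x)ᵀ) := fun i k => hF k i

lemma IsACMat.mul [Fintype q] (hr : 0 ≤ r) (hF : IsACMat r F F') (hH : IsACMat r H H') :
    IsACMat r (fun x => F x * H x) (fun x => F' x * H x + F x * H' x) := fun i k => by
  simp only [Matrix.mul_apply, Matrix.add_apply, ← Finset.sum_add_distrib]
  exact IsAC.sum _ fun j _ => (hF i j).mul hr (hH j k)

lemma IsACMat.congr (hF : IsACMat r F F') (hr : 0 ≤ r) (h : EqOn G F (Icc 0 r))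
    (h' : ∀ᵐ x ∂(volume.restrict (Ioo 0 r)), G' x = F' x) : IsACMat r G G' := fun i k =>
  (hF i k).congr hr (fun x hx => by simp only [h hx])
    (by filter_upwards [h'] with x hx using by rw [hx])

lemma IsACMat.eqOn_of_deriv_ae_eq (hr : 0 ≤ r) (hF : IsACMat r F F') (hG : IsACMat r G G')
    (h0 : F 0 = G 0) (h : ∀ᵐ x ∂(volume.restrict (Ioo 0 r)), F' x = G' x) :
    EqOn F G (Icc 0 r) := fun x hx => by
  ext i k
  exact (hF i k).eqOn_of_deriv_ae_eq hr (hG i k) (by simp only [h0])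
    (by filter_upwards [h] with x hx using by rw [hx]) hx

lemma IsACMat.ae_eq_deriv_of_eqOn [Finite p] [Finite q] (hr : 0 ≤ r) (hF : IsACMat r F F')
    (hG : IsACMat r G G') (h : EqOn F G (Icc 0 r)) :
    ∀ᵐ x ∂(volume.restrict (Ioo 0 r)), F' x = G' x := by
  have : ∀ i k, ∀ᵐ x ∂(volume.restrict (Ioo 0 r)), F' x i k = G' x i k := fun i k =>
    (hF i k).ae_eq_deriv_of_eqOn hr (hG i k) (fun x hx => by simp only [h hx])
  simp only [← ae_all_iff] at this
  filter_upwards [this] with x hx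
  ext i k
  exact hx i k

lemma isACMat_primitive (hF : ∀ i k, IntervalIntegrable (fun x => F x i k) volume 0 r) :
    IsACMat r (fun x => matInt 0 x F) F := fun i k => isAC_primitive (hF i k)

lemma IsUMat.isACMat (hr : 0 ≤ r) (h : IsUMat r F F' F'') : IsACMat r F F' :=
  fun i k => (h i k).isAC hr

lemma IsUMat.isACMat_deriv (hr : 0 ≤ r) (h : IsUMat r F F' F'') : IsACMat r F' F'' :=
  fun i k => (h i k).isAC_deriv hr

lemma IsUMat.isL2Mat (h : IsUMat r F F' F'') : IsL2Mat r F'' := fun i k => (h i k).memLp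

lemma isUMat_of_isACMat (hF : IsACMat r F F') (hF' : IsACMat r F' F'') (h : IsL2Mat r F'') :
    IsUMat r F F' F'' := fun i k => isU_of_isAC (hF i k) (hF' i k) (h i k)

lemma IsUMat.add (hr : 0 ≤ r) (hF : IsUMat r F F' F'') (hG : IsUMat r G G' G'') :
    IsUMat r (fun x => F x + G x) (fun x => F' x + G' x) (fun x => F'' x + G'' x) :=
  isUMat_of_isACMat ((hF.isACMat hr).add (hG.isACMat hr))
    ((hF.isACMat_deriv hr).add (hG.isACMat_deriv hr)) (hF.isL2Mat.add hG.isL2Mat)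

lemma IsUMat.sub (hr : 0 ≤ r) (hF : IsUMat r F F' F'') (hG : IsUMat r G G' G'') :
    IsUMat r (fun x => F x - G x) (fun x => F' x - G' x) (fun x => F'' x - G'' x) :=
  isUMat_of_isACMat ((hF.isACMat hr).sub (hG.isACMat hr))
    ((hF.isACMat_deriv hr).sub (hG.isACMat_deriv hr)) (hF.isL2Mat.sub hG.isL2Mat)

lemma IsUMat.mul [Fintype q] (hr : 0 ≤ r) (hF : IsUMat r F F' F'') (hH : IsUMat r H H' H'') :
    IsUMat r (fun x => F x * H x) (fun x => F' x * H x + F x * H' x)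
      (fun x => (F'' x * H x + F' x * H' x) + (F' x * H' x + F x * H'' x)) := by
  have hF1 := hF.isACMat hr
  have hF2 := hF.isACMat_deriv hr
  have hH1 := hH.isACMat hr
  have hH2 := hH.isACMat_deriv hr
  refine isUMat_of_isACMat (hF1.mul hr hH1) ((hF2.mul hr hH1).add (hF1.mul hr hH2)) ?_
  have h3 := (hF2.isContMat.mul hH2.isContMat).isL2Mat
  exact ((hF.isL2Mat.mul_isContMat hH1.isContMat).add h3).add
    (h3.add (hF1.isContMat.mul_isL2Mat hH.isL2Mat))

end Classes

/-! ### Fundamental solutions -/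

section FundSol

variable {ι : Type*} [Fintype ι] [DecidableEq ι] {r : ℝ} {B Y : ℝ → Matrix ι ι ℂ}

lemma memLp_entrySum {p q : Type*} [Fintype p] [Fintype q] {F : ℝ → Matrix p q ℂ}
    (hF : IsL2Mat r F) : MemLp (fun x => entrySum (F x)) 2 (volume.restrict (Ioo (0 : ℝ) r)) :=
  memLp_finsetSum _ fun i _ => memLp_finsetSum _ fun k _ => (hF i k).norm

lemma exists_isCoef_of_isL2Mat {p q : Type*} [Finite p] [Finite q] {F : ℝ → Matrix p q ℂ}
    (hr : 0 ≤ r) (hF : IsL2Mat r F) :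
    ∃ F', IsCoef r F' ∧ IsL2Mat r F' ∧ ∀ᵐ x ∂(volume.restrict (Ioo 0 r)), F x = F' x := by
  obtain ⟨F', h1, h2⟩ := exists_isCoef hr (hF.intervalIntegrable hr)
  have h3 : ∀ᵐ x ∂(volume.restrict (Ioo 0 r)), F x = F' x := by
    simp only [← ae_all_iff] at h2
    filter_upwards [h2] with x hx
    ext i k
    exact hx i k
  exact ⟨F', h1, hF.congr h3, h3⟩

omit [DecidableEq ι] in
lemma isL2Mat_colFun {r : ℝ} (f : Lp (EuclideanSpace ℂ ι) 2 (volume.restrict (Ioo (0 : ℝ) r))) :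
    IsL2Mat r (colFun f) := fun i _ => (Lp.memLp f).eval_piLp i

lemma exists_add_apply_eq {X : Type*} [NormedAddCommGroup X] [NormedSpace ℂ X] {T : X →L[ℂ] X}
    (hT : IsUnit (1 + T)) (g : X) : ∃ w, w + T w = g := by
  obtain ⟨S, hS⟩ := hT
  refine ⟨(S⁻¹ : (X →L[ℂ] X)ˣ).val g, ?_⟩
  have h1 := DFunLike.congr_fun (S.mul_inv) g
  rw [hS] at h1
  exact h1

omit [DecidableEq ι] in
lemma colFun_add_apply_eq {f g : Lp (EuclideanSpace ℂ ι) 2 (volume.restrict (Ioo (0 : ℝ) r))} :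
    ∀ᵐ x ∂(volume.restrict (Ioo (0 : ℝ) r)), colFun (f + g : Lp _ _ _) x
      = colFun f x + colFun g x := by
  filter_upwards [Lp.coeFn_add f g] with x hx
  ext i j
  simp only [colFun, hx, Pi.add_apply, PiLp.add_apply, Matrix.add_apply, Matrix.of_apply]

/-- Volterra equation `w = B (e + ∫ w)`. -/
lemma exists_colFun_eq_mul (hr : 0 ≤ r) (hB : IsL2Mat r B) (e : ι → ℂ) :
    ∃ w : Lp (EuclideanSpace ℂ ι) 2 (volume.restrict (Ioo (0 : ℝ) r)),
      ∀ᵐ x ∂(volume.restrict (Ioo (0 : ℝ) r)), colFun w x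
        = B x * (Matrix.of (fun i _ => e i) + matInt 0 x (colFun w)) := by
  obtain ⟨B', hB', hB2, hBB⟩ := exists_isCoef_of_isL2Mat hr hB
  -- The kernel −B(x) does not depend on t; the summand 1 makes c(x)c(t) dominate it.
  have hc : MemLp (fun x => 1 + entrySum (B' x)) 2 (volume.restrict (Ioo (0 : ℝ) r)) :=
    (memLp_const (1 : ℝ)).add (memLp_entrySum hB2)
  have hc0 : ∀ x, 0 ≤ 1 + entrySum (B' x) := fun x => add_nonneg zero_le_one (entrySum_nonneg _)
  have hm : ∀ i j, Measurable fun p : ℝ × ℝ => (-B' p.1) i j := fun i j =>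
    ((hB'.measurable i j).comp measurable_fst).neg
  have hk : ∀ x t, 0 < t → t ≤ x → x < r →
      entrySum (-B' x) ≤ (1 + entrySum (B' x)) * (1 + entrySum (B' t)) := fun x t _ _ _ => by
    have h1 := entrySum_nonneg (B' x)
    have h2 := entrySum_nonneg (B' t)
    have h3 : entrySum (-B' x) = entrySum (B' x) := by simp [entrySum]
    rw [h3]
    nlinarith [mul_nonneg h1 h2]
  obtain ⟨T, hT, hU⟩ := exists_matrixVolterra (k := fun x _ => -B' x) hr hm hc hc0 hk
  have hB3 : IsL2Mat r (fun x => B' x * Matrix.of (fun i (_ : Unit) => e i)) :=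
    hB2.mul_isContMat (isContMat_const _)
  have hBe : MemLp (fun x => WithLp.toLp 2 fun i => (B' x * Matrix.of (fun i (_ : Unit) => e i)) i ())
      2 (volume.restrict (Ioo (0 : ℝ) r)) := MemLp.of_eval_piLp fun i => hB3 i ()
  obtain ⟨w, hw⟩ := exists_add_apply_eq hU (hBe.toLp _)
  refine ⟨w, ?_⟩
  have h3 := colFun_add_apply_eq (f := w) (g := T w)
  rw [hw] at h3
  filter_upwards [h3, hBe.coeFn_toLp, hT w, hBB, ae_restrict_mem measurableSet_Ioo]
    with x h4 h5 h6 h7 hx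
  have hx' := Ioo_subset_Icc_self hx
  have h8 : colFun (hBe.toLp _) x = B' x * Matrix.of (fun i (_ : Unit) => e i) := by
    ext i j
    simp only [colFun, h5, Matrix.of_apply]
  rw [h8, h6] at h4
  have h9 : matInt 0 x (fun t => -B' x * colFun w t) = -B' x * matInt 0 x (colFun w) :=
    matInt_const_mul _ fun i j =>
      intervalIntegrable_mono ((isL2Mat_colFun w).intervalIntegrable hr i j) (zero_mem_Icc hx') hx'
  rw [h9, Matrix.neg_mul] at h4
  rw [h7, Matrix.mul_add, h4]
  exact (neg_add_cancel_right _ _).symm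

/-- The Volterra equation is solved for the derivatives w of the columns, which lie in L₂, and Y is
recovered as I + ∫w. So Y is continuous although the coefficient is only square integrable. -/
lemma exists_isFundSol (hr : 0 ≤ r) (hB : IsL2Mat r B) : ∃ Y, IsFundSol r B Y := by
  choose w hw using fun j : ι => exists_colFun_eq_mul hr hB (Pi.single j 1)
  have hwi : ∀ i j, IntervalIntegrable (fun x => w j x i) volume 0 r := fun i j =>
    (isL2Mat_colFun (w j)).intervalIntegrable hr i ()
  set Y : ℝ → Matrix ι ι ℂ := fun x => 1 + matInt 0 x (fun t => Matrix.of fun i j => w j t i)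
  have hY : IsACMat r Y (fun x => Matrix.of fun i j => w j x i) := by
    have := (isACMat_const (r := r) (1 : Matrix ι ι ℂ)).add
      (isACMat_primitive (F := fun t => Matrix.of fun i j => w j t i) hwi)
    simpa only [zero_add] using this
  have hd : ∀ᵐ x ∂(volume.restrict (Ioo 0 r)), Matrix.of (fun i j => w j x i) = B x * Y x := by
    filter_upwards [ae_all_iff.2 hw] with x hx
    ext i j
    have h1 := congrFun (congrFun (hx j) i) ()
    simp only [colFun, Matrix.of_apply, Matrix.mul_apply] at h1
    simp only [Matrix.of_apply, h1, Matrix.mul_apply]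
    refine Finset.sum_congr rfl fun l _ => ?_
    simp [Y, matInt, Matrix.one_apply, Pi.single_apply, colFun]
  refine ⟨Y, continuousOn_pi.2 fun i => continuousOn_pi.2 fun j => hY.isContMat i j,
    fun x hx => ?_⟩
  ext i j
  have := (hY.congr (G := Y) hr (fun _ _ => rfl) (by
    filter_upwards [hd] with x hx using hx.symm) i j).2 x hx
  rw [this]
  simp [Y, matInt]

lemma IsFundSol.isContMat (h : IsFundSol r B Y) : IsContMat r Y := fun i k =>
  continuousOn_pi.1 (continuousOn_pi.1 h.continuousOn i) k

lemma IsFundSol.zero (hr : 0 ≤ r) (h : IsFundSol r B Y) : Y 0 = 1 := by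
  rw [h.integral_eq 0 ⟨le_rfl, hr⟩]
  ext i k
  simp [matInt]

lemma IsFundSol.isACMat (hr : 0 ≤ r) (hB : IsL2Mat r B) (h : IsFundSol r B Y) :
    IsACMat r Y (fun x => B x * Y x) := fun i k =>
  ⟨(hB.mul_isContMat h.isContMat).intervalIntegrable hr i k, fun x hx => by
    rw [h.zero hr, h.integral_eq x hx]
    rfl⟩

/-- The inverse of a fundamental solution of `Y' = B Y` solves `Z' = -Z B`. -/
lemma IsFundSol.exists_inverse (hr : 0 ≤ r) (hB : IsL2Mat r B) (h : IsFundSol r B Y) :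
    ∃ Z, IsACMat r Z (fun x => -(Z x * B x)) ∧
      ∀ x ∈ Icc 0 r, Z x * Y x = 1 ∧ Y x * Z x = 1 := by
  -- Z is the transpose of the fundamental solution of X' = −BᵀX, which turns left into right
  -- multiplication; then (ZY)' = 0.
  have hB' : IsL2Mat r (fun x => -(B x)ᵀ) := fun i k => (hB k i).neg
  obtain ⟨X, hX⟩ := exists_isFundSol hr hB'
  have hZ := (hX.isACMat hr hB').transpose
  simp only [Matrix.transpose_mul, Matrix.transpose_neg, Matrix.transpose_transpose,
    Matrix.mul_neg] at hZ
  refine ⟨fun x => (X x)ᵀ, hZ, fun x hx => ?_⟩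
  have h1 : (X x)ᵀ * Y x = 1 := by
    refine (hZ.mul hr (h.isACMat hr hB)).eqOn_of_deriv_ae_eq hr (isACMat_const 1) ?_
      (Filter.Eventually.of_forall fun x => ?_) hx
    · simp [hX.zero hr, h.zero hr]
    · simp only [Matrix.neg_mul, Matrix.mul_assoc]
      exact neg_add_cancel _
  exact ⟨h1, mul_eq_one_comm.1 h1⟩

/-- For a skew-Hermitian coefficient, Y*Y has zero derivative. Applied to u, this gives unitarity
because R is self-adjoint. -/
lemma IsFundSol.conjTranspose_mul_self (hr : 0 ≤ r) (hB : IsL2Mat r B) (h : IsFundSol r B Y)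
    (hskew : ∀ x, (B x)ᴴ = -B x) {x : ℝ} (hx : x ∈ Icc 0 r) :
    (Y x)ᴴ * Y x = 1 ∧ Y x * (Y x)ᴴ = 1 := by
  have hY := h.isACMat hr hB
  have h1 : (Y x)ᴴ * Y x = 1 := by
    refine (hY.conjTranspose.mul hr hY).eqOn_of_deriv_ae_eq hr (isACMat_const 1) ?_
      (Filter.Eventually.of_forall fun x => ?_) hx
    · simp [h.zero hr]
    · simp only [Matrix.conjTranspose_mul, hskew, Matrix.mul_neg, Matrix.neg_mul, Matrix.mul_assoc]
      exact neg_add_cancel _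
  exact ⟨h1, mul_eq_one_comm.1 h1⟩

end FundSol

/-! ### The coefficients of the canonical system -/

section Coefficients

variable {m₁ m₂ : ℕ} {r : ℝ} {β β' β'' : ℝ → Matrix (Fin m₂) (Fin m₁ ⊕ Fin m₂) ℂ}
  {u : ℝ → Matrix (Fin m₂) (Fin m₂) ℂ} {Ω : ℝ → Matrix (Fin m₁ ⊕ Fin m₂) (Fin m₁ ⊕ Fin m₂) ℂ}

lemma J_conjTranspose : (J m₁ m₂)ᴴ = J m₁ m₂ := by
  simp [J, Matrix.fromBlocks_conjTranspose]

lemma R_conjTranspose (x : ℝ) : (R β' x)ᴴ = R β' x := by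
  simp [R, Matrix.conjTranspose_mul, J_conjTranspose, Matrix.mul_assoc]

lemma coefU_conjTranspose (x : ℝ) : (coefU β' x)ᴴ = -coefU β' x := by
  rw [coefU, Matrix.conjTranspose_smul, R_conjTranspose, ← neg_smul]
  congr 1
  simp [neg_div]

lemma IsUMat.isACMat_R (hr : 0 ≤ r) (hβ : IsUMat r β β' β'') :
    IsACMat r (R β') (R' β' β'') := by
  have h := hβ.isACMat_deriv hr
  have h1 := (h.mul hr (isACMat_const (J m₁ m₂))).mul hr h.conjTranspose
  simp only [Matrix.mul_zero, add_zero] at h1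
  exact h1

lemma IsUMat.isL2Mat_coefU (hr : 0 ≤ r) (hβ : IsUMat r β β' β'') : IsL2Mat r (coefU β') :=
  ((hβ.isACMat_R hr).isContMat.smul _).isL2Mat

lemma IsUMat.isL2Mat_R' (hr : 0 ≤ r) (hβ : IsUMat r β β' β'') : IsL2Mat r (R' β' β'') := by
  have h := (hβ.isACMat_deriv hr).isContMat
  have hJ := isContMat_const (r := r) (J m₁ m₂)
  exact ((hβ.isL2Mat.mul_isContMat hJ).mul_isContMat h.conjTranspose).add
    ((h.mul hJ).mul_isL2Mat hβ.isL2Mat.conjTranspose)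

lemma IsUMat.isL2Mat_coefΩ (hr : 0 ≤ r) (hβ : IsUMat r β β' β'') : IsL2Mat r (coefΩ β β'') :=
  (((hβ.isACMat hr).isContMat.conjTranspose.mul_isL2Mat hβ.isL2Mat).mul_isContMat
    (isContMat_const _)).smul _

/-- R is absolutely continuous with square integrable derivative R', so u' = (i/2)Ru can be
differentiated once more. -/
lemma isUMat_unitaryFactor (hr : 0 ≤ r) (hβ : IsUMat r β β' β'') (hu : IsFundSol r (coefU β') u) :
    IsUMat r u (fun x => coefU β' x * u x)
      (fun x => (Complex.I / 2) • R' β' β'' x * u x + coefU β' x * (coefU β' x * u x)) := by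
  have h1 := hu.isACMat hr (hβ.isL2Mat_coefU hr)
  have h2 := (hβ.isACMat_R hr).smul (Complex.I / 2)
  refine isUMat_of_isACMat h1 (h2.mul hr h1) ?_
  exact (((hβ.isL2Mat_R' hr).smul _).mul_isContMat hu.isContMat).add
    (h2.isContMat.mul (h2.isContMat.mul hu.isContMat)).isL2Mat

lemma isL2Mat_u₄ (hr : 0 ≤ r) (hβ : IsUMat r β β' β'') (hu : IsContMat r u) :
    IsL2Mat r (u₄ β' β'' u) := by
  have h := (hβ.isACMat_deriv hr).isContMat
  have hJ := isContMat_const (r := r) (J m₁ m₂)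
  have hR := (hβ.isACMat_R hr).isContMat
  exact (hu.conjTranspose.mul_isL2Mat ((((hR.mul hR).smul _).isL2Mat).add
    ((((hβ.isL2Mat.mul_isContMat hJ).mul_isContMat h.conjTranspose).sub
      ((h.mul hJ).mul_isL2Mat hβ.isL2Mat.conjTranspose)).smul _))).mul_isContMat hu

lemma isL2Mat_h₁ (hβ : IsUMat r β β' β'') (hu : IsContMat r u) (hΩ : IsContMat r Ω) :
    IsL2Mat r (h₁ β'' u Ω) :=
  ((((hu.conjTranspose.mul_isL2Mat hβ.isL2Mat).mul_isContMat
    (isContMat_const _))).mul_isContMat hΩ).smul _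

lemma isL2Mat_h₂ (hr : 0 ≤ r) (hβ : IsUMat r β β' β'') (hu : IsContMat r u)
    (hΩ : IsContMat r fun x => (Ω x)⁻¹) : IsL2Mat r (h₂ β β' β'' u Ω) := by
  have h0 := (hβ.isACMat hr).isContMat
  have h1 := (hβ.isACMat_deriv hr).isContMat
  have hJ := isContMat_const (r := r) (J m₁ m₂)
  have hR := (hβ.isACMat_R hr).isContMat
  refine (hΩ.mul_isL2Mat (((hβ.isL2Mat.conjTranspose.add
    ((h1.conjTranspose.mul hR).smul _).isL2Mat).add
    ((h0.conjTranspose.mul_isL2Mat (hβ.isL2Mat_R' hr)).smul _)).sub ?_)).mul_isContMat hu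
  exact (((h0.conjTranspose.mul_isL2Mat hβ.isL2Mat).mul_isContMat hJ).mul_isContMat
    (h1.conjTranspose.add ((h0.conjTranspose.mul hR).smul _))).smul _

/-- Differentiating `β' j β^* = i` gives `β'' j β^* = -R` almost everywhere. -/
lemma ae_second_deriv_mul_eq_neg_R (hr : 0 ≤ r) (hβ : IsUMat r β β' β'')
    (h : ∀ x ∈ Icc (0 : ℝ) r, β' x * J m₁ m₂ * (β x)ᴴ = Complex.I • 1) :
    ∀ᵐ x ∂(volume.restrict (Ioo 0 r)), β'' x * J m₁ m₂ * (β x)ᴴ = -R β' x := by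
  have h1 := ((hβ.isACMat_deriv hr).mul hr (isACMat_const (J m₁ m₂))).mul hr
    (hβ.isACMat hr).conjTranspose
  have h2 := h1.ae_eq_deriv_of_eqOn hr (isACMat_const (Complex.I • 1)) h
  filter_upwards [h2] with x hx
  simp only [Matrix.mul_zero, add_zero] at hx
  exact eq_neg_of_add_eq_zero_left hx

end Coefficients

/-! ### Second primitives -/

/-- The second primitive with vanishing initial data. -/
def secondPrimitive {p q : Type*} (f : ℝ → Matrix p q ℂ) (x : ℝ) : Matrix p q ℂ :=
  matInt 0 x (fun t => matInt 0 t f)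

section SecondPrimitive

variable {p q : Type*} {r : ℝ} {f g G G' G'' : ℝ → Matrix p q ℂ}

lemma isUMat_secondPrimitive (hr : 0 ≤ r) (hf : IsL2Mat r f) :
    IsUMat r (secondPrimitive f) (fun x => matInt 0 x f) f := by
  have h1 := isACMat_primitive (hf.intervalIntegrable hr)
  exact isUMat_of_isACMat
    (isACMat_primitive (h1.isContMat.isL2Mat.intervalIntegrable hr)) h1 hf

lemma secondPrimitive_zero : secondPrimitive f 0 = 0 := by
  ext i k
  simp [secondPrimitive, matInt]

lemma secondPrimitive_neg (x : ℝ) :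
    secondPrimitive (fun t => -f t) x = -secondPrimitive f x := by
  ext i k
  simp [secondPrimitive, matInt]

lemma matInt_self (x : ℝ) : matInt x x f = 0 := by
  ext i k
  simp [matInt]

lemma ae_Icc_of_ae_restrict {P : ℝ → Prop} (h : ∀ᵐ x ∂(volume.restrict (Ioo 0 r)), P x) :
    ∀ᵐ x, x ∈ Icc 0 r → P x := by
  rw [restrict_Ioo_eq_restrict_Icc] at h
  exact (ae_restrict_iff' measurableSet_Icc).1 h

lemma matInt_congr_ae_restrict (h : ∀ᵐ x ∂(volume.restrict (Ioo 0 r)), f x = g x) {x : ℝ}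
    (hx : x ∈ Icc 0 r) : matInt 0 x f = matInt 0 x g := by
  refine matInt_congr_ae hx.1 ?_
  filter_upwards [ae_Icc_of_ae_restrict h] with t ht ht' using ht ⟨ht'.1, ht'.2.trans hx.2⟩

lemma secondPrimitive_congr_ae (h : ∀ᵐ x ∂(volume.restrict (Ioo 0 r)), f x = g x) {x : ℝ}
    (hx : x ∈ Icc 0 r) : secondPrimitive f x = secondPrimitive g x := by
  refine matInt_congr hx.1 fun t ht => ?_
  exact matInt_congr_ae_restrict h ⟨ht.1, ht.2.trans hx.2⟩

lemma matInt_sub_smul_eq (hf : ∀ i k, IntervalIntegrable (fun x => f x i k) volume 0 r) {x : ℝ}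
    (hx : x ∈ Icc 0 r) :
    matInt 0 x (fun τ => ((x - τ : ℝ) : ℂ) • f τ) = secondPrimitive f x := by
  ext i k
  exact (integral_integral_eq_integral_sub_mul hx.1
    (intervalIntegrable_mono (hf i k) (zero_mem_Icc hx) hx)).symm

lemma IsUMat.eq_secondPrimitive (hr : 0 ≤ r) (h : IsUMat r G G' G'') {x : ℝ} (hx : x ∈ Icc 0 r) :
    G x = G 0 + matInt 0 x (fun τ => ((x - τ : ℝ) : ℂ) • G'' τ) + (x : ℂ) • G' 0 := by
  have h1 : ∀ t ∈ Icc (0 : ℝ) x, G' t = G' 0 + matInt 0 t G'' := fun t ht => by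
    ext i k
    exact (h.isACMat_deriv hr i k).2 t ⟨ht.1, ht.2.trans hx.2⟩
  have h2 : G x = G 0 + matInt 0 x G' := by
    ext i k
    exact (h.isACMat hr i k).2 x hx
  have h3 := isUMat_secondPrimitive hr h.isL2Mat
  rw [matInt_sub_smul_eq (h.isL2Mat.intervalIntegrable hr) hx, h2, matInt_congr hx.1 h1,
    matInt_add (G := fun _ => G' 0) (fun i k => intervalIntegrable_const) fun i k =>
      intervalIntegrable_mono (h3.isACMat hr i k).1 (zero_mem_Icc hx) hx]
  have h4 : matInt 0 x (fun _ => G' 0) = (x : ℂ) • G' 0 := by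
    ext i k
    simp [matInt]
  rw [h4, secondPrimitive]
  abel

lemma IsUMat.eq_secondPrimitive_of_zero (hr : 0 ≤ r) (h : IsUMat r G G' G'') (h0 : G 0 = 0)
    (h1 : G' 0 = 0) {x : ℝ} (hx : x ∈ Icc 0 r) : G x = secondPrimitive G'' x := by
  rw [h.eq_secondPrimitive hr hx, matInt_sub_smul_eq (h.isL2Mat.intervalIntegrable hr) hx, h0, h1]
  simp

lemma secondPrimitive_add (hr : 0 ≤ r) (hf : IsL2Mat r f) (hg : IsL2Mat r g) {x : ℝ}
    (hx : x ∈ Icc 0 r) :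
    secondPrimitive (fun s => f s + g s) x = secondPrimitive f x + secondPrimitive g x := by
  have h := (isUMat_secondPrimitive hr hf).add hr (isUMat_secondPrimitive hr hg)
  exact (h.eq_secondPrimitive_of_zero hr (by simp [secondPrimitive_zero])
    (by simp [matInt_self]) hx).symm

end SecondPrimitive

/-! ### The operator with kernel `𝒱` on functions -/

section Kernel

variable {m : Type*} [Fintype m] {n : ℕ} {q : Type*} [Fintype q] {r : ℝ}
  {v : ℝ → Matrix (Fin n) (Fin n) ℂ} {a : ℝ → Matrix (Fin n) m ℂ}
  {b : ℝ → Matrix m (Fin n) ℂ} {W : ℝ → ℝ → Matrix (Fin n) (Fin n) ℂ} {B : ℝ}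

lemma IsBddFun.isL2Mat {p q : Type*} {g : ℝ → Matrix p q ℂ} {G : ℝ} (hg : IsBddFun r g G) :
    IsL2Mat r g := fun i k => by
  refine MemLp.of_bound (hg.measurable i k).aestronglyMeasurable G ?_
  filter_upwards [ae_restrict_mem measurableSet_Ioo] with x hx
  exact hg.bound x (Ioo_subset_Icc_self hx) i k

omit [Fintype q] in
lemma IsL2Mat.mul_isBddFun {p m : Type*} [Fintype p] [Fintype m] {v : ℝ → Matrix p m ℂ}
    (hv : IsL2Mat r v) (hvc : IsCoef r v) {g : ℝ → Matrix m q ℂ} {G : ℝ} (hg : IsBddFun r g G) :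
    IsL2Mat r (fun x => v x * g x) := fun i k => by
  refine MemLp.of_le_mul (c := G) (memLp_entrySum hv)
    (measurable_mul_entry hvc.measurable hg.measurable i k).aestronglyMeasurable ?_
  filter_upwards [ae_restrict_mem measurableSet_Ioo] with x hx
  rw [Real.norm_of_nonneg (entrySum_nonneg _), mul_comm]
  exact norm_mul_entry_le _ _ _ _ fun j => hg.bound x (Ioo_subset_Icc_self hx) _ _

/-- Bounded kernels on the triangle that satisfy the integral equation of the kernel series. -/
structure IsSeriesKernel (r : ℝ) (v : ℝ → Matrix (Fin n) (Fin n) ℂ) (a : ℝ → Matrix (Fin n) m ℂ)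
    (b : ℝ → Matrix m (Fin n) ℂ) (W : ℝ → ℝ → Matrix (Fin n) (Fin n) ℂ) (B : ℝ) : Prop where
  coef_v : IsCoef r v
  coef_a : IsCoef r a
  coef_b : IsCoef r b
  memLp_v : IsL2Mat r v
  memLp_a : IsL2Mat r a
  isBddKer : IsBddKer r W B
  fixedPoint : ∀ x ζ, 0 ≤ ζ → ζ ≤ x → x ≤ r → ∀ i k, W x ζ i k
    = dAlembert (fun t η => fullPhi v a b W t η i k) x ζ

/-- W solves the integral equation for Borel representatives, yet it is the sum of the series formed
with the given coefficients, since the terms agree on the triangle. -/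
lemma exists_isSeriesKernel (hr : 0 ≤ r) (hv : IsL2Mat r v) (ha : IsL2Mat r a)
    (hb : IsL2Mat r b) : ∃ v' a' b' W B, IsSeriesKernel r v' a' b' W B ∧
      (∀ᵐ x ∂(volume.restrict (Ioo 0 r)), v x = v' x ∧ a x = a' x ∧ b x = b' x) ∧
      ∀ x ζ, 0 ≤ ζ → ζ ≤ x → x ≤ r → HasSum (fun N => kernelTerm v a b N x ζ) (W x ζ) := by
  obtain ⟨v', hv1, hv2, hv3⟩ := exists_isCoef_of_isL2Mat hr hv
  obtain ⟨a', ha1, ha2, ha3⟩ := exists_isCoef_of_isL2Mat hr ha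
  obtain ⟨b', hb1, hb2, hb3⟩ := exists_isCoef_of_isL2Mat hr hb
  obtain ⟨W, B, hW, hsum, hfix⟩ := exists_kernelSum hr hv1 ha1 hb1
  refine ⟨v', a', b', W, B, ⟨hv1, ha1, hb1, hv2, ha2, hW, hfix⟩, ?_, fun x ζ h0 h1 h2 => ?_⟩
  · filter_upwards [hv3, ha3, hb3] with x h1 h2 h3 using ⟨h1, h2, h3⟩
  · have := hsum x ζ h0 h1 h2
    simp only [← kernelTerm_congr (ae_Icc_of_ae_restrict hv3) (ae_Icc_of_ae_restrict ha3)
      (ae_Icc_of_ae_restrict hb3) _ x ζ h0 h1 h2] at this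
    exact this

omit [Fintype q] in
lemma kerApp_congr_ae {g h : ℝ → Matrix (Fin n) q ℂ}
    (hgh : ∀ᵐ x ∂(volume.restrict (Ioo 0 r)), g x = h x) {x : ℝ} (hx : x ∈ Icc 0 r) :
    kerApp W g x = kerApp W h x :=
  matInt_congr_ae_restrict (r := r) (by filter_upwards [hgh] with t ht using by rw [ht]) hx

lemma IsBddKer.intervalIntegrable_mul (hW : IsBddKer r W B) {g : ℝ → Matrix (Fin n) q ℂ}
    (hg : IsCoef r g) {x : ℝ} (hx : x ∈ Icc 0 r) (i : Fin n) (k : q) :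
    IntervalIntegrable (fun t => (W x t * g t) i k) volume 0 x := by
  have hi : IntervalIntegrable (fun s => entrySum (g s)) volume 0 x :=
    intervalIntegrable_mono hg.intervalIntegrable_entrySum (zero_mem_Icc hx) hx
  refine intervalIntegrable_of_norm_le hx.1 (measurable_mul_entry
    (fun i k => (hW.measurable i k).comp measurable_prodMk_left) hg.measurable i k)
    (hi.const_mul (n * (n * B))) fun t ht => ?_
  refine (norm_mul_entry_le _ _ _ _ fun j => norm_entry_le_entrySum (g t) j k).trans ?_
  exact mul_le_mul_of_nonneg_right (hW.entrySum_le ht.1 ht.2 hx.2) (entrySum_nonneg _)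

lemma IsBddKer.kerApp_add (hW : IsBddKer r W B) {g h : ℝ → Matrix (Fin n) q ℂ}
    (hg : IsCoef r g) (hh : IsCoef r h) {x : ℝ} (hx : x ∈ Icc 0 r) :
    kerApp W (fun t => g t + h t) x = kerApp W g x + kerApp W h x := by
  simp only [kerApp, Matrix.mul_add]
  exact matInt_add (hW.intervalIntegrable_mul hg hx) (hW.intervalIntegrable_mul hh hx)

omit [Fintype q] in
lemma kerApp_neg {g : ℝ → Matrix (Fin n) q ℂ} (x : ℝ) :
    kerApp W (fun t => -g t) x = -kerApp W g x := by
  ext i k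
  simp [kerApp, matInt]

variable (hr : 0 ≤ r) (hK : IsSeriesKernel r v a b W B)

include hr hK in
omit [Fintype q] in
lemma IsSeriesKernel.isL2Mat_potTerm {z : ℝ → Matrix (Fin n) q ℂ} {Z : ℝ} (hz : IsBddFun r z Z) :
    IsL2Mat r (potTerm v a b z) := by
  obtain ⟨Z', h1⟩ := hK.coef_b.matInt_mul_isBddFun hz hr
  exact (hK.memLp_v.mul_isBddFun hK.coef_v hz).sub (hK.memLp_a.mul_isBddFun hK.coef_a h1)

include hr hK in
/-- The operator with kernel `𝒱` maps `𝒰` to second primitives. -/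
lemma IsSeriesKernel.exists_kerApp_eq {G G' G'' : ℝ → Matrix (Fin n) q ℂ}
    (hG : IsUMat r G G' G'') :
    ∃ P, IsL2Mat r P ∧ ∀ x ∈ Icc 0 r, kerApp W G x = secondPrimitive P x := by
  obtain ⟨f, hf, hf2, hf3⟩ := exists_isCoef_of_isL2Mat hr hG.isL2Mat
  -- The linear part gb is treated separately: the even extension of ga has zero derivative at 0,
  -- whereas that of gb has a kink, which contributes W(s,0)G'(0).
  set ga : ℝ → Matrix (Fin n) q ℂ := fun x =>
    G 0 + matInt 0 x (fun τ => ((x - τ : ℝ) : ℂ) • f τ)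
  set gb : ℝ → Matrix (Fin n) q ℂ := fun x => (x : ℂ) • G' 0
  obtain ⟨Za, hga⟩ := isBddFun_second_primitive hr hf (G 0)
  have hgb : IsBddFun r gb (r * entrySum (G' 0)) :=
    ⟨fun i k => Complex.measurable_ofReal.mul_const _, fun x hx i k => by
      simp only [gb, Matrix.smul_apply, norm_smul, Complex.norm_real, Real.norm_of_nonneg hx.1]
      exact mul_le_mul hx.2 (norm_entry_le_entrySum _ _ _) (norm_nonneg _) hr⟩
  obtain ⟨Za', hza⟩ := hga.add_kerApp hr hK.isBddKer
  obtain ⟨Zb', hzb⟩ := hgb.add_kerApp hr hK.isBddKer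
  obtain ⟨F, hF⟩ := hK.isBddKer.kerApp_isBddFun hf hr
  have hW0 : IsBddFun r (fun s => W s 0 * G' 0) ((n * (n * B)) * entrySum (G' 0)) :=
    ⟨fun i k => measurable_mul_entry (M := fun s => W s 0) (N := fun _ => G' 0)
      (fun i k => (hK.isBddKer.measurable i k).comp (measurable_prodMk_right (y := (0 : ℝ))))
      (fun i k => measurable_const) i k, fun x hx i k => by
      refine (norm_mul_entry_le _ _ _ _ fun j => norm_entry_le_entrySum (G' 0) j k).trans ?_
      exact mul_le_mul_of_nonneg_right (hK.isBddKer.entrySum_le le_rfl hx.1 hx.2)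
        (entrySum_nonneg _)⟩
  have hPa := (hK.isL2Mat_potTerm hr hza).add hF.isL2Mat
  have hPb := (hK.isL2Mat_potTerm hr hzb).add hW0.isL2Mat
  refine ⟨_, hPa.add hPb, fun x hx => ?_⟩
  have h1 : kerApp W G x = kerApp W (fun t => ga t + gb t) x := by
    refine matInt_congr hx.1 fun t ht => ?_
    have ht' : t ∈ Icc 0 r := ⟨ht.1, ht.2.trans hx.2⟩
    have h2 : matInt 0 t (fun τ => ((t - τ : ℝ) : ℂ) • G'' τ)
        = matInt 0 t (fun τ => ((t - τ : ℝ) : ℂ) • f τ) := matInt_congr_ae_restrict (r := r)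
      (by filter_upwards [hf3] with s hs using by rw [hs]) ht'
    rw [hG.eq_secondPrimitive hr ht', h2]
  rw [h1, hK.isBddKer.kerApp_add (hga.isCoef hr) (hgb.isCoef hr) hx,
    secondPrimitive_add hr hPa hPb hx,
    kerApp_second_primitive hr hK.coef_v hK.coef_a hK.coef_b hK.isBddKer hK.fixedPoint hf (G 0)
      (fun _ => rfl) hx.1 hx.2,
    kerApp_linear hr hK.coef_v hK.coef_a hK.coef_b hK.isBddKer hK.fixedPoint (G' 0)
      (fun _ => rfl) hx.1 hx.2]
  rfl

include hr hK in
/-- With `g = -∬ φ`, the function `z = g + 𝒱 g` satisfies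
`z'' = v z - a ∫ b z - (φ + 𝒱 φ)`. -/
lemma IsSeriesKernel.exists_intertwining {φ : ℝ → Matrix (Fin n) q ℂ} (hφ : IsCoef r φ)
    (hφ2 : IsL2Mat r φ) {g : ℝ → Matrix (Fin n) q ℂ}
    (hg : ∀ x ∈ Icc 0 r, g x = -secondPrimitive φ x) :
    IsUMat r (fun x => g x + kerApp W g x)
      (fun x => matInt 0 x (fun s => potTerm v a b (fun x => g x + kerApp W g x) s
        - (φ s + kerApp W φ s)))
      (fun s => potTerm v a b (fun x => g x + kerApp W g x) s - (φ s + kerApp W φ s)) ∧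
    g 0 + kerApp W g 0 = 0 := by
  have hf : IsCoef r (fun x => -φ x) :=
    ⟨fun i k => (hφ.measurable i k).neg, fun i k => (hφ.intervalIntegrable i k).neg⟩
  have hf2 : IsL2Mat r (fun x => -φ x) := fun i k => (hφ2 i k).neg
  set ga : ℝ → Matrix (Fin n) q ℂ := fun x =>
    0 + matInt 0 x (fun τ => ((x - τ : ℝ) : ℂ) • -φ τ)
  obtain ⟨Za, hga⟩ := isBddFun_second_primitive hr hf 0
  obtain ⟨Za', hza⟩ := hga.add_kerApp hr hK.isBddKer
  obtain ⟨F, hF⟩ := hK.isBddKer.kerApp_isBddFun hf hr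
  -- g is given as a second primitive on [0,r] only, while `kerApp_second_primitive` needs the
  -- formula on the whole line; ga is that global version.
  have hga1 : ∀ x ∈ Icc 0 r, ga x = secondPrimitive (fun x => -φ x) x := fun x hx => by
    simp only [ga, zero_add]
    exact matInt_sub_smul_eq (hf2.intervalIntegrable hr) hx
  have hga2 : ∀ x ∈ Icc 0 r, g x = ga x := fun x hx => by
    rw [hg x hx, hga1 x hx, secondPrimitive_neg]
  have hker : ∀ x ∈ Icc 0 r, kerApp W g x = kerApp W ga x := fun x hx =>
    matInt_congr hx.1 fun t ht => by rw [hga2 t ⟨ht.1, ht.2.trans hx.2⟩]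
  have hpot : ∀ x ∈ Icc 0 r, potTerm v a b (fun x => g x + kerApp W g x) x
      = potTerm v a b (fun x => ga x + kerApp W ga x) x := fun x hx => by
    simp only [potTerm]
    rw [hga2 x hx, hker x hx, matInt_congr hx.1 fun t ht => by
      rw [hga2 t ⟨ht.1, ht.2.trans hx.2⟩, hker t ⟨ht.1, ht.2.trans hx.2⟩]]
  set P : ℝ → Matrix (Fin n) q ℂ := fun s =>
    potTerm v a b (fun x => g x + kerApp W g x) s - (φ s + kerApp W φ s) with hPdef
  have hP1 : IsL2Mat r (fun s => potTerm v a b (fun x => ga x + kerApp W ga x) s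
      + kerApp W (fun x => -φ x) s) := (hK.isL2Mat_potTerm hr hza).add hF.isL2Mat
  have hPeq : ∀ x ∈ Icc 0 r, -φ x + (potTerm v a b (fun x => ga x + kerApp W ga x) x
      + kerApp W (fun x => -φ x) x) = P x := fun x hx => by
    simp only [hPdef]
    rw [hpot x hx, kerApp_neg]
    abel
  have hPae : ∀ᵐ x ∂(volume.restrict (Ioo 0 r)), -φ x + (potTerm v a b
      (fun x => ga x + kerApp W ga x) x + kerApp W (fun x => -φ x) x) = P x := by
    filter_upwards [ae_restrict_mem measurableSet_Ioo] with x hx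
    exact hPeq x (Ioo_subset_Icc_self hx)
  have hP : IsL2Mat r P := (hf2.add hP1).congr hPae
  have hz : ∀ x ∈ Icc 0 r, g x + kerApp W g x = secondPrimitive P x := fun x hx => by
    rw [← secondPrimitive_congr_ae hPae hx, secondPrimitive_add hr hf2 hP1 hx, ← hga1 x hx,
      hga2 x hx, hker x hx, kerApp_second_primitive hr hK.coef_v hK.coef_a hK.coef_b hK.isBddKer
        hK.fixedPoint hf 0 (fun _ => rfl) hx.1 hx.2]
    rfl
  have hU := isUMat_secondPrimitive hr hP
  refine ⟨isUMat_of_isACMat ((hU.isACMat hr).congr hr hz (Filter.Eventually.of_forall fun _ => rfl))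
    (hU.isACMat_deriv hr) hP, ?_⟩
  rw [hz 0 ⟨le_rfl, hr⟩, secondPrimitive_zero]

end Kernel

/-! ### The differential equation behind the similarity -/

section Algebra

variable {k m q : Type*} [Fintype k] [DecidableEq k] [Fintype m]

/-- The second derivative of `y = u z`, expressed through `y`, `y'` and the data. -/
lemma second_deriv_unitary_mul {U Us R P Q : Matrix k k ℂ} {Z Z₁ Z₂ S p : Matrix k q ℂ}
    (hU : U * Us = 1)
    (hZ : Z₂ = Us * ((3 / 4 : ℂ) • (R * R) + (Complex.I / 2) • (P - Q)) * U * Z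
      - Complex.I • (Us * S) - p) :
    ((Complex.I / 2) • (P + Q) * U + (Complex.I / 2) • R * ((Complex.I / 2) • R * U)) * Z
        + (Complex.I / 2) • R * U * Z₁ + ((Complex.I / 2) • R * U * Z₁ + U * Z₂)
      = Complex.I • (R * ((Complex.I / 2) • R * U * Z + U * Z₁))
        + Complex.I • ((P - Complex.I • (R * R)) * (U * Z)) - Complex.I • S - U * p := by
  have h : ∀ A : Matrix k q ℂ, U * (Us * A) = A := fun A => by
    rw [← Matrix.mul_assoc, hU, Matrix.one_mul]
  have hI : Complex.I ^ 2 = -1 := Complex.I_sq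
  subst hZ
  simp only [Matrix.mul_add, Matrix.add_mul, Matrix.mul_sub, Matrix.sub_mul, Matrix.mul_assoc,
    Matrix.smul_mul, Matrix.mul_smul, h, smul_add, smul_sub, smul_smul]
  -- The coefficient of R² is the only one needing i² = −1. It equals −1/4 + 3/4 on the left and
  -- −1/2 + 1 on the right, which is the origin of the constant 3/4 in u₄.
  match_scalars <;> first | ring1 | linear_combination (3 / 4 : ℂ) * hI

end Algebra

section Similarity

variable {m₁ m₂ : ℕ} {r : ℝ} {β β' β'' : ℝ → Matrix (Fin m₂) (Fin m₁ ⊕ Fin m₂) ℂ}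
  {u : ℝ → Matrix (Fin m₂) (Fin m₂) ℂ} {Ω : ℝ → Matrix (Fin m₁ ⊕ Fin m₂) (Fin m₁ ⊕ Fin m₂) ℂ}
  {q : Type*} {z z' z'' p : ℝ → Matrix (Fin m₂) q ℂ}

lemma mul_h₂_mul {x : ℝ} (hΩ : Ω x * (Ω x)⁻¹ = 1) (Z : Matrix (Fin m₂) q ℂ) :
    Ω x * (h₂ β β' β'' u Ω x * Z) = ((β'' x)ᴴ + Complex.I • ((β' x)ᴴ * R β' x)
      + Complex.I • ((β x)ᴴ * R' β' β'' x) - Complex.I • ((β x)ᴴ * β'' x * J m₁ m₂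
        * ((β' x)ᴴ + Complex.I • ((β x)ᴴ * R β' x)))) * (u x * Z) := by
  rw [h₂, ← Matrix.mul_assoc, ← Matrix.mul_assoc, ← Matrix.mul_assoc, hΩ, Matrix.one_mul,
    Matrix.mul_assoc]

/-- If `z'' = u₄ z - h₁ ∫ h₂ z - p` with vanishing initial data, then `y = u z` is the image of
`u p` under the operator `K`. -/
theorem opK_eq_unitary_mul (hr : 0 ≤ r) (hβ : IsUMat r β β' β'')
    (hβ₁ : ∀ x ∈ Icc (0 : ℝ) r, β x * J m₁ m₂ * (β x)ᴴ = 0)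
    (hβ₂ : ∀ x ∈ Icc (0 : ℝ) r, β' x * J m₁ m₂ * (β x)ᴴ = Complex.I • 1)
    (hu : IsFundSol r (coefU β') u) (hΩ : IsFundSol r (coefΩ β β'') Ω)
    (hΩi : ∀ x ∈ Icc 0 r, Ω x * (Ω x)⁻¹ = 1) (hΩc : IsContMat r fun x => (Ω x)⁻¹)
    (hz : IsUMat r z z' z'') (hz0 : z 0 = 0) (hz0' : z' 0 = 0) (hp : IsL2Mat r p)
    (heq : ∀ᵐ x ∂(volume.restrict (Ioo 0 r)), z'' x = u₄ β' β'' u x * z x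
      - h₁ β'' u Ω x * matInt 0 x (fun ξ => h₂ β β' β'' u Ω ξ * z ξ) - p x)
    {x : ℝ} (hx : x ∈ Icc 0 r) :
    Complex.I • (β x * J m₁ m₂) * matInt 0 x (fun t => (β t)ᴴ * (u t * p t)) = u x * z x := by
  have hb0 := hβ.isACMat hr
  have hb1 := hβ.isACMat_deriv hr
  have hR := hβ.isACMat_R hr
  have huU := isUMat_unitaryFactor hr hβ hu
  have hyU := huU.mul hr hz
  have hy := hyU.isACMat hr
  have hy1 := hyU.isACMat_deriv hr
  have hh2 : IsL2Mat r (fun ξ => h₂ β β' β'' u Ω ξ * z ξ) :=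
    (isL2Mat_h₂ hr hβ hu.isContMat hΩc).mul_isContMat (hz.isACMat hr).isContMat
  have hc := isACMat_primitive (hh2.intervalIntegrable hr)
  have hΩA := hΩ.isACMat hr (hβ.isL2Mat_coefΩ hr)
  have hq : IsL2Mat r (fun t => (β t)ᴴ * (u t * p t)) :=
    hb0.isContMat.conjTranspose.mul_isL2Mat (hu.isContMat.mul_isL2Mat hp)
  have hw := isACMat_primitive (hq.intervalIntegrable hr)
  set c : ℝ → Matrix (Fin m₁ ⊕ Fin m₂) q ℂ := fun x =>
    matInt 0 x (fun ξ => h₂ β β' β'' u Ω ξ * z ξ) with hcdef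
  set w : ℝ → Matrix (Fin m₁ ⊕ Fin m₂) q ℂ := fun x =>
    matInt 0 x (fun t => (β t)ᴴ * (u t * p t)) with hwdef
  have hu0 : u 0 = 1 := hu.zero hr
  have hw0 : w 0 = 0 := matInt_self 0
  have hc0 : c 0 = 0 := matInt_self 0
  set y₁ : ℝ → Matrix (Fin m₂) q ℂ := fun x => coefU β' x * u x * z x + u x * z' x with hy₁
  set y₂ : ℝ → Matrix (Fin m₂) q ℂ := fun x =>
    (((Complex.I / 2) • R' β' β'' x * u x + coefU β' x * (coefU β' x * u x)) * z x
      + coefU β' x * u x * z' x) + (coefU β' x * u x * z' x + u x * z'' x) with hy₂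
  have hy10 : y₁ 0 = 0 := by simp [hy₁, hz0, hz0']
  -- The equation for z, rewritten for y = uz. The factor iβ''jβ'* + R² is recognized as iβ''j(β'* +
  -- iβ*R), by means of β''jβ* = −R.
  have hbr : ∀ᵐ x ∂(volume.restrict (Ioo 0 r)), y₂ x = Complex.I • (R β' x * y₁ x)
      + Complex.I • (β'' x * J m₁ m₂ * (((β' x)ᴴ + Complex.I • ((β x)ᴴ * R β' x)) * (u x * z x)))
      - Complex.I • (β'' x * J m₁ m₂ * (Ω x * c x)) - u x * p x := by
    filter_upwards [heq, ae_second_deriv_mul_eq_neg_R hr hβ hβ₂, ae_restrict_mem measurableSet_Ioo]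
      with x h1 h2 hx
    have h3 := (hu.conjTranspose_mul_self hr (hβ.isL2Mat_coefU hr) coefU_conjTranspose
      (Ioo_subset_Icc_self hx)).2
    have h4 := second_deriv_unitary_mul (R := R β' x) (P := β'' x * J m₁ m₂ * (β' x)ᴴ)
      (Q := β' x * J m₁ m₂ * (β'' x)ᴴ) (Z := z x) (Z₁ := z' x) (Z₂ := z'' x)
      (S := β'' x * J m₁ m₂ * (Ω x * c x)) (p := p x) h3 (by
        rw [h1, u₄, h₁]
        simp only [Matrix.smul_mul, Matrix.mul_assoc, hcdef])
    have h5 : β'' x * J m₁ m₂ * (((β' x)ᴴ + Complex.I • ((β x)ᴴ * R β' x)) * (u x * z x))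
        = (β'' x * J m₁ m₂ * (β' x)ᴴ - Complex.I • (R β' x * R β' x)) * (u x * z x) := by
      rw [← Matrix.mul_assoc _ _ (u x * z x), Matrix.mul_add, Matrix.mul_smul,
        ← Matrix.mul_assoc _ _ (R β' x), h2, Matrix.neg_mul, smul_neg, ← sub_eq_add_neg]
    rw [h5]
    exact h4
  -- The combination β*y' − (β'* + iβ*R)y + Ωc has derivative −β*up. Indeed Ω' = iβ*β''jΩ cancels
  -- the integral term of β*y'', and h₂ is chosen so that Ωh₂z cancels what remains in y. Hence the
  -- combination equals −w.
  have he : IsACMat r (fun x => (β x)ᴴ * y₁ x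
      - ((β' x)ᴴ + Complex.I • ((β x)ᴴ * R β' x)) * (u x * z x) + Ω x * c x) _ :=
    ((hb0.conjTranspose.mul hr hy1).sub ((hb1.conjTranspose.add
      ((hb0.conjTranspose.mul hr hR).smul Complex.I)).mul hr hy)).add (hΩA.mul hr hc)
  have hew : ∀ x ∈ Icc 0 r, (β x)ᴴ * y₁ x
      - ((β' x)ᴴ + Complex.I • ((β x)ᴴ * R β' x)) * (u x * z x) + Ω x * c x = (-1 : ℂ) • w x := by
    refine he.eqOn_of_deriv_ae_eq hr (hw.smul (-1)) ?_ ?_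
    · simp [hy10, hz0, hc0, hw0]
    · filter_upwards [hbr, ae_restrict_mem measurableSet_Ioo] with x h1 hx
      have h2 := mul_h₂_mul (β := β) (β' := β') (β'' := β'') (u := u)
        (hΩi x (Ioo_subset_Icc_self hx)) (z x)
      change (β' x)ᴴ * y₁ x + (β x)ᴴ * y₂ x - (((β'' x)ᴴ + Complex.I • ((β' x)ᴴ * R β' x
        + (β x)ᴴ * R' β' β'' x)) * (u x * z x) + ((β' x)ᴴ + Complex.I • ((β x)ᴴ * R β' x)) * y₁ x)
        + (coefΩ β β'' x * Ω x * c x + Ω x * (h₂ β β' β'' u Ω x * z x)) = _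
      rw [h1, h2, coefΩ]
      simp only [Matrix.mul_add, Matrix.add_mul, Matrix.mul_sub, Matrix.sub_mul, Matrix.mul_assoc,
        Matrix.smul_mul, Matrix.mul_smul, smul_add, smul_smul]
      module
  -- Inserting the expression for w into iβ''jw recovers y'' + up, and −up equals iβ'jβ*up. So y''
  -- is the derivative of iβ'jw.
  have hd1 : ∀ᵐ x ∂(volume.restrict (Ioo 0 r)), y₂ x
      = Complex.I • (β'' x * J m₁ m₂) * w x
        + Complex.I • (β' x * J m₁ m₂) * ((β x)ᴴ * (u x * p x)) := by
    filter_upwards [hbr, ae_second_deriv_mul_eq_neg_R hr hβ hβ₂, ae_restrict_mem measurableSet_Ioo]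
      with x h1 h2 hx
    have hx' := Ioo_subset_Icc_self hx
    have h3 : w x = -((β x)ᴴ * y₁ x
      - ((β' x)ᴴ + Complex.I • ((β x)ᴴ * R β' x)) * (u x * z x) + Ω x * c x) := by
      rw [hew x hx', neg_smul, one_smul, neg_neg]
    have h4 : ∀ A : Matrix (Fin m₂) q ℂ, β'' x * (J m₁ m₂ * ((β x)ᴴ * A)) = -(R β' x * A) :=
      fun A => by rw [← Matrix.mul_assoc, ← Matrix.mul_assoc, h2, Matrix.neg_mul]
    have h5 : ∀ A : Matrix (Fin m₂) q ℂ, β' x * (J m₁ m₂ * ((β x)ᴴ * A)) = Complex.I • A :=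
      fun A => by rw [← Matrix.mul_assoc, ← Matrix.mul_assoc, hβ₂ x hx', Matrix.smul_mul,
        Matrix.one_mul]
    have hI : Complex.I * Complex.I = -1 := Complex.I_mul_I
    rw [h1, h3]
    simp only [Matrix.mul_add, Matrix.add_mul, Matrix.mul_sub, Matrix.mul_assoc, Matrix.mul_neg,
      Matrix.smul_mul, Matrix.mul_smul, smul_add, smul_smul, smul_neg, h4, h5, hI]
    module
  have hJ0 := (hb0.mul hr (isACMat_const (J m₁ m₂))).smul Complex.I
  have hJ1 := (hb1.mul hr (isACMat_const (J m₁ m₂))).smul Complex.I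
  simp only [Matrix.mul_zero, add_zero] at hJ0 hJ1
  -- Two integrations with zero data: first y' = iβ'jw, then y = iβjw, where βjβ* = 0 removes the
  -- term that contains w'.
  have hL1 := (hJ1.mul hr hw).eqOn_of_deriv_ae_eq hr hy1 (by
    simp only [hw0, hy10, Matrix.mul_zero]) (by
    filter_upwards [hd1] with x h1 using h1.symm)
  refine (hJ0.mul hr hw).eqOn_of_deriv_ae_eq hr hy (by
    simp only [hw0, hz0, Matrix.mul_zero]) ?_ hx
  filter_upwards [ae_restrict_mem measurableSet_Ioo] with x hx
  have hx' := Ioo_subset_Icc_self hx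
  have h1 := hL1 hx'
  have h2 : Complex.I • (β x * J m₁ m₂) * ((β x)ᴴ * (u x * p x)) = 0 := by
    rw [Matrix.smul_mul, ← Matrix.mul_assoc, hβ₁ x hx', Matrix.zero_mul, smul_zero]
  rw [h2, add_zero]
  exact h1

end Similarity

/-! ### Operators in `L₂` described through column functions -/

section ColFun

variable {n : ℕ} {r : ℝ}

lemma ext_of_colFun {f g : L2 n r}
    (h : ∀ᵐ x ∂(volume.restrict (Ioo (0 : ℝ) r)), colFun f x = colFun g x) : f = g := by
  refine Lp.ext ?_
  filter_upwards [h] with x hx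
  ext i
  exact congrFun (congrFun hx i) ()

lemma exists_colFun_eq {G : ℝ → Matrix (Fin n) Unit ℂ} (hG : IsL2Mat r G) :
    ∃ f : L2 n r, ∀ᵐ x ∂(volume.restrict (Ioo (0 : ℝ) r)), colFun f x = G x := by
  have h : MemLp (fun x => WithLp.toLp 2 fun i => G x i ()) 2
      (volume.restrict (Ioo (0 : ℝ) r)) := MemLp.of_eval_piLp fun i => hG i ()
  refine ⟨h.toLp _, ?_⟩
  filter_upwards [h.coeFn_toLp] with x hx
  ext i j
  simp only [colFun, hx, Matrix.of_apply]

lemma isCoef_colFun (hr : 0 ≤ r) (f : L2 n r) : IsCoef r (colFun f) :=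
  ⟨fun i _ => (EuclideanSpace.proj (𝕜 := ℂ) i).continuous.measurable.comp
    (Lp.stronglyMeasurable f).measurable, (isL2Mat_colFun f).intervalIntegrable hr⟩

lemma memU_iff {F : L2 n r} : MemU F ↔ ∃ G G' G'' : ℝ → Matrix (Fin n) Unit ℂ,
    IsUMat r G G' G'' ∧ ∀ᵐ x ∂(volume.restrict (Ioo (0 : ℝ) r)), colFun F x = G x := by
  constructor
  · rintro ⟨f, hf, hF⟩
    choose g' g'' hg using hf
    refine ⟨colFun f, fun x => Matrix.of fun i _ => g' i x, fun x => Matrix.of fun i _ => g'' i x,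
      fun i _ => hg i, ?_⟩
    filter_upwards [hF] with x hx
    ext i j
    simp only [colFun, hx]
  · rintro ⟨G, G', G'', hG, hF⟩
    refine ⟨fun x => WithLp.toLp 2 fun i => G x i (), fun i =>
      ⟨fun x => G' x i (), fun x => G'' x i (), hG i ()⟩, ?_⟩
    filter_upwards [hF] with x hx
    ext i
    exact congrFun (congrFun hx i) ()

lemma MemU.add (hr : 0 ≤ r) {F G : L2 n r} (hF : MemU F) (hG : MemU G) : MemU (F + G) := by
  obtain ⟨f, f', f'', h1, h2⟩ := memU_iff.1 hF
  obtain ⟨g, g', g'', h3, h4⟩ := memU_iff.1 hG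
  refine memU_iff.2 ⟨_, _, _, h1.add hr h3, ?_⟩
  filter_upwards [colFun_add_apply_eq (f := F) (g := G), h2, h4] with x h5 h6 h7
  rw [h5, h6, h7]

/-- Multiplication by a continuous matrix function. -/
lemma exists_mulOperator {F : ℝ → Matrix (Fin n) (Fin n) ℂ} (hF : IsContMat r F) :
    ∃ M : L2 n r →L[ℂ] L2 n r, ∀ f, ∀ᵐ x ∂(volume.restrict (Ioo (0 : ℝ) r)),
      colFun (M f) x = F x * colFun f x := by
  have hc : ContinuousOn (fun x => Matrix.toEuclideanCLM (n := Fin n) (𝕜 := ℂ) (F x))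
      (Icc 0 r) := by
    simp only [toEuclideanCLM_eq_sum (F _)]
    exact continuousOn_finsetSum _ fun i _ => continuousOn_finsetSum _ fun j _ =>
      (hF i j).smul continuousOn_const
  obtain ⟨C, hC⟩ := isCompact_Icc.exists_bound_of_continuousOn hc
  have hm : MemLp (fun x => Matrix.toEuclideanCLM (n := Fin n) (𝕜 := ℂ) (F x)) ⊤
      (volume.restrict (Ioo (0 : ℝ) r)) := by
    refine memLp_top_of_bound
      ((hc.mono Ioo_subset_Icc_self).aestronglyMeasurable measurableSet_Ioo) C ?_
    filter_upwards [ae_restrict_mem measurableSet_Ioo] with x hx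
    exact hC x (Ioo_subset_Icc_self hx)
  refine ⟨(ContinuousLinearMap.id ℂ (EuclideanSpace ℂ (Fin n) →L[ℂ] EuclideanSpace ℂ (Fin n))).holderL
    (volume.restrict (Ioo (0 : ℝ) r)) ⊤ 2 2 (hm.toLp _), fun f => ?_⟩
  rw [ContinuousLinearMap.holderL_apply_apply]
  filter_upwards [ContinuousLinearMap.coeFn_holder (r := 2) (ContinuousLinearMap.id ℂ
    (EuclideanSpace ℂ (Fin n) →L[ℂ] EuclideanSpace ℂ (Fin n))) (hm.toLp _) f, hm.coeFn_toLp]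
    with x h1 h2
  ext i j
  simp only [colFun, h1, Matrix.of_apply]
  rw [h2]
  simp only [ContinuousLinearMap.id_apply, Matrix.ofLp_toEuclideanCLM]
  rfl

lemma entrySum_mul_le {p q s : Type*} [Fintype p] [Fintype q] [Fintype s] (M : Matrix p q ℂ)
    (N : Matrix q s ℂ) : entrySum (M * N) ≤ entrySum M * entrySum N := by
  calc entrySum (M * N) ≤ ∑ i, ∑ k, ∑ j, ‖M i j‖ * ‖N j k‖ :=
        Finset.sum_le_sum fun i _ => Finset.sum_le_sum fun k _ => by
          rw [Matrix.mul_apply]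
          exact (norm_sum_le _ _).trans_eq (Finset.sum_congr rfl fun j _ => norm_mul _ _)
    _ = ∑ i, ∑ j, ‖M i j‖ * ∑ k, ‖N j k‖ := Finset.sum_congr rfl fun i _ => by
        rw [Finset.sum_comm]
        simp only [Finset.mul_sum]
    _ ≤ ∑ i, ∑ j, ‖M i j‖ * entrySum N := Finset.sum_le_sum fun i _ =>
        Finset.sum_le_sum fun j _ =>
          mul_le_mul_of_nonneg_left (row_le_entrySum N j) (norm_nonneg _)
    _ = _ := by simp only [entrySum, Finset.sum_mul]

/-- Volterra operators with separable kernels. -/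
lemma exists_separableVolterra {m : Type*} [Fintype m] (hr : 0 ≤ r)
    {a : ℝ → Matrix (Fin n) m ℂ} {b : ℝ → Matrix m (Fin n) ℂ} (ha : IsL2Mat r a)
    (hb : IsL2Mat r b) :
    ∃ T : L2 n r →L[ℂ] L2 n r, (∀ f, ∀ᵐ x ∂(volume.restrict (Ioo (0 : ℝ) r)),
      colFun (T f) x = a x * matInt 0 x (fun t => b t * colFun f t)) ∧ IsUnit (1 + T) := by
  obtain ⟨a', ha1, ha2, ha3⟩ := exists_isCoef_of_isL2Mat hr ha
  obtain ⟨b', hb1, hb2, hb3⟩ := exists_isCoef_of_isL2Mat hr hb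
  have hc : MemLp (fun x => entrySum (a' x) + entrySum (b' x)) 2
      (volume.restrict (Ioo (0 : ℝ) r)) := (memLp_entrySum ha2).add (memLp_entrySum hb2)
  have hc0 : ∀ x, 0 ≤ entrySum (a' x) + entrySum (b' x) := fun x =>
    add_nonneg (entrySum_nonneg _) (entrySum_nonneg _)
  have hm : ∀ i j, Measurable fun p : ℝ × ℝ => (a' p.1 * b' p.2) i j := fun i j =>
    measurable_mul_entry (M := fun p : ℝ × ℝ => a' p.1) (N := fun p : ℝ × ℝ => b' p.2)
      (fun i k => (ha1.measurable i k).comp measurable_fst)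
      (fun i k => (hb1.measurable i k).comp measurable_snd) i j
  have hk : ∀ x t, 0 < t → t ≤ x → x < r → entrySum (a' x * b' t)
      ≤ (entrySum (a' x) + entrySum (b' x)) * (entrySum (a' t) + entrySum (b' t)) :=
    fun x t _ _ _ => by
      refine (entrySum_mul_le _ _).trans ?_
      have h1 := entrySum_nonneg (a' x)
      have h2 := entrySum_nonneg (b' x)
      have h3 := entrySum_nonneg (a' t)
      have h4 := entrySum_nonneg (b' t)
      exact mul_le_mul (le_add_of_nonneg_right h2) (le_add_of_nonneg_left h3) h4 (add_nonneg h1 h2)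
  obtain ⟨T, hT, hU⟩ := exists_matrixVolterra (k := fun x t => a' x * b' t) hr hm hc hc0 hk
  refine ⟨T, fun f => ?_, hU⟩
  filter_upwards [hT f, ha3, ae_restrict_mem measurableSet_Ioo] with x h1 h2 hx
  have hx' := Ioo_subset_Icc_self hx
  have hi : ∀ i k, IntervalIntegrable (fun t => (b' t * colFun f t) i k) volume 0 x := by
    intro i k
    refine intervalIntegrable_mono (r := r) ?_ (zero_mem_Icc hx') hx'
    rw [intervalIntegrable_iff_integrableOn_Ioo_of_le hr]
    simp only [Matrix.mul_apply]
    exact integrable_finsetSum _ fun j _ => (hb2 i j).integrable_mul (isL2Mat_colFun f j k)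
  rw [h1, h2, matInt_congr_ae_restrict (f := fun t => b t * colFun f t)
    (g := fun t => b' t * colFun f t) (by filter_upwards [hb3] with t ht using by rw [ht]) hx',
    ← matInt_const_mul _ hi]
  simp only [Matrix.mul_assoc]

/-- The operator `A` of twofold integration. -/
lemma exists_opA (hr : 0 ≤ r) : ∃ A : L2 n r →L[ℂ] L2 n r,
    ∀ f, ∀ᵐ x ∂(volume.restrict (Ioo (0 : ℝ) r)),
      colFun (A f) x = matInt 0 x (fun t => ((t - x : ℝ) : ℂ) • colFun f t) := by
  have hk : ∀ x t, 0 < t → t ≤ x → x < r →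
      entrySum (((t - x : ℝ) : ℂ) • (1 : Matrix (Fin n) (Fin n) ℂ))
        ≤ (1 + r * entrySum (1 : Matrix (Fin n) (Fin n) ℂ))
          * (1 + r * entrySum (1 : Matrix (Fin n) (Fin n) ℂ)) := fun x t h1 h2 h3 => by
    have h4 : entrySum (((t - x : ℝ) : ℂ) • (1 : Matrix (Fin n) (Fin n) ℂ))
        = |t - x| * entrySum (1 : Matrix (Fin n) (Fin n) ℂ) := by
      simp only [entrySum, Matrix.smul_apply, norm_smul, Complex.norm_real, Finset.mul_sum,
        Real.norm_eq_abs]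
    have h5 := entrySum_nonneg (1 : Matrix (Fin n) (Fin n) ℂ)
    have h6 : |t - x| ≤ r := abs_le.2 ⟨by linarith, by linarith⟩
    rw [h4]
    nlinarith [mul_le_mul_of_nonneg_right h6 h5, mul_nonneg hr h5]
  obtain ⟨A, hA, -⟩ := exists_matrixVolterra
    (k := fun x t => ((t - x : ℝ) : ℂ) • (1 : Matrix (Fin n) (Fin n) ℂ)) hr (fun i j => by
      simp only [Matrix.smul_apply, smul_eq_mul]
      refine Measurable.mul_const ?_ _
      fun_prop) (memLp_const _) (fun x => by
        have := entrySum_nonneg (1 : Matrix (Fin n) (Fin n) ℂ)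
        positivity) hk
  refine ⟨A, fun f => ?_⟩
  simpa only [Matrix.smul_mul, Matrix.one_mul] using hA f

/-- Volterra operators with bounded kernels. -/
lemma exists_opKernel (hr : 0 ≤ r) {W : ℝ → ℝ → Matrix (Fin n) (Fin n) ℂ} {B : ℝ}
    (hW : IsBddKer r W B) : ∃ T : L2 n r →L[ℂ] L2 n r,
    (∀ f, ∀ᵐ x ∂(volume.restrict (Ioo (0 : ℝ) r)), colFun (T f) x = kerApp W (colFun f) x)
      ∧ IsUnit (1 + T) :=
  exists_matrixVolterra (c := fun _ => 1 + |(n * (n * B) : ℝ)|) hr hW.measurable (memLp_const _)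
    (fun _ => by positivity) fun x t h1 h2 h3 => by
      have h4 := hW.entrySum_le h1.le h2 h3.le
      nlinarith [le_abs_self (n * (n * B) : ℝ), abs_nonneg (n * (n * B) : ℝ)]

lemma intervalIntegral_apply {ι : Type*} [Fintype ι] {F : ℝ → EuclideanSpace ℂ ι} {x y : ℝ}
    (h : ∀ i, IntervalIntegrable (fun t => F t i) volume x y) (i : ι) :
    (∫ t in x..y, F t) i = ∫ t in x..y, F t i := by
  simp only [intervalIntegral, PiLp.sub_apply]
  rw [eval_integral_piLp fun i => (h i).1, eval_integral_piLp fun i => (h i).2]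

end ColFun

/-! ### The similarity -/

section Pointwise

variable {m₁ m₂ : ℕ} {r : ℝ} {β β' β'' : ℝ → Matrix (Fin m₂) (Fin m₁ ⊕ Fin m₂) ℂ}
  {u : ℝ → Matrix (Fin m₂) (Fin m₂) ℂ} {W : ℝ → ℝ → Matrix (Fin m₂) (Fin m₂) ℂ} {B : ℝ}
  {A K V : L2 m₂ r →L[ℂ] L2 m₂ r}

lemma isOpA_of_colFun (hr : 0 ≤ r) (hA : ∀ f, ∀ᵐ x ∂(volume.restrict (Ioo (0 : ℝ) r)),
    colFun (A f) x = matInt 0 x (fun t => ((t - x : ℝ) : ℂ) • colFun f t)) : IsOpA A := fun f => by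
  filter_upwards [hA f, ae_restrict_mem measurableSet_Ioo] with x h1 hx
  have hx' := Ioo_subset_Icc_self hx
  ext i
  rw [intervalIntegral_apply]
  · exact congrFun (congrFun h1 i) ()
  · intro i
    refine (intervalIntegrable_mono ((isCoef_colFun hr f).intervalIntegrable i ())
      (zero_mem_Icc hx') hx').continuousOn_mul ?_
    fun_prop

lemma isOpK_of_colFun (hr : 0 ≤ r) (hβ : IsContMat r β)
    (hK : ∀ f, ∀ᵐ x ∂(volume.restrict (Ioo (0 : ℝ) r)),
      colFun (K f) x = Complex.I • (β x * J m₁ m₂) * matInt 0 x (fun t => (β t)ᴴ * colFun f t)) :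
    IsOpK β K := fun f => by
  filter_upwards [hK f, ae_restrict_mem measurableSet_Ioo] with x h1 hx
  have hx' := Ioo_subset_Icc_self hx
  have h2 : ∀ l, (∫ t in (0 : ℝ)..x, Matrix.toEuclideanLin (β t)ᴴ (f t)) l
      = matInt 0 x (fun t => (β t)ᴴ * colFun f t) l () := fun l => by
    have h3 : ∀ l, IntervalIntegrable (fun t => ((β t)ᴴ * colFun f t) l ()) volume 0 x := fun l =>
      intervalIntegrable_mono ((hβ.conjTranspose.mul_isL2Mat
        (isL2Mat_colFun f)).intervalIntegrable hr l ()) (zero_mem_Icc hx') hx'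
    rw [intervalIntegral_apply h3]
    rfl
  ext i
  rw [Matrix.ofLp_toLpLin, Matrix.toLin'_apply]
  refine (congrFun (congrFun h1 i) ()).trans ?_
  simp only [Matrix.mul_apply, Matrix.mulVec, dotProduct, h2]

lemma isOpV_of_colFun (hr : 0 ≤ r) (hW : IsBddKer r W B)
    {𝒱 : ℝ → ℝ → Matrix (Fin m₂) (Fin m₂) ℂ}
    (h𝒱 : ∀ x ζ, 0 ≤ ζ → ζ ≤ x → x ≤ r → 𝒱 x ζ = W x ζ)
    (hV : ∀ f, ∀ᵐ x ∂(volume.restrict (Ioo (0 : ℝ) r)),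
      colFun (V f) x = u x * (colFun f x + kerApp W (colFun f) x)) : IsOpV u 𝒱 V := fun f => by
  filter_upwards [hV f, ae_restrict_mem measurableSet_Ioo] with x h1 hx
  have hx' := Ioo_subset_Icc_self hx
  have h2 : ∀ l, (∫ t in (0 : ℝ)..x, Matrix.toEuclideanLin (𝒱 x t) (f t)) l
      = kerApp W (colFun f) x l () := fun l => by
    have h0 : ∫ t in (0 : ℝ)..x, Matrix.toEuclideanLin (𝒱 x t) (f t)
        = ∫ t in (0 : ℝ)..x, Matrix.toEuclideanLin (W x t) (f t) :=
      intervalIntegral.integral_congr fun t ht => by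
        rw [uIcc_of_le hx.1.le] at ht
        simp only [h𝒱 x t ht.1 ht.2 hx'.2]
    rw [h0, intervalIntegral_apply fun i =>
      hW.intervalIntegrable_mul (isCoef_colFun hr f) hx' i ()]
    rfl
  ext i
  rw [Matrix.ofLp_toLpLin, Matrix.toLin'_apply]
  refine (congrFun (congrFun h1 i) ()).trans ?_
  simp only [Matrix.mul_apply, Matrix.mulVec, dotProduct, PiLp.add_apply, h2, Matrix.add_apply]
  rfl

lemma opA_eq_neg_secondPrimitive (hr : 0 ≤ r)
    (hA : ∀ f, ∀ᵐ x ∂(volume.restrict (Ioo (0 : ℝ) r)),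
      colFun (A f) x = matInt 0 x (fun t => ((t - x : ℝ) : ℂ) • colFun f t)) (f : L2 m₂ r) :
    ∀ᵐ x ∂(volume.restrict (Ioo (0 : ℝ) r)),
      colFun (A f) x = -secondPrimitive (colFun f) x := by
  filter_upwards [hA f, ae_restrict_mem measurableSet_Ioo] with x h1 hx
  rw [h1, ← matInt_sub_smul_eq (isCoef_colFun hr f).intervalIntegrable (Ioo_subset_Icc_self hx)]
  ext i k
  simp only [matInt, Matrix.of_apply, Matrix.neg_apply, Matrix.smul_apply, smul_eq_mul]
  rw [← intervalIntegral.integral_neg]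
  congr 1
  ext t
  push_cast
  ring

variable (hA : ∀ f, ∀ᵐ x ∂(volume.restrict (Ioo (0 : ℝ) r)),
  colFun (A f) x = -secondPrimitive (colFun f) x)

include hA in
lemma memU_opA (hr : 0 ≤ r) (f : L2 m₂ r) : MemU (A f) := by
  have h1 : IsL2Mat r (fun x => -colFun f x) := fun i k => (isL2Mat_colFun f i k).neg
  refine memU_iff.2 ⟨_, _, _, isUMat_secondPrimitive hr h1, ?_⟩
  filter_upwards [hA f] with x h2
  rw [h2, secondPrimitive_neg]

include hA in
-- The preimage is −G'': every element of 𝒰 with vanishing value and derivative at 0 lies in the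
-- range of A.
lemma exists_opA_eq (hr : 0 ≤ r) {G G' G'' : ℝ → Matrix (Fin m₂) Unit ℂ} (hG : IsUMat r G G' G'')
    (h0 : G 0 = 0) (h1 : G' 0 = 0) :
    ∃ s, ∀ᵐ x ∂(volume.restrict (Ioo (0 : ℝ) r)), colFun (A s) x = G x := by
  obtain ⟨s, hs⟩ := exists_colFun_eq (G := fun x => -G'' x) fun i k => (hG.isL2Mat i k).neg
  refine ⟨s, ?_⟩
  filter_upwards [hA s, ae_restrict_mem measurableSet_Ioo] with x h2 hx
  have hx' := Ioo_subset_Icc_self hx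
  rw [h2, secondPrimitive_congr_ae hs hx', hG.eq_secondPrimitive_of_zero hr h0 h1 hx',
    secondPrimitive_neg, neg_neg]

/-- Two differentiations of `K φ`. -/
lemma opK_eq_secondPrimitive (hr : 0 ≤ r) (hβ : IsUMat r β β' β'')
    (hβ₁ : ∀ x ∈ Icc (0 : ℝ) r, β x * J m₁ m₂ * (β x)ᴴ = 0)
    (hβ₂ : ∀ x ∈ Icc (0 : ℝ) r, β' x * J m₁ m₂ * (β x)ᴴ = Complex.I • 1)
    {φ : ℝ → Matrix (Fin m₂) Unit ℂ} (hφ : IsL2Mat r φ) {x : ℝ} (hx : x ∈ Icc 0 r) :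
    Complex.I • (β x * J m₁ m₂) * matInt 0 x (fun t => (β t)ᴴ * φ t)
      = secondPrimitive (fun s => Complex.I • (β'' s * J m₁ m₂)
          * matInt 0 s (fun t => (β t)ᴴ * φ t) - φ s) x := by
  have hb0 := hβ.isACMat hr
  have hb1 := hβ.isACMat_deriv hr
  have hq : IsL2Mat r (fun t => (β t)ᴴ * φ t) := hb0.isContMat.conjTranspose.mul_isL2Mat hφ
  have hw := isACMat_primitive (hq.intervalIntegrable hr)
  set w : ℝ → Matrix (Fin m₁ ⊕ Fin m₂) Unit ℂ := fun x => matInt 0 x (fun t => (β t)ᴴ * φ t)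
  have hw0 : w 0 = 0 := matInt_self 0
  have hJ0 := (hb0.mul hr (isACMat_const (J m₁ m₂))).smul Complex.I
  have hJ1 := (hb1.mul hr (isACMat_const (J m₁ m₂))).smul Complex.I
  simp only [Matrix.mul_zero, add_zero] at hJ0 hJ1
  have hL0 : IsACMat r (fun x => Complex.I • (β x * J m₁ m₂) * w x)
      (fun x => Complex.I • (β' x * J m₁ m₂) * w x) := by
    refine (hJ0.mul hr hw).congr hr (fun _ _ => rfl) ?_
    filter_upwards [ae_restrict_mem measurableSet_Ioo] with x hx
    rw [Matrix.smul_mul _ _ ((β x)ᴴ * φ x), ← Matrix.mul_assoc _ _ (φ x),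
      hβ₁ x (Ioo_subset_Icc_self hx), Matrix.zero_mul, smul_zero, add_zero]
  have hL1 : IsACMat r (fun x => Complex.I • (β' x * J m₁ m₂) * w x)
      (fun x => Complex.I • (β'' x * J m₁ m₂) * w x - φ x) := by
    refine (hJ1.mul hr hw).congr hr (fun _ _ => rfl) ?_
    filter_upwards [ae_restrict_mem measurableSet_Ioo] with x hx
    rw [Matrix.smul_mul _ _ ((β x)ᴴ * φ x), ← Matrix.mul_assoc _ _ (φ x),
      hβ₂ x (Ioo_subset_Icc_self hx), Matrix.smul_mul _ 1, Matrix.one_mul, smul_smul,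
      Complex.I_mul_I, neg_one_smul, ← sub_eq_add_neg]
  have hL2 : IsL2Mat r (fun x => Complex.I • (β'' x * J m₁ m₂) * w x - φ x) :=
    (((hβ.isL2Mat.mul_isContMat (isContMat_const _)).smul _).mul_isContMat hw.isContMat).sub hφ
  exact (isUMat_of_isACMat hL0 hL1 hL2).eq_secondPrimitive_of_zero hr
    (by simp only [hw0, Matrix.mul_zero]) (by simp only [hw0, Matrix.mul_zero]) hx

variable (hK : ∀ f, ∀ᵐ x ∂(volume.restrict (Ioo (0 : ℝ) r)),
  colFun (K f) x = Complex.I • (β x * J m₁ m₂) * matInt 0 x (fun t => (β t)ᴴ * colFun f t))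

include hA hK in
/-- `K = A (1 + T)` with `1 + T` invertible, hence the range of `A` lies in the range of `K`. -/
lemma exists_opK_eq_opA (hr : 0 ≤ r) (hβ : IsUMat r β β' β'')
    (hβ₁ : ∀ x ∈ Icc (0 : ℝ) r, β x * J m₁ m₂ * (β x)ᴴ = 0)
    (hβ₂ : ∀ x ∈ Icc (0 : ℝ) r, β' x * J m₁ m₂ * (β x)ᴴ = Complex.I • 1) (s : L2 m₂ r) :
    ∃ s', K s' = A s := by
  have ha : IsL2Mat r (fun x => (-Complex.I) • (β'' x * J m₁ m₂)) :=
    (hβ.isL2Mat.mul_isContMat (isContMat_const _)).smul _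
  have hb : IsL2Mat r (fun x => (β x)ᴴ) := (hβ.isACMat hr).isContMat.conjTranspose.isL2Mat
  -- T has the kernel −iβ''(x)jβ(t)*, so that Ks' is the negative second primitive of s' + Ts', that
  -- is, A(s' + Ts').
  obtain ⟨T, hT, hU⟩ := exists_separableVolterra hr ha hb
  obtain ⟨s', hs'⟩ := exists_add_apply_eq hU s
  refine ⟨s', ext_of_colFun ?_⟩
  have hcol : ∀ᵐ x ∂(volume.restrict (Ioo (0 : ℝ) r)), colFun s x
      = -(Complex.I • (β'' x * J m₁ m₂) * matInt 0 x (fun t => (β t)ᴴ * colFun s' t)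
        - colFun s' x) := by
    have h1 := colFun_add_apply_eq (f := s') (g := T s')
    rw [hs'] at h1
    filter_upwards [h1, hT s'] with x h2 h3
    rw [h2, h3, neg_smul, Matrix.neg_mul]
    abel
  filter_upwards [hK s', hA s, ae_restrict_mem measurableSet_Ioo] with x h1 h2 hx
  have hx' := Ioo_subset_Icc_self hx
  rw [h1, h2, opK_eq_secondPrimitive hr hβ hβ₁ hβ₂ (isL2Mat_colFun s') hx',
    secondPrimitive_congr_ae hcol hx', secondPrimitive_neg, neg_neg]

variable (hV : ∀ f, ∀ᵐ x ∂(volume.restrict (Ioo (0 : ℝ) r)),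
  colFun (V f) x = u x * (colFun f x + kerApp W (colFun f) x))

include hA hK hV in
/-- The intertwining relation `K V = V A`. -/
lemma opK_comp_opV (hr : 0 ≤ r) (hβ : IsUMat r β β' β'')
    (hβ₁ : ∀ x ∈ Icc (0 : ℝ) r, β x * J m₁ m₂ * (β x)ᴴ = 0)
    (hβ₂ : ∀ x ∈ Icc (0 : ℝ) r, β' x * J m₁ m₂ * (β x)ᴴ = Complex.I • 1)
    (hu : IsFundSol r (coefU β') u) {Ω : ℝ → Matrix (Fin m₁ ⊕ Fin m₂) (Fin m₁ ⊕ Fin m₂) ℂ}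
    (hΩ : IsFundSol r (coefΩ β β'') Ω)
    (hΩi : ∀ x ∈ Icc 0 r, Ω x * (Ω x)⁻¹ = 1) (hΩc : IsContMat r fun x => (Ω x)⁻¹)
    {v : ℝ → Matrix (Fin m₂) (Fin m₂) ℂ} {a : ℝ → Matrix (Fin m₂) (Fin m₁ ⊕ Fin m₂) ℂ}
    {b : ℝ → Matrix (Fin m₁ ⊕ Fin m₂) (Fin m₂) ℂ} (hS : IsSeriesKernel r v a b W B)
    (hvab : ∀ᵐ x ∂(volume.restrict (Ioo 0 r)), u₄ β' β'' u x = v x ∧ h₁ β'' u Ω x = a x ∧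
      h₂ β β' β'' u Ω x = b x) (f : L2 m₂ r) : K (V f) = V (A f) := by
  have hφ := isCoef_colFun hr f
  have hφ2 := isL2Mat_colFun f
  -- Here g represents Af, so uz represents V(Af) with z = g + 𝒱g, and up represents Vf with p = f +
  -- 𝒱f.
  obtain ⟨hz, hz0⟩ := hS.exists_intertwining hr hφ hφ2
    (g := fun x => -secondPrimitive (colFun f) x) fun _ _ => rfl
  obtain ⟨F, hF⟩ := hS.isBddKer.kerApp_isBddFun hφ hr
  have hp : IsL2Mat r (fun s => colFun f s + kerApp W (colFun f) s) := hφ2.add hF.isL2Mat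
  set g : ℝ → Matrix (Fin m₂) Unit ℂ := fun x => -secondPrimitive (colFun f) x
  refine ext_of_colFun ?_
  filter_upwards [hK (V f), hV (A f), hA f, ae_restrict_mem measurableSet_Ioo] with x h1 h2 h3 hx
  have hx' := Ioo_subset_Icc_self hx
  rw [h1, h2, h3, kerApp_congr_ae (h := g) (hA f) hx',
    ← opK_eq_unitary_mul hr hβ hβ₁ hβ₂ hu hΩ hΩi hΩc hz hz0 (matInt_self 0) hp ?_ hx']
  · congr 1
    refine matInt_congr_ae_restrict (r := r) ?_ hx'
    filter_upwards [hV f] with t ht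
    rw [ht]
  · filter_upwards [hvab, ae_restrict_mem measurableSet_Ioo] with y h4 hy
    have h5 : matInt 0 y (fun ξ => h₂ β β' β'' u Ω ξ * (g ξ + kerApp W g ξ))
        = matInt 0 y (fun ξ => b ξ * (g ξ + kerApp W g ξ)) :=
      matInt_congr_ae_restrict (r := r) (by
        filter_upwards [hvab] with t ht
        rw [ht.2.2]) (Ioo_subset_Icc_self hy)
    rw [h5, h4.1, h4.2.1]
    rfl

include hV in
/-- The image of an element of `𝒰` under `V`, with its initial data. -/
lemma exists_opV_eq (hr : 0 ≤ r) (hβ : IsUMat r β β' β'') (hu : IsFundSol r (coefU β') u)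
    {m : Type*} [Fintype m] {v : ℝ → Matrix (Fin m₂) (Fin m₂) ℂ} {a : ℝ → Matrix (Fin m₂) m ℂ}
    {b : ℝ → Matrix m (Fin m₂) ℂ} (hS : IsSeriesKernel r v a b W B) {f : L2 m₂ r}
    {G G' G'' : ℝ → Matrix (Fin m₂) Unit ℂ} (hG : IsUMat r G G' G'')
    (hf : ∀ᵐ x ∂(volume.restrict (Ioo (0 : ℝ) r)), colFun f x = G x) :
    ∃ H H' H'', IsUMat r H H' H'' ∧ H 0 = G 0 ∧ H' 0 = coefU β' 0 * G 0 + G' 0 ∧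
      ∀ᵐ x ∂(volume.restrict (Ioo (0 : ℝ) r)), colFun (V f) x = H x := by
  -- The integral part of V contributes a second primitive with zero data, so the initial data of
  -- the image come from u and G alone.
  obtain ⟨P, hP, hPW⟩ := hS.exists_kerApp_eq hr hG
  refine ⟨_, _, _, (isUMat_unitaryFactor hr hβ hu).mul hr (hG.add hr (isUMat_secondPrimitive hr hP)),
    ?_, ?_, ?_⟩
  · simp [secondPrimitive_zero, hu.zero hr]
  · simp [secondPrimitive_zero, hu.zero hr, matInt_self]
  · filter_upwards [hV f, hf, ae_restrict_mem measurableSet_Ioo] with x h1 h2 hx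
    have hx' := Ioo_subset_Icc_self hx
    rw [h1, h2, kerApp_congr_ae hf hx', hPW x hx']

lemma isUMat_affine (G₀ G₁ : Matrix (Fin m₂) Unit ℂ) :
    IsUMat r (fun x : ℝ => G₀ + (x : ℂ) • G₁) (fun _ => G₁) (fun _ => 0) :=
  isUMat_of_isACMat (fun i k => ⟨intervalIntegrable_const, fun x _ => by simp⟩)
    (isACMat_const G₁) (fun i k => by simp)

end Pointwise

/-! ### The inverse of V on the class 𝒰. -/

section Inverse

variable {m₁ m₂ : ℕ} {r : ℝ} {β β' β'' : ℝ → Matrix (Fin m₂) (Fin m₁ ⊕ Fin m₂) ℂ}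
  {u : ℝ → Matrix (Fin m₂) (Fin m₂) ℂ} {W : ℝ → ℝ → Matrix (Fin m₂) (Fin m₂) ℂ} {B : ℝ}
  {A K : L2 m₂ r →L[ℂ] L2 m₂ r} {V : L2 m₂ r ≃L[ℂ] L2 m₂ r}

/-- Subtracting the image of an affine f₀ leaves an element with zero data, hence As, which equals
some Ks'. Then V⁻¹f = f₀ + V⁻¹Ks' = f₀ + AV⁻¹s', and the range of A lies in 𝒰. No regularity of the
inverse kernel is needed. -/
lemma memU_symm (hr : 0 ≤ r) (hβ : IsUMat r β β' β'')
    (hβ₁ : ∀ x ∈ Icc (0 : ℝ) r, β x * J m₁ m₂ * (β x)ᴴ = 0)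
    (hβ₂ : ∀ x ∈ Icc (0 : ℝ) r, β' x * J m₁ m₂ * (β x)ᴴ = Complex.I • 1)
    (hu : IsFundSol r (coefU β') u)
    {m : Type*} [Fintype m] {v : ℝ → Matrix (Fin m₂) (Fin m₂) ℂ} {a : ℝ → Matrix (Fin m₂) m ℂ}
    {b : ℝ → Matrix m (Fin m₂) ℂ} (hS : IsSeriesKernel r v a b W B)
    (hA : ∀ f, ∀ᵐ x ∂(volume.restrict (Ioo (0 : ℝ) r)),
      colFun (A f) x = -secondPrimitive (colFun f) x)
    (hK : ∀ f, ∀ᵐ x ∂(volume.restrict (Ioo (0 : ℝ) r)),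
      colFun (K f) x = Complex.I • (β x * J m₁ m₂) * matInt 0 x (fun t => (β t)ᴴ * colFun f t))
    (hV : ∀ f, ∀ᵐ x ∂(volume.restrict (Ioo (0 : ℝ) r)),
      colFun (V f) x = u x * (colFun f x + kerApp W (colFun f) x))
    (hKV : ∀ f, K (V f) = V (A f)) {f : L2 m₂ r} (hf : MemU f) : MemU (V.symm f) := by
  obtain ⟨G, G', G'', hG, hfG⟩ := memU_iff.1 hf
  -- The slope compensates for u'(0) = `coefU β' 0`, so that Vf₀ has value G(0) and derivative G'(0)
  -- at 0.
  have haff := isUMat_affine (r := r) (G 0) (G' 0 - coefU β' 0 * G 0)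
  obtain ⟨f₀, hf₀⟩ := exists_colFun_eq (haff.isACMat hr).isContMat.isL2Mat
  obtain ⟨H, H', H'', hH, hH0, hH1, hVH⟩ := exists_opV_eq
    (V := (V : L2 m₂ r →L[ℂ] L2 m₂ r)) hV hr hβ hu hS haff hf₀
  obtain ⟨s, hs⟩ := exists_opA_eq hA hr (hG.sub hr hH) (by simp [hH0]) (by simp [hH1])
  obtain ⟨s', hs'⟩ := exists_opK_eq_opA hA hK hr hβ hβ₁ hβ₂ s
  have h1 : f = V f₀ + A s := by
    refine ext_of_colFun ?_
    filter_upwards [hfG, hVH, hs, colFun_add_apply_eq (f := V f₀) (g := A s)] with x h2 h3 h4 h5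
    have h3' : colFun (V f₀) x = H x := h3
    rw [h5, h2, h3', h4]
    abel
  have h2 : V.symm f = f₀ + A (V.symm s') := by
    rw [V.symm_apply_eq, map_add, ← hKV, V.apply_symm_apply, hs', h1]
  rw [h2]
  exact (memU_iff.2 ⟨_, _, _, haff, hf₀⟩).add hr (memU_opA hA hr _)

end Inverse

end

end CanonSim

theorem propositionA1 (m₁ m₂ : ℕ) (r : ℝ) (hr : 0 < r)
    (β β' β'' : ℝ → Matrix (Fin m₂) (Fin m₁ ⊕ Fin m₂) ℂ)
    (hβ : CanonSim.IsUMat r β β' β'')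
    (hβ₁ : ∀ x ∈ Set.Icc (0 : ℝ) r, β x * CanonSim.J m₁ m₂ * (β x)ᴴ = 0)
    (hβ₂ : ∀ x ∈ Set.Icc (0 : ℝ) r, β' x * CanonSim.J m₁ m₂ * (β x)ᴴ = Complex.I • 1) :
    ∃ (u : ℝ → Matrix (Fin m₂) (Fin m₂) ℂ)
      (Ω : ℝ → Matrix (Fin m₁ ⊕ Fin m₂) (Fin m₁ ⊕ Fin m₂) ℂ)
      (A K : CanonSim.L2 m₂ r →L[ℂ] CanonSim.L2 m₂ r)
      (V : CanonSim.L2 m₂ r ≃L[ℂ] CanonSim.L2 m₂ r),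
      -- the data of the construction, all of them uniquely determined by `β` on `[0,r]`
      CanonSim.IsFundSol r (CanonSim.coefU β') u ∧
      CanonSim.IsFundSol r (CanonSim.coefΩ β β'') Ω ∧
      CanonSim.IsOpA A ∧
      CanonSim.IsOpK β K ∧
      CanonSim.IsOpV u (CanonSim.simKernel β β' β'' u Ω) (V : CanonSim.L2 m₂ r →L[ℂ] CanonSim.L2 m₂ r) ∧
      -- the construction is meaningful and has the required form
      (∀ x ∈ Set.Icc (0 : ℝ) r, IsUnit (Ω x)) ∧
      (∀ x ζ : ℝ, 0 ≤ ζ → ζ ≤ x → x ≤ r →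
        Summable (fun k => CanonSim.simTerm β β' β'' u Ω k x ζ)) ∧
      (∃ C : ℝ, ∀ x ζ : ℝ, 0 ≤ ζ → ζ ≤ x → x ≤ r →
        ‖Matrix.toEuclideanCLM (n := Fin m₂) (𝕜 := ℂ)
          (CanonSim.simKernel β β' β'' u Ω x ζ)‖ ≤ C) ∧
      (∃ u' u'' : ℝ → Matrix (Fin m₂) (Fin m₂) ℂ, CanonSim.IsUMat r u u' u'') ∧
      (∀ x ∈ Set.Icc (0 : ℝ) r, (u x)ᴴ * u x = 1 ∧ u x * (u x)ᴴ = 1) ∧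
      -- `V` is a similarity between `A` and `K`
      (∀ f, K f = V (A (V.symm f))) ∧
      -- `V` and its inverse preserve the class `𝒰^{m₂}[0,r]`
      (∀ f, CanonSim.MemU f → CanonSim.MemU (V f)) ∧
      (∀ f, CanonSim.MemU f → CanonSim.MemU (V.symm f)) := by
  have hr0 : 0 ≤ r := hr.le
  obtain ⟨u, hu⟩ := CanonSim.exists_isFundSol hr0 (hβ.isL2Mat_coefU hr0)
  obtain ⟨Ω, hΩ⟩ := CanonSim.exists_isFundSol hr0 (hβ.isL2Mat_coefΩ hr0)
  obtain ⟨Z, hZ, hZΩ⟩ := hΩ.exists_inverse hr0 (hβ.isL2Mat_coefΩ hr0)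
  have hΩi : ∀ x ∈ Set.Icc 0 r, Ω x * (Ω x)⁻¹ = 1 := fun x hx => by
    rw [Matrix.inv_eq_left_inv (hZΩ x hx).1, (hZΩ x hx).2]
  have hΩc : CanonSim.IsContMat r fun x => (Ω x)⁻¹ := fun i k =>
    (hZ.isContMat i k).congr fun x hx =>
      congrFun (congrFun (Matrix.inv_eq_left_inv (hZΩ x hx).1) i) k
  obtain ⟨v, a, b, W, B, hS, hvab, hsum⟩ := CanonSim.exists_isSeriesKernel hr0
    (CanonSim.isL2Mat_u₄ hr0 hβ hu.isContMat)
    (CanonSim.isL2Mat_h₁ hβ hu.isContMat hΩ.isContMat)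
    (CanonSim.isL2Mat_h₂ hr0 hβ hu.isContMat hΩc)
  have hker : ∀ x ζ, 0 ≤ ζ → ζ ≤ x → x ≤ r →
      CanonSim.simKernel β β' β'' u Ω x ζ = W x ζ := fun x ζ h0 h1 h2 =>
    (hsum x ζ h0 h1 h2).tsum_eq
  have huni : ∀ x ∈ Set.Icc (0 : ℝ) r, (u x)ᴴ * u x = 1 ∧ u x * (u x)ᴴ = 1 := fun x hx =>
    hu.conjTranspose_mul_self hr0 (hβ.isL2Mat_coefU hr0) CanonSim.coefU_conjTranspose hx
  obtain ⟨A, hA⟩ := CanonSim.exists_opA (n := m₂) hr0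
  have hA' := CanonSim.opA_eq_neg_secondPrimitive hr0 hA
  obtain ⟨K, hK, -⟩ := CanonSim.exists_separableVolterra (r := r) hr0
    (a := fun x => Complex.I • (β x * CanonSim.J m₁ m₂)) (b := fun x => (β x)ᴴ)
    (((hβ.isACMat hr0).isContMat.mul (CanonSim.isContMat_const _)).smul _).isL2Mat
    (hβ.isACMat hr0).isContMat.conjTranspose.isL2Mat
  obtain ⟨T, hT, hTU⟩ := CanonSim.exists_opKernel hr0 hS.isBddKer
  obtain ⟨M, hM⟩ := CanonSim.exists_mulOperator hu.isContMat
  obtain ⟨M', hM'⟩ := CanonSim.exists_mulOperator hu.isContMat.conjTranspose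
  -- Multiplication by u is inverted by multiplication by u*.
  have hMU : IsUnit M := by
    refine ⟨⟨M, M', ContinuousLinearMap.ext fun f => CanonSim.ext_of_colFun ?_,
      ContinuousLinearMap.ext fun f => CanonSim.ext_of_colFun ?_⟩, rfl⟩
    · filter_upwards [hM (M' f), hM' f, ae_restrict_mem measurableSet_Ioo] with x h1 h2 hx
      change CanonSim.colFun (M (M' f)) x = CanonSim.colFun f x
      rw [h1, h2, ← Matrix.mul_assoc, (huni x (Set.Ioo_subset_Icc_self hx)).2, Matrix.one_mul]
    · filter_upwards [hM' (M f), hM f, ae_restrict_mem measurableSet_Ioo] with x h1 h2 hx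
      change CanonSim.colFun (M' (M f)) x = CanonSim.colFun f x
      rw [h1, h2, ← Matrix.mul_assoc, (huni x (Set.Ioo_subset_Icc_self hx)).1, Matrix.one_mul]
  -- V is the product of multiplication by u and I plus the Volterra operator with kernel 𝒱; both
  -- factors are invertible.
  obtain ⟨S, hSV⟩ := hMU.mul hTU
  set V : CanonSim.L2 m₂ r ≃L[ℂ] CanonSim.L2 m₂ r := ContinuousLinearEquiv.unitsEquiv ℂ _ S
  have hV : ∀ f, ∀ᵐ x ∂(volume.restrict (Set.Ioo (0 : ℝ) r)), CanonSim.colFun (V f) x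
      = u x * (CanonSim.colFun f x + CanonSim.kerApp W (CanonSim.colFun f) x) := by
    intro f
    have h1 : V f = M (f + T f) := by
      change (S : CanonSim.L2 m₂ r →L[ℂ] CanonSim.L2 m₂ r) f = _
      rw [hSV]
      rfl
    filter_upwards [hM (f + T f), CanonSim.colFun_add_apply_eq (f := f) (g := T f), hT f]
      with x h2 h3 h4
    rw [h1, h2, h3, h4]
  have hKV : ∀ f, K (V f) = V (A f) := CanonSim.opK_comp_opV
    (V := (V : CanonSim.L2 m₂ r →L[ℂ] CanonSim.L2 m₂ r)) hA' hK hV hr0 hβ hβ₁ hβ₂ hu hΩ hΩi hΩc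
    hS hvab
  refine ⟨u, Ω, A, K, V, hu, hΩ, CanonSim.isOpA_of_colFun hr0 hA,
    CanonSim.isOpK_of_colFun hr0 (hβ.isACMat hr0).isContMat hK,
    CanonSim.isOpV_of_colFun hr0 hS.isBddKer hker hV,
    fun x hx => ⟨⟨Ω x, Z x, (hZΩ x hx).2, (hZΩ x hx).1⟩, rfl⟩,
    fun x ζ h0 h1 h2 => (hsum x ζ h0 h1 h2).summable,
    ⟨m₂ * (m₂ * B), fun x ζ h0 h1 h2 => ?_⟩,
    ⟨_, _, CanonSim.isUMat_unitaryFactor hr0 hβ hu⟩, huni, fun f => ?_, fun f hf => ?_,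
    fun f hf => CanonSim.memU_symm hr0 hβ hβ₁ hβ₂ hu hS hA' hK hV hKV hf⟩
  · rw [hker x ζ h0 h1 h2]
    exact (CanonSim.norm_toEuclideanCLM_le _).trans (hS.isBddKer.entrySum_le h0 h1 h2)
  · rw [← hKV, V.apply_symm_apply]
  · obtain ⟨G, G', G'', hG, hfG⟩ := CanonSim.memU_iff.1 hf
    obtain ⟨H, H', H'', hH, -, -, hVH⟩ := CanonSim.exists_opV_eq
      (V := (V : CanonSim.L2 m₂ r →L[ℂ] CanonSim.L2 m₂ r)) hV hr0 hβ hu hS hG hfG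
    exact CanonSim.memU_iff.2 ⟨H, H', H'', hH, hVH⟩
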